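/- **Setting.** Let $M$ be a smooth ($C^\infty$, Hausdorff, second countable) manifold of dimension $m\ge 2$. A Jacobi structure on $M$ is a pair $(\Lambda,E)$ of a smooth bivector field and a smooth vector field with $[\Lambda,E]=0$ and $[\Lambda,\Lambda]=2E\wedge\Lambda$ (Schouten–Nijenhuis bracket, with the sign for which $[\Lambda,\Lambda](df,dg,dh)=2\big(\Lambda(d\Lambda(df,dg),dh)+\text{cyclic}\big)$). Put $\{f,g\}=\Lambda(df,dg)+fE(g)-gE(f)$ and $X_f=\Lambda^\sharp(df)+fE$, where $\beta(\Lambda^\sharp\alpha)=\Lambda(\alpha,\beta)$. Let $H\in C^\infty(M)$. A *Jacobi $C^\infty$-structure* for $H$ is an ordered family $(f_1,\dots,f_{m-2})$ of smooth functions on $M$ such that, with $f_0=H$, for some open dense $U\subseteq M$: 1. $X_{f_0},\dots,X_{f_{m-2}}$ are linearly independent at every point of $U$; 2. for all $j>i\ge 0$ there is $F_{ji}\in C^\infty(\mathbb R^{j+1})$ with $\{f_j,f_i\}=F_{ji}(f_0,\dots,f_j)$ on $M$, and 3. $\big(F_{ji}(f_0,\dots,f_j)-\sum_{k=0}^{j}f_k\,\tfrac{\partial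 F_{ji}}{\partial u_k}(f_0,\dots,f_j)\big)E$ is, near every point of $U$, a combination of $X_{f_0},\dots,X_{f_j}$ with smooth coefficients. For an open set $V$, a distribution $D$ on $V$ is a $C^\infty(V)$-module of smooth vector fields on $V$ of constant rank. A smooth vector field $X$ on $V$ is a *$C^\infty$-symmetry* of $D$ if it is independent of $D$ at every point of $V$ and $[X,D]\subseteq D\oplus\langle X\rangle$. If $D$ has rank $m-r$, a family $(X_1,\dots,X_r)$ is a *$C^\infty$-structure* for $D$ if each $X_j$ is a $C^\infty$-symmetry of $D\oplus\langle X_1,\dots,X_{j-1}\rangle$. **Theorem (exact integration on Jacobi manifolds).** Suppose that $H$ admits a Jacobi $C^\infty$-structure $(f_1,\dots,f_{m-2})$. Call $(V,R)$ a *completion* if $V\subseteq M$ is open, $R$ is a smooth vector field on $V$, and $X_H,X_{f_1},\dots,X_{f_{m-2}},R$ are linearly independent at every point of $V$. Then: * **(A)** There is a completion $(V,R)$ with $V$ dense in $M$ for which $V$ carries a volume form. Moreover every point at which $X_H,X_{f_1},\dots,X_{f_{m-2}}$ are linearly independent lies in $V$ for some completion $(V,R)$ for which $V$ carries a volume form.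 * **(B)** For every completion $(V,R)$, the family $(X_{f_1},\dots,X_{f_{m-2}},R)$ is a $C^\infty$-structure on $V$ for $\mathcal D_H=\langle X_H\rangle$. * **(C)** For every completion $(V,R)$ and every volume form $\Omega$ on $V$, put $X_0=X_H$, $X_i=X_{f_i}$ for $1\le i\le m-2$, and $X_{m-1}=R$. The motion on $V$ is integrated by the $m-1$ completely integrable Pfaffian equations $\omega_i\equiv 0$ with $$\omega_i=\Omega(X_0,\dots,\widehat{X_i},\dots,X_{m-1},\,\cdot\,),\qquad 1\le i\le m-1,$$ solved in the order $i=m-1,m-2,\dots,1$. That is: * the $\omega_i$ are smooth and pointwise linearly independent on $V$, with common kernel $\langle X_H\rangle$, and $d\omega_i=\sum_{l\ge i}\theta_l\wedge\omega_l$ on $V$ for some smooth one-forms $\theta_l$ depending on $i$; * call $I_i$ a *solution of the $i$-th equation* on an open $W\subseteq V$, given $I_{i+1},\dots,I_{m-1}$, if $I_i\in C^\infty(W)$ and, at every point of $W$, on the tangent space of the common level set $\Sigma$ of $I_{i+1},\dots,I_{m-1}$ (the common kernel of their differentials) one has $dI_i\ne 0$ and $\omega_i\wedge dI_i=0$. Whenever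 $I_{i+1},\dots,I_{m-1}$ are successive solutions on an open $W\subseteq V$, the $i$-th equation has a solution on a neighbourhood of each point of $W$; * for every full sequence of successive solutions $I_1,\dots,I_{m-1}$ on an open $W\subseteq V$, the common level sets are the integral curves of $\mathcal D_H$. Precisely, at every point of $W$ the $dI_i$ are linearly independent with common kernel $\langle X_H\rangle$. Each $I_i$ is constant along every integral curve of $X_H$ in $W$ defined on an open interval. Every $x\in W$ has an open neighbourhood $W'\subseteq W$ in which the common level set of $I_1,\dots,I_{m-1}$ through $x$ equals the image $\gamma((-\varepsilon,\varepsilon))$ of an integral curve $\gamma$ of $X_H$ with $\gamma(0)=x$, for some $\varepsilon>0$. -/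

import Mathlib

open scoped Manifold ContDiff
open Module Set

noncomputable section

namespace JacobiCinf

section Basic

variable (d : ℕ) (M : Type*) [TopologicalSpace M] [ChartedSpace (EuclideanSpace ℝ (Fin d)) M]

/-- Vector fields on the `d`-dimensional manifold `M` (smoothness is a separate condition). -/
abbrev VField := ∀ x : M, TangentSpace (𝓡 d) x

/-- One-forms on `M` (smoothness is a separate condition). -/
abbrev OneForm := ∀ x : M, Dual ℝ (TangentSpace (𝓡 d) x)

/-- Forms of degree `d = dim M` on `M` (smoothness is a separate condition). -/
abbrev TopForm := ∀ x : M, (TangentSpace (𝓡 d) x) [⋀^Fin d]→ₗ[ℝ] ℝ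

end Basic

section Calculus

variable {d : ℕ} {M : Type*} [TopologicalSpace M] [ChartedSpace (EuclideanSpace ℝ (Fin d)) M]

/-- The real function `f` is `C^∞` on the set `V`. -/
abbrev SmoothFnOn (d : ℕ) {M : Type*} [TopologicalSpace M]
    [ChartedSpace (EuclideanSpace ℝ (Fin d)) M] (V : Set M) (f : M → ℝ) : Prop :=
  ContMDiffOn (𝓡 d) 𝓘(ℝ, ℝ) ∞ f V

/-- The differential of a real function, as a one-form. -/
def dif (f : M → ℝ) : OneForm d M := fun x => (mvfderiv (𝓡 d) f x).toLinearMap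

/-- The derivative `Y(f)` of the function `f` along the vector field `Y`. -/
def der (Y : VField d M) (f : M → ℝ) : M → ℝ := fun x => dif f x (Y x)

/-- The Lie bracket `[Y, Z]` of two vector fields. -/
def lieBr (Y Z : VField d M) : VField d M := VectorField.mlieBracket (𝓡 d) Y Z

variable [IsManifold (𝓡 d) ∞ M]

/-- The vector field `Y` is `C^∞` on the set `V`. -/
def SmoothVFOn (V : Set M) (Y : VField d M) : Prop :=
  ContMDiffOn (𝓡 d) (𝓡 d).tangent ∞ (fun x => (⟨x, Y x⟩ : TangentBundle (𝓡 d) M)) V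

/-- The one-form `η` is `C^∞` on `V`: it takes `C^∞` vector fields on `V` to `C^∞` functions. -/
def SmoothFormOn (V : Set M) (η : OneForm d M) : Prop :=
  ∀ Y : VField d M, SmoothVFOn V Y → SmoothFnOn d V (fun x => η x (Y x))

/-- A volume form on `V`: a `C^∞` form of top degree that vanishes nowhere on `V`. -/
def IsVolumeFormOn (V : Set M) (Ω : TopForm d M) : Prop :=
  (∀ Y : Fin d → VField d M, (∀ i, SmoothVFOn V (Y i)) →
    SmoothFnOn d V (fun x => Ω x (fun i => Y i x))) ∧
  ∀ x ∈ V, Ω x ≠ 0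

/-- The exterior derivative of a one-form, evaluated on two vector fields:
`dη(Y, Z) = Y(η(Z)) - Z(η(Y)) - η([Y, Z])`. -/
def extD (η : OneForm d M) (Y Z : VField d M) : M → ℝ := fun x =>
  der Y (fun y => η y (Z y)) x - der Z (fun y => η y (Y y)) x - η x (lieBr Y Z x)

/-- The wedge product of two one-forms, evaluated on two vector fields. -/
def wedge (α β : OneForm d M) (Y Z : VField d M) : M → ℝ := fun x =>
  α x (Y x) * β x (Z x) - α x (Z x) * β x (Y x)

/-- The `C^∞(V)`-module `⟨Y_i⟩` of vector fields on `V` generated by a finite family. -/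
def moduleSpan {ι : Type*} [Fintype ι] (V : Set M) (Y : ι → VField d M) : Set (VField d M) :=
  {Z | ∃ c : ι → M → ℝ, (∀ i, SmoothFnOn d V (c i)) ∧ ∀ x ∈ V, Z x = ∑ i, c i x • Y i x}

/-- The sum, over `V`, of two modules of vector fields. -/
def moduleSum (V : Set M) (D D' : Set (VField d M)) : Set (VField d M) :=
  {Z | ∃ Y ∈ D, ∃ Y' ∈ D', ∀ x ∈ V, Z x = Y x + Y' x}

/-- The subspace `D_x = {Y(x) | Y ∈ D}` of the tangent space. -/
def fibre (D : Set (VField d M)) (x : M) : Submodule ℝ (TangentSpace (𝓡 d) x) :=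
  Submodule.span ℝ {v | ∃ Y ∈ D, Y x = v}

/-- `X` is a `C^∞`-symmetry over `V` of the distribution `D`:
it is independent of `D` at every point of `V`, and `[X, D] ⊆ D ⊕ ⟨X⟩`. -/
def IsCinfSymmetry (V : Set M) (D : Set (VField d M)) (X : VField d M) : Prop :=
  SmoothVFOn V X ∧
  (∀ x ∈ V, X x ∉ fibre D x) ∧
  ∀ Y ∈ D, lieBr X Y ∈ moduleSum V D (moduleSpan V (fun _ : Fin 1 => X))

/-- `(X_1, …, X_r)` is a `C^∞`-structure over `V` for the distribution `D`: `D` has constant rank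
`d - r`, and each `X_j` is a `C^∞`-symmetry of `D ⊕ ⟨X_1, …, X_{j-1}⟩`. -/
def IsCinfStructure {r : ℕ} (V : Set M) (D : Set (VField d M)) (X : Fin r → VField d M) : Prop :=
  (∀ x ∈ V, finrank ℝ (fibre D x) + r = d) ∧
  ∀ j : Fin r, IsCinfSymmetry V
    (moduleSum V D (moduleSpan V (fun i : {i : Fin r // i < j} => X i.1))) (X j)

/-- The tangent space at `x` of the level sets of the functions `g_l`, `l > i`:
the common kernel of their differentials. -/
def levelTangent {r : ℕ} (g : Fin r → M → ℝ) (i : Fin r) (x : M) :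
    Submodule ℝ (TangentSpace (𝓡 d) x) :=
  ⨅ l : {l : Fin r // i < l}, LinearMap.ker (dif (g l.1) x)

/-- The function `g_i` is on `W` a (regular) solution of the Pfaffian equation `η_i ≡ 0` restricted
to the level sets `Σ` of the functions `g_l`, `l > i`: at each point `dg_i` does not vanish
on `TΣ`, and `η_i|_Σ ∧ d(g_i|_Σ) = 0`. -/
def SolvesPfaffian {r : ℕ} (W : Set M) (η : Fin r → OneForm d M) (g : Fin r → M → ℝ)
    (i : Fin r) : Prop :=
  SmoothFnOn d W (g i) ∧
  ∀ x ∈ W,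
    (∃ v ∈ levelTangent (d := d) g i x, dif (g i) x v ≠ 0) ∧
    ∀ v ∈ levelTangent (d := d) g i x, ∀ w ∈ levelTangent (d := d) g i x,
      η i x v * dif (g i) x w - η i x w * dif (g i) x v = 0

/-- The motions of the vector field `X` on the open set `V` are integrated by the ordered sequence
`η_1, …, η_r` of completely integrable Pfaffian equations, solved from the last one to the first,
each one on the level sets of the solutions of those already solved. -/
structure IntegratedByPfaffians {r : ℕ} (V : Set M) (X : VField d M)
    (η : Fin r → OneForm d M) : Prop where
  smooth : ∀ i, SmoothFormOn V (η i)
  independent : ∀ x ∈ V, LinearIndependent ℝ (fun i => η i x)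
  annihilator : ∀ x ∈ V, (⨅ i, LinearMap.ker (η i x)) = Submodule.span ℝ {X x}
  /-- `dη_i = 0` modulo `⟨η_i, …, η_r⟩`: there are smooth one-forms `θ_l` with
  `dη_i = ∑_{l ≥ i} θ_l ∧ η_l`. -/
  closed_mod : ∀ i, ∃ θ : Fin r → OneForm d M, (∀ l, SmoothFormOn V (θ l)) ∧
    ∀ Y Z : VField d M, SmoothVFOn V Y → SmoothVFOn V Z → ∀ x ∈ V,
      extD (η i) Y Z x = ∑ l ∈ Finset.Ici i, wedge (θ l) (η l) Y Z x
  /-- Whatever solutions of the equations after the `i`-th have been found on an open set `W`,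
  the `i`-th one, restricted to their level sets, can be solved near every point of `W`. -/
  solvable : ∀ (i : Fin r) (W : Set M), IsOpen W → W ⊆ V → ∀ g : Fin r → M → ℝ,
    (∀ l, i < l → SolvesPfaffian W η g l) → ∀ x ∈ W,
      ∃ W' : Set M, IsOpen W' ∧ x ∈ W' ∧ W' ⊆ W ∧
        ∃ h : M → ℝ, SolvesPfaffian W' η (Function.update g i h) i
  /-- The common level sets of a full sequence of solutions are integral curves of `⟨X⟩`. -/
  level_tangent : ∀ W : Set M, IsOpen W → W ⊆ V → ∀ g : Fin r → M → ℝ,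
    (∀ i, SolvesPfaffian W η g i) → ∀ x ∈ W,
      LinearIndependent ℝ (fun i => dif (d := d) (g i) x) ∧
      (⨅ i, LinearMap.ker (dif (d := d) (g i) x)) = Submodule.span ℝ {X x}
  /-- Every solution of the equations of motion stays in one common level set. -/
  motion_in_level : ∀ W : Set M, IsOpen W → W ⊆ V → ∀ g : Fin r → M → ℝ,
    (∀ i, SolvesPfaffian W η g i) → ∀ (a b : ℝ) (γ : ℝ → M),
      IsMIntegralCurveOn (I := 𝓡 d) γ X (Ioo a b) → (∀ t ∈ Ioo a b, γ t ∈ W) →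
      ∀ i, ∀ s ∈ Ioo a b, ∀ t ∈ Ioo a b, g i (γ s) = g i (γ t)
  /-- Locally the common level set through a point is exactly the trajectory of the point. -/
  level_is_motion : ∀ W : Set M, IsOpen W → W ⊆ V → ∀ g : Fin r → M → ℝ,
    (∀ i, SolvesPfaffian W η g i) → ∀ x ∈ W,
      ∃ W' : Set M, IsOpen W' ∧ x ∈ W' ∧ W' ⊆ W ∧
        ∃ (ε : ℝ) (γ : ℝ → M), 0 < ε ∧ γ 0 = x ∧
          IsMIntegralCurveOn (I := 𝓡 d) γ X (Ioo (-ε) ε) ∧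
          γ '' Ioo (-ε) ε = {y ∈ W' | ∀ i, g i y = g i x}

variable (d M) in
/-- A smooth bivector field `Λ` on `M`, given by the skew maps
`Λ^♯ : T*_x M → T_x M`, where `β(Λ^♯ α) = Λ(α, β)`. -/
structure Bivector where
  sharp : ∀ x : M, Dual ℝ (TangentSpace (𝓡 d) x) →ₗ[ℝ] TangentSpace (𝓡 d) x
  skew : ∀ (x : M) (α : Dual ℝ (TangentSpace (𝓡 d) x)), α (sharp x α) = 0
  smooth : ∀ f : M → ℝ, SmoothFnOn d univ f → SmoothVFOn univ (fun x => sharp x (dif f x))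

/-- The function `Λ(df, dg)`. -/
def Bivector.pair (Λ : Bivector d M) (f g : M → ℝ) : M → ℝ := fun x =>
  dif g x (Λ.sharp x (dif f x))

/-- The Schouten–Nijenhuis bracket `[P, Y]` of a bivector field and a vector field, evaluated on
`(df, dg)`. Multivector fields are identified with skew multiderivations of `C^∞(M)`. -/
def schoutenBV (P : Bivector d M) (Y : VField d M) (f g : M → ℝ) : M → ℝ := fun x =>
  P.pair (der Y f) g x - P.pair (der Y g) f x - der Y (P.pair f g) x

/-- The Schouten–Nijenhuis bracket `[P, Q]` of two bivector fields, evaluated on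
`(df, dg, dh)`. -/
def schoutenBB (P Q : Bivector d M) (f g h : M → ℝ) : M → ℝ := fun x =>
  (P.pair (Q.pair f g) h x + P.pair (Q.pair g h) f x + P.pair (Q.pair h f) g x) +
  (Q.pair (P.pair f g) h x + Q.pair (P.pair g h) f x + Q.pair (P.pair h f) g x)

/-- The trivector field `Y ∧ P`, evaluated on `(df, dg, dh)`. -/
def wedgeVB (Y : VField d M) (P : Bivector d M) (f g h : M → ℝ) : M → ℝ := fun x =>
  der Y f x * P.pair g h x + der Y g x * P.pair h f x + der Y h x * P.pair f g x

variable (d M) in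
/-- A Jacobi structure `(Λ, E)` on `M`: `[Λ, E] = 0` and `[Λ, Λ] = 2 E ∧ Λ`. -/
structure JacobiStructure where
  biv : Bivector d M
  reeb : VField d M
  smooth_reeb : SmoothVFOn univ reeb
  schouten_reeb : ∀ f g : M → ℝ, SmoothFnOn d univ f → SmoothFnOn d univ g →
    ∀ x, schoutenBV biv reeb f g x = 0
  schouten_self : ∀ f g h : M → ℝ, SmoothFnOn d univ f → SmoothFnOn d univ g →
    SmoothFnOn d univ h → ∀ x, schoutenBB biv biv f g h x = 2 * wedgeVB reeb biv f g h x

/-- The Jacobi bracket `{f, g} = Λ(df, dg) + f E(g) - g E(f)`. -/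
def JacobiStructure.bracket (J : JacobiStructure d M) (f g : M → ℝ) : M → ℝ := fun x =>
  J.biv.pair f g x + f x * der J.reeb g x - g x * der J.reeb f x

/-- The Hamiltonian vector field `X_f = Λ^♯(df) + f E`. -/
def JacobiStructure.ham (J : JacobiStructure d M) (f : M → ℝ) : VField d M := fun x =>
  J.biv.sharp x (dif f x) + f x • J.reeb x

/-- The vector field `(F(f_0, …, f_j) - ∑_k f_k ∂F/∂u_k(f_0, …, f_j)) E`. -/
def JacobiStructure.reebTerm (J : JacobiStructure d M) {k : ℕ} (F : (Fin k → ℝ) → ℝ)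
    (f : Fin k → M → ℝ) : VField d M := fun x =>
  (F (fun a => f a x) -
    ∑ a, f a x * fderiv ℝ F (fun b => f b x) (Pi.single a 1)) • J.reeb x

end Calculus

section Systems

variable {n : ℕ} {M : Type*} [TopologicalSpace M]
  [ChartedSpace (EuclideanSpace ℝ (Fin (n + 2))) M] [IsManifold (𝓡 (n + 2)) ∞ M]

/-- The family `(f_0, f_1, …, f_n)` with `f_0 = H`. -/
def family (H : M → ℝ) (f : Fin n → M → ℝ) : Fin (n + 1) → M → ℝ := Fin.cons H f

/-- The first members `(f_0, …, f_j)` of a family. -/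
def initial (f : Fin (n + 1) → M → ℝ) (j : Fin (n + 1)) : Fin (j.1 + 1) → M → ℝ :=
  fun k => f (Fin.castLE j.2 k)

/-- `(f_1, …, f_n)` is a Jacobi `C^∞`-structure for the Hamiltonian `H` on the Jacobi manifold
`(M, J)` of dimension `m = n + 2`. -/
def IsJacobiCinfStructure (J : JacobiStructure (n + 2) M) (H : M → ℝ) (f : Fin n → M → ℝ) :
    Prop :=
  (∀ i, SmoothFnOn (n + 2) univ (f i)) ∧
  ∃ U : Set M, IsOpen U ∧ Dense U ∧
    (∀ x ∈ U, LinearIndependent ℝ (fun i => J.ham (family H f i) x)) ∧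
    ∀ i j : Fin (n + 1), i < j → ∃ F : (Fin (j.1 + 1) → ℝ) → ℝ, ContDiff ℝ ∞ F ∧
      (∀ x, J.bracket (family H f j) (family H f i) x =
        F (fun k => initial (family H f) j k x)) ∧
      ∀ x ∈ U, ∃ W : Set M, IsOpen W ∧ x ∈ W ∧
        J.reebTerm F (initial (family H f) j) ∈
          moduleSpan W (fun k => J.ham (initial (family H f) j k))

/-- The vector fields `(X_H, X_{f_1}, …, X_{f_n}, R)`. -/
def hamFrame (J : JacobiStructure (n + 2) M) (H : M → ℝ) (f : Fin n → M → ℝ)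
    (R : VField (n + 2) M) : Fin (n + 2) → VField (n + 2) M :=
  Fin.snoc (α := fun _ => VField (n + 2) M) (fun i : Fin (n + 1) => J.ham (family H f i)) R

/-- `V` is open, `R` is a `C^∞` vector field on `V`, and `X_H, X_{f_1}, …, X_{f_n}, R` are
linearly independent at every point of `V`. -/
def IsCompletion (J : JacobiStructure (n + 2) M) (H : M → ℝ) (f : Fin n → M → ℝ)
    (V : Set M) (R : VField (n + 2) M) : Prop :=
  IsOpen V ∧ SmoothVFOn V R ∧ ∀ x ∈ V, LinearIndependent ℝ (fun i => hamFrame J H f R i x)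

/-- The one-forms `η_i = Ω(X_0, …, X_{i-1}, X_{i+1}, …, X_{n+1}, ·)`, `1 ≤ i ≤ n + 1`, obtained by
contracting `Ω` with all but one of the vector fields `X_0, …, X_{n+1}`
(`η_i` is numbered from `0` in the code). -/
def pfaffianForms (Ω : TopForm (n + 2) M) (X : Fin (n + 2) → VField (n + 2) M) :
    Fin (n + 1) → OneForm (n + 2) M := fun i x =>
  (Ω x).toMultilinearMap.toLinearMap
    (Fin.snoc (α := fun _ => TangentSpace (𝓡 (n + 2)) x)
      (fun l : Fin (n + 1) => X (i.succ.succAbove l) x) 0) (Fin.last (n + 1))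

end Systems

end JacobiCinf

end

/-! Everything reduces to one property of the frame `X_0 = X_H, X_1, …, X_n, X_{n+1} = R`, recorded
as `SolvableFrame`: every initial segment spans an involutive distribution.

For a Jacobi structure `[X_f, X_g] = X_{{f,g}}` (`lieBr_ham`), and the chain rule for Hamiltonian
fields (`ham_comp`) gives `X_{F(f_0,…,f_j)} = ∑ ∂_kF X_{f_k} + (F - ∑ f_k ∂_kF) E`. Conditions 2 and
3 therefore put `[X_{f_j}, X_{f_i}]` in the span of `X_{f_0}, …, X_{f_j}` at the points of `U`. The
components of the bracket in a frame are continuous and `U` is dense, so this persists on all of `V`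
(`IsCompletion.solvableFrame`). Nothing is required of `R`, since no member of the frame follows it.
The `C^∞`-structure is then the Leibniz rule.

The forms `ω_i` are nowhere vanishing multiples of the dual coframe without its first member.
Involutivity says `dω_i(X_a, X_b) = 0` for `a, b < i`, which is closedness modulo `ω_i, ω_{i+1}, …`.
A solution of the `i`-th equation is a function annihilated by `X_0, …, X_{i-1}` but not by `X_i`;
it comes from Frobenius' theorem and does not depend on the solutions already chosen. Conversely,
descending induction shows that later solutions have the same common kernel as the later coframe
members (`forall_dif_eq_zero_iff`), so a full sequence has independent differentials with common
kernel `⟨X_H⟩`. Adding a function increasing along `X_H` makes the family locally injective, which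
identifies level sets with trajectories.

Frobenius is proved by adjoining one field at a time: the new field, normalized, descends to the
quotient by the previous leaves and is straightened there by a flow box (`frobenius_step`). The
smooth flow this needs comes from the inverse function theorem on the Banach space of continuous
curves on the unit interval.

A dense completion with a volume form is obtained by Zorn's lemma on families of disjoint open
pieces, where no compatibility between pieces is needed. -/

noncomputable section

namespace JacobiCinf

/-! ### Composition operators on spaces of curves, and the inverse function theorem. -/

section CurveSpace

open Filter Topology

universe u

variable {K : Type*} [TopologicalSpace K] [CompactSpace K]
  {E F : Type u} [NormedAddCommGroup E] [NormedSpace ℝ E] [NormedAddCommGroup F] [NormedSpace ℝ F]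

/-- Pointwise application of a continuous family of operators to a continuous family of vectors. -/
def applyCLM (K : Type*) [TopologicalSpace K] [CompactSpace K] (E F : Type u)
    [NormedAddCommGroup E] [NormedSpace ℝ E] [NormedAddCommGroup F] [NormedSpace ℝ F] :
    C(K, E →L[ℝ] F) →L[ℝ] C(K, E) →L[ℝ] C(K, F) :=
  LinearMap.mkContinuous₂
    (LinearMap.mk₂ ℝ
      (fun (A : C(K, E →L[ℝ] F)) (v : C(K, E)) => (⟨fun s => A s (v s), by fun_prop⟩ : C(K, F)))
      (fun _ _ _ => by ext; simp) (fun _ _ _ => by ext; simp)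
      (fun _ _ _ => by ext; simp) (fun _ _ _ => by ext; simp)) 1
    (fun A v => by
      refine (ContinuousMap.norm_le _
        (mul_nonneg (mul_nonneg zero_le_one (norm_nonneg A)) (norm_nonneg v))).2 fun s => ?_
      simp only [one_mul]
      exact ((A s).le_opNorm (v s)).trans
        (mul_le_mul (A.norm_coe_le_norm s) (v.norm_coe_le_norm s) (norm_nonneg _) (norm_nonneg _)))

@[simp] lemma applyCLM_apply (A : C(K, E →L[ℝ] F)) (v : C(K, E)) (s : K) :
    applyCLM K E F A v s = A s (v s) := rfl

/-- The mean value inequality applied at each parameter `s`; the sup norm requires a radius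
independent of `s`. -/
lemma hasFDerivAt_comp_curve (f : E → F) (hf : ContDiff ℝ 1 f) (γ : C(K, E)) :
    HasFDerivAt (fun γ : C(K, E) => (⟨fun s => f (γ s), hf.continuous.comp γ.continuous⟩ : C(K, F)))
      (applyCLM K E F ⟨fun s => fderiv ℝ f (γ s),
        (hf.continuous_fderiv one_ne_zero).comp γ.continuous⟩) γ := by
  have hdf : Continuous (fderiv ℝ f) := hf.continuous_fderiv one_ne_zero
  rw [hasFDerivAt_iff_isLittleO_nhds_zero, Asymptotics.isLittleO_iff]
  intro c hc
  have hcont : Continuous (fun γ' : C(K, E) =>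
      (⟨fun s => fderiv ℝ f (γ' s), hdf.comp γ'.continuous⟩ : C(K, E →L[ℝ] F))) :=
    ContinuousMap.continuous_postcomp (X := K) ⟨fderiv ℝ f, hdf⟩
  let dN : C(K, E) → C(K, E →L[ℝ] F) := fun γ' =>
    ⟨fun s => fderiv ℝ f (γ' s), hdf.comp γ'.continuous⟩
  have hmem : dN ⁻¹' Metric.ball (dN γ) c ∈ 𝓝 γ :=
    hcont.continuousAt.preimage_mem_nhds (Metric.ball_mem_nhds (dN γ) hc)
  obtain ⟨δ, hδ, hb⟩ := Metric.mem_nhds_iff.1 hmem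
  filter_upwards [Metric.ball_mem_nhds (0 : C(K, E)) hδ] with h hh
  rw [mem_ball_zero_iff] at hh
  refine (ContinuousMap.norm_le _ (by positivity)).2 fun s => ?_
  -- Shifting the whole curve by the constant `y - γ s` turns continuity of `dN` in the sup norm
  -- into a bound at `y` with the same `δ` for all `s`.
  have key : ∀ y ∈ Metric.ball (γ s) δ, ‖fderiv ℝ f y - fderiv ℝ f (γ s)‖ ≤ c := by
    intro y hy
    have h1 : dist (γ + ContinuousMap.const K (y - γ s)) γ < δ := by
      rw [dist_eq_norm, add_sub_cancel_left]
      refine lt_of_le_of_lt ((ContinuousMap.norm_le _ (norm_nonneg (y - γ s))).2 fun t => ?_) 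
        (by simpa [dist_eq_norm] using hy)
      simp
    have h2 : dist (dN _) (dN γ) < c := hb h1
    have h3 := (ContinuousMap.dist_apply_le_dist (f := dN (γ + ContinuousMap.const K (y - γ s)))
      (g := dN γ) s).trans h2.le
    rw [dist_eq_norm] at h3
    simpa [dN] using h3
  have hmv := (convex_ball (γ s) δ).norm_image_sub_le_of_norm_hasFDerivWithin_le
    (f := fun y => f y - fderiv ℝ f (γ s) y) (f' := fun y => fderiv ℝ f y - fderiv ℝ f (γ s))
    (x := γ s) (y := γ s + h s)
    (fun y _ => ((((hf.differentiable one_ne_zero) y).hasFDerivAt).sub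
      (fderiv ℝ f (γ s)).hasFDerivAt).hasFDerivWithinAt) key
    (Metric.mem_ball_self hδ)
    (by simpa [dist_eq_norm] using (h.norm_coe_le_norm s).trans_lt hh)
  have : ‖f (γ s + h s) - f (γ s) - fderiv ℝ f (γ s) (h s)‖ ≤ c * ‖h s‖ := by
    refine le_trans (le_of_eq ?_) (hmv.trans (le_of_eq ?_))
    · congr 1; simp only [map_add]; abel
    · simp
  refine le_trans ?_ (this.trans (by gcongr; exact h.norm_coe_le_norm s))
  simp

/-- Composition with a smooth map is a smooth operation on continuous curves. -/
lemma contDiff_comp_curve_nat (n : ℕ) : ∀ {F : Type u} [NormedAddCommGroup F] [NormedSpace ℝ F]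
    (f : E → F) (hf : ContDiff ℝ n f),
    ContDiff ℝ n (fun γ : C(K, E) =>
      (⟨fun s => f (γ s), hf.continuous.comp γ.continuous⟩ : C(K, F))) := by
  induction n with
  | zero =>
    intro F _ _ f hf
    exact contDiff_zero.2 (ContinuousMap.continuous_postcomp (X := K) ⟨f, hf.continuous⟩)
  | succ n ih =>
    intro F _ _ f hf
    have h1 : ContDiff ℝ 1 f := hf.of_le (by exact_mod_cast Nat.le_add_left 1 n)
    have hdf : ContDiff ℝ n (fderiv ℝ f) := hf.fderiv_right (m := n) (by norm_cast)
    -- The derivative of composition with `f` is composition with `fderiv ℝ f` followed by the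
    -- continuous linear `applyCLM`. The induction hypothesis is thus used with values in `E →L[ℝ]
    -- F`, which is why `F` varies in the induction and shares its universe with `E`.
    push_cast
    rw [contDiff_succ_iff_hasFDerivAt]
    exact ⟨fun γ => applyCLM K E F ⟨fun s => fderiv ℝ f (γ s), hdf.continuous.comp γ.continuous⟩,
      ContDiff.comp (g := applyCLM K E F) (ContinuousLinearMap.contDiff _) (ih (fderiv ℝ f) hdf),
      fun γ => hasFDerivAt_comp_curve f h1 γ⟩

lemma contDiff_comp_curve (f : E → F) (hf : ContDiff ℝ ∞ f) :
    ContDiff ℝ ∞ (fun γ : C(K, E) =>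
      (⟨fun s => f (γ s), hf.continuous.comp γ.continuous⟩ : C(K, F))) :=
  contDiff_infty.2 fun n => contDiff_comp_curve_nat n f (hf.of_le (by exact_mod_cast le_top))

/-- The inverse function theorem, with smoothness on a full neighbourhood. -/
lemma exists_smooth_local_inverse {E F : Type*} [NormedAddCommGroup E] [NormedSpace ℝ E]
    [CompleteSpace E] [NormedAddCommGroup F] [NormedSpace ℝ F] {f : E → F} {O : Set E}
    (hO : IsOpen O) (hf : ContDiffOn ℝ ∞ f O) {a : E} (ha : a ∈ O)
    (hinv : (fderiv ℝ f a).IsInvertible) :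
    ∃ e : OpenPartialHomeomorph E F, (∀ x, e x = f x) ∧ a ∈ e.source ∧ e.source ⊆ O ∧
      ContDiffOn ℝ ∞ e.symm e.target ∧ ∀ y ∈ e.target,
        (∀ v, fderiv ℝ e.symm y (fderiv ℝ f (e.symm y) v) = v) ∧
        ∀ w, fderiv ℝ f (e.symm y) (fderiv ℝ e.symm y w) = w := by
  obtain ⟨A, hA⟩ := hinv
  have hfa : ContDiffAt ℝ ∞ f a := hf.contDiffAt (hO.mem_nhds ha)
  have hda : HasFDerivAt f (A : E →L[ℝ] F) a := by
    rw [hA]; exact (hfa.differentiableAt (by simp)).hasFDerivAt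
  let e₀ := hfa.toOpenPartialHomeomorph f hda (by simp)
  -- Invertible operators form an open set; shrinking to where the derivative is invertible makes
  -- the inverse smooth on the whole target, not just at one point.
  have ho : IsOpen (O ∩ fderiv ℝ f ⁻¹' (range ((↑) : (E ≃L[ℝ] F) → E →L[ℝ] F))) :=
    (hf.continuousOn_fderiv_of_isOpen hO (by simp)).isOpen_inter_preimage hO
      ContinuousLinearEquiv.isOpen
  have hee : ∀ x, e₀ x = f x := fun x => rfl
  set e := e₀.restrOpen _ ho with he
  have hsymm : ∀ y ∈ e.target, ContDiffAt ℝ ∞ e.symm y := by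
    intro y hy
    have hx : e.symm y ∈ e.source := e.map_target hy
    obtain ⟨B, hB⟩ := hx.2.2
    have hfx : ContDiffAt ℝ ∞ f (e.symm y) := hf.contDiffAt (hO.mem_nhds hx.2.1)
    refine e.contDiffAt_symm hy (f₀' := B) ?_ hfx
    rw [hB]
    exact (hfx.differentiableAt (by simp)).hasFDerivAt
  refine ⟨e, fun x => rfl, ⟨hfa.mem_toOpenPartialHomeomorph_source hda (by simp),
    ha, A, hA⟩, fun x hx => hx.2.1, fun y hy => (hsymm y hy).contDiffWithinAt, fun y hy => ?_⟩
  have hx : e.symm y ∈ e.source := e.map_target hy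
  have hfx : HasFDerivAt f (fderiv ℝ f (e.symm y)) (e.symm y) :=
    ((hf.contDiffAt (hO.mem_nhds hx.2.1)).differentiableAt (by simp)).hasFDerivAt
  have hsy : HasFDerivAt e.symm (fderiv ℝ e.symm y) y :=
    ((hsymm y hy).differentiableAt (by simp)).hasFDerivAt
  constructor
  · have hey : e (e.symm y) = y := e.right_inv hy
    have h1 : HasFDerivAt e.symm (fderiv ℝ e.symm y) (f (e.symm y)) := by
      change HasFDerivAt e.symm (fderiv ℝ e.symm y) (e (e.symm y))
      rwa [hey]
    have h2 := (h1.comp (e.symm y) hfx).unique ((hasFDerivAt_id (e.symm y)).congr_of_eventuallyEq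
      (by filter_upwards [e.open_source.mem_nhds hx] with x hx using e.left_inv hx))
    exact fun v => congrArg (fun L : E →L[ℝ] E => L v) h2
  · have h2 := (hfx.comp y hsy).unique ((hasFDerivAt_id y).congr_of_eventuallyEq
      (by filter_upwards [e.open_target.mem_nhds hy] with x hx using e.right_inv hx))
    exact fun v => congrArg (fun L : F →L[ℝ] F => L v) h2

end CurveSpace

/-! ### Smooth local flows by the inverse function theorem on curves. -/

section Flow

open Filter Topology intervalIntegral

variable {G : Type*} [NormedAddCommGroup G] [NormedSpace ℝ G] [CompleteSpace G]

/-- The primitive of a continuous curve on the unit interval. -/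
def primitiveCLM (G : Type*) [NormedAddCommGroup G] [NormedSpace ℝ G] [CompleteSpace G] :
    C(unitInterval, G) →L[ℝ] C(unitInterval, G) :=
  LinearMap.mkContinuous
    { toFun := fun v => ⟨fun s => ∫ τ in (0 : ℝ)..s, IccExtend zero_le_one v τ, by
        have hc : Continuous (IccExtend zero_le_one v) := v.continuous.Icc_extend'
        exact (intervalIntegral.continuous_primitive
          (fun a b => hc.intervalIntegrable a b) 0).comp continuous_subtype_val⟩
      map_add' := fun v w => by
        ext s
        have hv : Continuous (IccExtend (zero_le_one (α := ℝ)) v) := v.continuous.Icc_extend'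
        have hw : Continuous (IccExtend (zero_le_one (α := ℝ)) w) := w.continuous.Icc_extend'
        simp only [ContinuousMap.coe_mk, ContinuousMap.add_apply]
        rw [← intervalIntegral.integral_add (hv.intervalIntegrable _ _) (hw.intervalIntegrable _ _)]
        rfl
      map_smul' := fun c v => by
        ext s
        simp only [ContinuousMap.coe_mk, ContinuousMap.smul_apply, RingHom.id_apply]
        rw [← intervalIntegral.integral_smul]
        rfl } 1
    (fun v => by
      refine (ContinuousMap.norm_le _ (by positivity)).2 fun s => ?_
      have h := intervalIntegral.norm_integral_le_of_norm_le_const (a := 0) (b := (s : ℝ))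
        (f := IccExtend zero_le_one v) (C := ‖v‖) (fun τ _ => v.norm_coe_le_norm _)
      refine h.trans ?_
      rw [sub_zero, abs_of_nonneg s.2.1, one_mul]
      exact mul_le_of_le_one_right (norm_nonneg _) s.2.2)

lemma primitiveCLM_apply (v : C(unitInterval, G)) (s : unitInterval) :
    primitiveCLM G v s = ∫ τ in (0 : ℝ)..s, IccExtend zero_le_one v τ := rfl

end Flow


section Flow

open Filter Topology intervalIntegral

/-- Constant curves. -/
def constCurveCLM (G : Type*) [NormedAddCommGroup G] [NormedSpace ℝ G] :
    G →L[ℝ] C(unitInterval, G) :=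
  LinearMap.mkContinuous
    { toFun := fun v => ContinuousMap.const _ v
      map_add' := fun v w => by ext; simp
      map_smul' := fun c v => by ext; simp } 1
    (fun v => (ContinuousMap.norm_le _ (by positivity)).2 fun s => by simp)

@[simp] lemma constCurveCLM_apply {G : Type*} [NormedAddCommGroup G] [NormedSpace ℝ G] (v : G)
    (s : unitInterval) : constCurveCLM G v s = v := rfl

/-- Multiplication of the unit interval by one of its points. -/
def scaleCurve {G : Type*} [TopologicalSpace G] (γ : C(unitInterval, G)) (σ : unitInterval) :
    C(unitInterval, G) := ⟨fun s => γ (σ * s), by fun_prop⟩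

variable {G : Type*} [NormedAddCommGroup G] [NormedSpace ℝ G] [CompleteSpace G]

/-- The substitution `τ ↦ σ τ`. It makes the reparametrized solution curve for time `t` the solution
curve for time `σ t`. -/
lemma primitiveCLM_scale (v : C(unitInterval, G)) (σ s : unitInterval) :
    primitiveCLM G v (σ * s) = (σ : ℝ) • primitiveCLM G (scaleCurve v σ) s := by
  rw [primitiveCLM_apply, primitiveCLM_apply]
  have h := intervalIntegral.smul_integral_comp_mul_left (a := 0) (b := (s : ℝ))
    (IccExtend zero_le_one v) (σ : ℝ)
  rw [mul_zero] at h
  change ∫ τ in (0 : ℝ)..((σ : ℝ) * s), _ = _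
  rw [← h]
  congr 1
  refine intervalIntegral.integral_congr fun τ hτ => ?_
  rw [uIcc_of_le s.2.1] at hτ
  have hτ' : τ ∈ Icc (0 : ℝ) 1 := ⟨hτ.1, hτ.2.trans s.2.2⟩
  have hστ : (σ : ℝ) * τ ∈ Icc (0 : ℝ) 1 :=
    ⟨mul_nonneg σ.2.1 hτ'.1, mul_le_one₀ σ.2.2 hτ'.1 hτ'.2⟩
  rw [IccExtend_of_mem _ _ hστ, IccExtend_of_mem _ _ hτ']
  rfl

/-- A globally defined smooth vector field has a smooth local flow. -/
theorem exists_smooth_flow_of_contDiff (Y : G → G) (hY : ContDiff ℝ ∞ Y) (u₀ : G) :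
    ∃ (Φ : ℝ × G → G) (O : Set (ℝ × G)), IsOpen O ∧ (0, u₀) ∈ O ∧ ContDiffOn ℝ ∞ Φ O ∧
      (∀ u, (0, u) ∈ O → Φ (0, u) = u) ∧ ∀ p ∈ O, fderiv ℝ Φ p (1, 0) = Y (Φ p) := by
  let N : C(unitInterval, G) → C(unitInterval, G) :=
    fun γ => ⟨fun s => Y (γ s), hY.continuous.comp γ.continuous⟩
  have hN : ContDiff ℝ ∞ N := contDiff_comp_curve Y hY
  let Q : C(unitInterval, G) → C(unitInterval, G) := fun γ => primitiveCLM G (N γ)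
  have hQ : ContDiff ℝ ∞ Q := (primitiveCLM G).contDiff.comp hN
  -- The trajectory from `u` over time `t`, reparametrized to the unit interval, is the curve `γ`
  -- with `γ = u + t ∫ Y(γ)`, that is `S (t, u, γ) = (t, u, 0)`.
  let S : ℝ × G × C(unitInterval, G) → ℝ × G × C(unitInterval, G) :=
    fun p => (p.1, p.2.1, p.2.2 - constCurveCLM G p.2.1 - p.1 • Q p.2.2)
  have hS : ContDiff ℝ ∞ S := by
    refine contDiff_fst.prodMk ((contDiff_fst.comp contDiff_snd).prodMk
      (((contDiff_snd.comp contDiff_snd).sub ((constCurveCLM G).contDiff.comp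
        (contDiff_fst.comp contDiff_snd))).sub
      (contDiff_fst.smul (hQ.comp (contDiff_snd.comp contDiff_snd)))))
  let c₀ := constCurveCLM G u₀
  let p₀ : ℝ × G × C(unitInterval, G) := (0, u₀, c₀)
  have hinv : (fderiv ℝ S p₀).IsInvertible := by
    let CL := C(unitInterval, G)
    let a1 : ℝ × G × CL →L[ℝ] ℝ := ContinuousLinearMap.fst ℝ ℝ (G × CL)
    let a2 : ℝ × G × CL →L[ℝ] G :=
      (ContinuousLinearMap.fst ℝ G CL).comp (ContinuousLinearMap.snd ℝ ℝ (G × CL))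
    let a3 : ℝ × G × CL →L[ℝ] CL :=
      (ContinuousLinearMap.snd ℝ G CL).comp (ContinuousLinearMap.snd ℝ ℝ (G × CL))
    have h1 : HasFDerivAt (fun p : ℝ × G × CL => p.1) a1 p₀ := a1.hasFDerivAt
    have h2 : HasFDerivAt (fun p : ℝ × G × CL => p.2.1) a2 p₀ := a2.hasFDerivAt
    have h3 : HasFDerivAt (fun p : ℝ × G × CL => p.2.2) a3 p₀ := a3.hasFDerivAt
    have h4 : HasFDerivAt (fun p : ℝ × G × CL => constCurveCLM G p.2.1)
      ((constCurveCLM G).comp a2) p₀ := ((constCurveCLM G).comp a2).hasFDerivAt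
    have h5 : HasFDerivAt (fun p : ℝ × G × CL => Q p.2.2) ((fderiv ℝ Q c₀).comp a3) p₀ :=
      HasFDerivAt.comp (f := fun p : ℝ × G × CL => p.2.2) p₀
        ((hQ.differentiable (by simp)) c₀).hasFDerivAt h3
    have h6 := h1.prodMk (h2.prodMk ((h3.sub h4).sub (h1.smul h5)))
    let B : (ℝ × G × CL) →L[ℝ] (ℝ × G × CL) :=
      a1.prod (a2.prod (a3 - (constCurveCLM G).comp a2 - a1.smulRight (Q c₀)))
    -- At `t = 0` the term `t • dQ` disappears, so the derivative of `S` is unipotent triangular and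
    -- is inverted by changing the signs off the diagonal.
    let B' : (ℝ × G × CL) →L[ℝ] (ℝ × G × CL) :=
      a1.prod (a2.prod (a3 + (constCurveCLM G).comp a2 + a1.smulRight (Q c₀)))
    have hB : HasFDerivAt S B p₀ := by
      refine h6.congr_fderiv ?_
      refine ContinuousLinearMap.ext fun v => ?_
      simp [B, p₀]
    rw [hB.fderiv]
    refine ⟨ContinuousLinearEquiv.equivOfInverse B B' (fun v => ?_) (fun v => ?_), ?_⟩
    · refine Prod.ext rfl (Prod.ext rfl ?_)
      simp only [B, B', a1, a2, a3, ContinuousLinearMap.prod_apply, add_apply,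
        sub_apply, ContinuousLinearMap.comp_apply,
        ContinuousLinearMap.smulRight_apply, ContinuousLinearMap.coe_fst',
        ContinuousLinearMap.coe_snd']
      abel
    · refine Prod.ext rfl (Prod.ext rfl ?_)
      simp only [B, B', a1, a2, a3, ContinuousLinearMap.prod_apply, add_apply,
        sub_apply, ContinuousLinearMap.comp_apply,
        ContinuousLinearMap.smulRight_apply, ContinuousLinearMap.coe_fst',
        ContinuousLinearMap.coe_snd']
      abel
    · ext <;> rfl
  obtain ⟨e, he, hp₀, -, hsymm, -⟩ :=
    exists_smooth_local_inverse isOpen_univ hS.contDiffOn (mem_univ p₀) hinv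
  obtain ⟨δ, hδ, hball⟩ := Metric.isOpen_iff.1 e.open_source p₀ hp₀
  let ι : ℝ × G → ℝ × G × C(unitInterval, G) := fun q => (q.1, q.2, 0)
  have hι : ContDiff ℝ ∞ ι := contDiff_fst.prodMk (contDiff_snd.prodMk contDiff_const)
  let curve : ℝ × G → C(unitInterval, G) := fun q => (e.symm (ι q)).2.2
  -- The solution curve is also required to stay in a ball contained in `e.source`: there the
  -- equation has only one solution, and the ball survives the rescaling of time.
  let O₁ : Set (ℝ × G) := ι ⁻¹' (e.target ∩ e.symm ⁻¹' Metric.ball p₀ δ)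
  have hO₁ : IsOpen O₁ :=
    (e.isOpen_inter_preimage_symm Metric.isOpen_ball).preimage hι.continuous
  have hSp₀ : S p₀ = ι (0, u₀) := by
    ext <;> simp [S, p₀, ι, c₀]
  have hmem₀ : (0, u₀) ∈ O₁ := by
    refine ⟨?_, ?_⟩
    · rw [← hSp₀, ← he]; exact e.map_source hp₀
    · rw [mem_preimage, ← hSp₀, ← he, e.left_inv hp₀]; exact Metric.mem_ball_self hδ
  -- the defining equation of the curves
  have heq : ∀ q ∈ O₁, e.symm (ι q) = (q.1, q.2, curve q) ∧
      curve q = constCurveCLM G q.2 + q.1 • Q (curve q) := by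
    intro q hq
    have h1 : S (e.symm (ι q)) = ι q := by rw [← he, e.right_inv hq.1]
    have h2 : (e.symm (ι q)).1 = q.1 := congrArg (fun p => p.1) h1
    have h3 : (e.symm (ι q)).2.1 = q.2 := congrArg (fun p => p.2.1) h1
    have h4 : (e.symm (ι q)).2.2 - constCurveCLM G (e.symm (ι q)).2.1
      - (e.symm (ι q)).1 • Q (e.symm (ι q)).2.2 = 0 := congrArg (fun p => p.2.2) h1
    refine ⟨Prod.ext h2 (Prod.ext h3 rfl), ?_⟩
    rw [h2, h3] at h4
    rw [sub_sub, sub_eq_zero] at h4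
    exact h4
  -- rescaling of time
  have hscale : ∀ q ∈ O₁, ∀ σ : unitInterval, ((σ : ℝ) * q.1, q.2) ∈ O₁ ∧
      curve ((σ : ℝ) * q.1, q.2) = scaleCurve (curve q) σ := by
    intro q hq σ
    obtain ⟨h1, h2⟩ := heq q hq
    have hqb : (q.1, q.2, curve q) ∈ Metric.ball p₀ δ := by rw [← h1]; exact hq.2
    -- The centre `c₀` is a constant curve, so reparametrization does not increase the distance to
    -- it. Hence `r` stays in the ball, and injectivity of `e` identifies it with the solution for
    -- time `σ t`.
    let r : ℝ × G × C(unitInterval, G) := ((σ : ℝ) * q.1, q.2, scaleCurve (curve q) σ)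
    have hr : r ∈ Metric.ball p₀ δ := by
      simp only [Metric.mem_ball, Prod.dist_eq, max_lt_iff, p₀, r] at hqb ⊢
      refine ⟨?_, hqb.2.1, ?_⟩
      · refine lt_of_le_of_lt ?_ hqb.1
        rw [Real.dist_eq, Real.dist_eq, sub_zero, sub_zero, abs_mul, abs_of_nonneg σ.2.1]
        exact mul_le_of_le_one_left (abs_nonneg _) σ.2.2
      · refine lt_of_le_of_lt ?_ hqb.2.2
        refine (ContinuousMap.dist_le dist_nonneg).2 fun s => ?_
        exact ContinuousMap.dist_apply_le_dist (f := curve q) (g := c₀) (σ * s)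
    have hSr : S r = ι ((σ : ℝ) * q.1, q.2) := by
      refine Prod.ext rfl (Prod.ext rfl ?_)
      change scaleCurve (curve q) σ - constCurveCLM G q.2
        - ((σ : ℝ) * q.1) • Q (scaleCurve (curve q) σ) = 0
      ext s
      have h3 := congrArg (fun c : C(unitInterval, G) => c (σ * s)) h2
      have h4 : Q (curve q) (σ * s) = (σ : ℝ) • Q (scaleCurve (curve q) σ) s :=
        primitiveCLM_scale (N (curve q)) σ s
      simp only [ContinuousMap.add_apply, ContinuousMap.smul_apply, constCurveCLM_apply, h4] at h3
      simp only [ContinuousMap.sub_apply, ContinuousMap.smul_apply, constCurveCLM_apply,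
        ContinuousMap.zero_apply]
      change curve q (σ * s) - _ - _ = 0
      rw [h3, mul_comm, mul_smul]
      abel
    have hrs := hball hr
    have h5 : e.symm (ι ((σ : ℝ) * q.1, q.2)) = r := by
      rw [← hSr, ← he, e.left_inv hrs]
    refine ⟨⟨?_, ?_⟩, ?_⟩
    · rw [← hSr, ← he]; exact e.map_source hrs
    · rw [mem_preimage, h5]; exact hr
    · exact congrArg (fun p => p.2.2) h5
  let Φ : ℝ × G → G := fun q => curve q 1
  have hΦ : ContDiffOn ℝ ∞ Φ O₁ := by
    have h1 : ContDiffOn ℝ ∞ (fun q => e.symm (ι q)) O₁ :=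
      hsymm.comp hι.contDiffOn fun q hq => hq.1
    exact (ContinuousMap.evalCLM ℝ (1 : unitInterval)).contDiff.comp_contDiffOn
      ((contDiff_snd.comp contDiff_snd).comp_contDiffOn h1)
  have hhalf : ((1 / 2 : ℝ)) ∈ Icc (0 : ℝ) 1 := by constructor <;> norm_num
  -- On the preimage of `O₁` under doubling of time, `Φ (t, u)` is the value at `1 / 2` of the curve
  -- for time `2 t`. The parameter is then interior to the unit interval, and two-sided derivatives
  -- are available.
  let D : ℝ × G → ℝ × G := fun q => (2 * q.1, q.2)
  have hD : Continuous D := by fun_prop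
  have hsub : ∀ q ∈ D ⁻¹' O₁, q ∈ O₁ := by
    intro q hq
    have h := (hscale _ hq ⟨1 / 2, hhalf⟩).1
    have h' : ((1 / 2 : ℝ) * (2 * q.1), q.2) = q := by ext <;> simp
    rwa [h'] at h
  -- the differential equation away from time zero
  have hode : ∀ q ∈ D ⁻¹' O₁, q.1 ≠ 0 → fderiv ℝ Φ q (1, 0) = Y (Φ q) := by
    intro q hq hq0
    have hd : HasFDerivAt Φ (fderiv ℝ Φ q) q :=
      ((hΦ.contDiffAt (hO₁.mem_nhds (hsub q hq))).differentiableAt (by simp)).hasFDerivAt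
    have hcq : ((1 / 2 : ℝ) * (2 * q.1), q.2) = q := by ext <;> simp
    have hline : HasDerivAt (fun σ : ℝ => (σ * (2 * q.1), q.2)) (2 * q.1, (0 : G)) (1 / 2) := by
      have := (hasDerivAt_id (1 / 2 : ℝ)).mul_const (2 * q.1)
      rw [one_mul] at this
      exact this.prodMk (hasDerivAt_const _ _)
    rw [← hcq] at hd
    have hleft := hd.comp_hasDerivAt (1 / 2 : ℝ) hline
    rw [hcq] at hleft
    set γ := curve (D q) with hγ
    have hint : Continuous (IccExtend (zero_le_one (α := ℝ)) (N γ)) := (N γ).continuous.Icc_extend'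
    have hval : ∀ σ : unitInterval, Φ ((σ : ℝ) * (2 * q.1), q.2) = γ σ := by
      intro σ
      change curve _ 1 = _
      rw [(hscale _ hq σ).2]
      change curve (D q) (σ * 1) = _
      rw [mul_one]
    have hright : HasDerivAt (fun σ : ℝ => q.2 + (2 * q.1) • ∫ τ in (0 : ℝ)..σ,
        IccExtend (zero_le_one (α := ℝ)) (N γ) τ)
        ((2 * q.1) • IccExtend (zero_le_one (α := ℝ)) (N γ) (1 / 2)) (1 / 2) :=
      ((intervalIntegral.integral_hasDerivAt_right (hint.intervalIntegrable _ _)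
        hint.aestronglyMeasurable.stronglyMeasurableAtFilter hint.continuousAt).const_smul _).const_add _
    have hloc : (Φ ∘ fun σ : ℝ => (σ * (2 * q.1), q.2)) =ᶠ[𝓝 (1 / 2)]
        (fun σ : ℝ => q.2 + (2 * q.1) • ∫ τ in (0 : ℝ)..σ,
          IccExtend (zero_le_one (α := ℝ)) (N γ) τ) := by
      have : Icc (0 : ℝ) 1 ∈ 𝓝 (1 / 2 : ℝ) := Icc_mem_nhds (by norm_num) (by norm_num)
      filter_upwards [this] with σ hσ
      have h := hval ⟨σ, hσ⟩
      change Φ (σ * (2 * q.1), q.2) = _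
      rw [h]
      exact congrArg (fun c : C(unitInterval, G) => c ⟨σ, hσ⟩) (heq _ hq).2
    have huniq := hleft.unique (hright.congr_of_eventuallyEq hloc)
    rw [IccExtend_of_mem _ _ hhalf] at huniq
    have h7 : N γ ⟨1 / 2, hhalf⟩ = Y (Φ q) := by
      change Y (γ ⟨1 / 2, hhalf⟩) = _
      rw [← hval ⟨1 / 2, hhalf⟩, hcq]
    rw [h7] at huniq
    have h8 : ((2 * q.1, (0 : G)) : ℝ × G) = (2 * q.1) • ((1 : ℝ), (0 : G)) := by ext <;> simp
    rw [h8, map_smul] at huniq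
    exact smul_right_injective G (mul_ne_zero two_ne_zero hq0) huniq
  refine ⟨Φ, D ⁻¹' O₁, hO₁.preimage hD, ?_, hΦ.mono hsub, ?_, ?_⟩
  · change (2 * (0 : ℝ), u₀) ∈ O₁
    rwa [mul_zero]
  · intro u hu
    have h := (heq _ (hsub _ hu)).2
    have h' := congrArg (fun c : C(unitInterval, G) => c 1) h
    simpa using h'
  · intro q hq
    -- Differentiating in the curve parameter gives the equation multiplied by `2 t`, which says
    -- nothing at `t = 0`; there it follows by continuity from `t ≠ 0`.
    by_cases hq0 : q.1 = 0
    · obtain ⟨t, u⟩ := q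
      simp only at hq0
      subst hq0
      have hO2 := hO₁.preimage hD
      have hline : Continuous (fun t : ℝ => (t, u)) := by fun_prop
      have hT : Continuous (fun t : ℝ => (t, u)) := hline
      have hnear : ∀ᶠ t : ℝ in 𝓝 0, (t, u) ∈ D ⁻¹' O₁ :=
        hline.continuousAt.eventually (hO2.mem_nhds hq)
      have hc1 : ContinuousAt (fun t : ℝ => fderiv ℝ Φ (t, u) (1, 0)) 0 := by
        have : ContinuousAt (fderiv ℝ Φ) (0, u) :=
          (hΦ.continuousOn_fderiv_of_isOpen hO₁ (by simp)).continuousAt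
            (hO₁.mem_nhds (hsub _ hq))
        have h2 : ContinuousAt (fun t : ℝ => fderiv ℝ Φ (t, u)) 0 :=
          ContinuousAt.comp (f := fun t : ℝ => (t, u)) this hline.continuousAt
        exact h2.clm_apply continuousAt_const
      have hc2 : ContinuousAt (fun t : ℝ => Y (Φ (t, u))) 0 := by
        have : ContinuousAt Φ (0, u) := hΦ.continuousOn.continuousAt (hO₁.mem_nhds (hsub _ hq))
        exact hY.continuous.continuousAt.comp
          (ContinuousAt.comp (f := fun t : ℝ => (t, u)) this hline.continuousAt)
      refine tendsto_nhds_unique (hc1.tendsto.mono_left (nhdsWithin_le_nhds (s := {0}ᶜ)))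
        ((hc2.tendsto.mono_left (nhdsWithin_le_nhds (s := {0}ᶜ))).congr' ?_)
      filter_upwards [nhdsWithin_le_nhds hnear, self_mem_nhdsWithin] with t ht ht0
      exact (hode _ ht ht0).symm
    · exact hode q hq hq0

end Flow


/-! ### Flow boxes and first integrals of involutive families in a vector space. -/

section Frobenius

open Filter Topology

lemma isInvertible_of_bijective {E F : Type*} [NormedAddCommGroup E] [NormedSpace ℝ E]
    [CompleteSpace E] [NormedAddCommGroup F] [NormedSpace ℝ F] [CompleteSpace F] {L : E →L[ℝ] F}
    (hinj : ∀ v, L v = 0 → v = 0) (hsurj : Function.Surjective L) : L.IsInvertible :=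
  ⟨ContinuousLinearEquiv.ofBijective L (LinearMap.ker_eq_bot'.2 hinj)
    (LinearMap.range_eq_top.2 hsurj), by ext; rfl⟩

variable {G : Type*} [NormedAddCommGroup G] [NormedSpace ℝ G] [FiniteDimensional ℝ G]

/-- Cut-off by a bump function, so that the flow theorem for globally defined fields applies to a
field given on an open set. -/
lemma exists_contDiff_eqOn_ball {F : Type*} [NormedAddCommGroup F] [NormedSpace ℝ F] {Y : G → F}
    {O : Set G} (hO : IsOpen O) (hY : ContDiffOn ℝ ∞ Y O) {u₀ : G} (hu : u₀ ∈ O) :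
    ∃ (Y' : G → F) (r : ℝ), 0 < r ∧ ContDiff ℝ ∞ Y' ∧ Metric.ball u₀ r ⊆ O ∧
      ∀ u ∈ Metric.ball u₀ r, Y' u = Y u := by
  obtain ⟨ε, hε, hb⟩ := Metric.isOpen_iff.1 hO u₀ hu
  let b : ContDiffBump u₀ := ⟨ε / 4, ε / 2, by positivity, by linarith⟩
  refine ⟨fun u => b u • Y u, ε / 4, by positivity, ?_,
    (Metric.ball_subset_ball (by linarith)).trans hb, fun u hu => ?_⟩
  · rw [contDiff_iff_contDiffAt]
    intro u
    by_cases h : u ∈ O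
    · exact b.contDiffAt.smul (hY.contDiffAt (hO.mem_nhds h))
    · have hd : u ∉ Metric.closedBall u₀ (ε / 2) := fun h' =>
        h (hb (Metric.closedBall_subset_ball (by linarith) h'))
      refine contDiffAt_const (c := (0 : F)) |>.congr_of_eventuallyEq ?_
      filter_upwards [Metric.isClosed_closedBall.isOpen_compl.mem_nhds hd] with v hv
      rw [b.zero_of_le_dist, zero_smul]
      rw [mem_compl_iff, Metric.mem_closedBall, not_le] at hv
      exact hv.le
  · have : b u = 1 := b.one_of_mem_closedBall (Metric.ball_subset_closedBall hu)
    simp [this]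

/-- Near a point where it does not vanish, a smooth vector field has a full set of
smooth first integrals. -/
theorem exists_flow_box {Y : G → G} {O : Set G} (hO : IsOpen O) (hY : ContDiffOn ℝ ∞ Y O)
    {u₀ : G} (hu : u₀ ∈ O) (hne : Y u₀ ≠ 0) :
    ∃ (m : ℕ) (h : G → Fin m → ℝ) (O' : Set G), IsOpen O' ∧ u₀ ∈ O' ∧ O' ⊆ O ∧
      ContDiffOn ℝ ∞ h O' ∧ ∀ u ∈ O', Function.Surjective (fderiv ℝ h u) ∧
        LinearMap.ker (fderiv ℝ h u).toLinearMap = Submodule.span ℝ {Y u} := by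
  obtain ⟨Y', r, hr, hY', hrO, hYY'⟩ := exists_contDiff_eqOn_ball hO hY hu
  obtain ⟨Φ, OΦ, hOΦ, h0Φ, hΦ, hΦ0, hΦY⟩ := exists_smooth_flow_of_contDiff Y' hY' u₀
  -- The hyperplane `u₀ + ker lam` is transversal to `Y`. Flowing from it gives the local
  -- diffeomorphism `Ψ`, and the `K`-component of its inverse is the full set of first integrals.
  obtain ⟨lam, hlam⟩ := SeparatingDual.exists_eq_one (R := ℝ) hne
  let K := LinearMap.ker lam.toLinearMap
  let A : ℝ × K → ℝ × G := fun p => (p.1, u₀ + (p.2 : G))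
  have hA : ContDiff ℝ ∞ A :=
    contDiff_fst.prodMk (contDiff_const.add (K.subtypeL.contDiff.comp contDiff_snd))
  have hAd : ∀ p, HasFDerivAt A
      ((ContinuousLinearMap.fst ℝ ℝ K).prod (K.subtypeL.comp (ContinuousLinearMap.snd ℝ ℝ K))) p :=
    fun p => (ContinuousLinearMap.fst ℝ ℝ K).hasFDerivAt.prodMk
      ((K.subtypeL.comp (ContinuousLinearMap.snd ℝ ℝ K)).hasFDerivAt.const_add u₀)
  let OΨ : Set (ℝ × K) := A ⁻¹' (OΦ ∩ Φ ⁻¹' Metric.ball u₀ r)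
  have hOΨ : IsOpen OΨ :=
    (hΦ.continuousOn.isOpen_inter_preimage hOΦ Metric.isOpen_ball).preimage hA.continuous
  have hA0 : A (0, 0) = (0, u₀) := by simp [A]
  have h0Ψ : (0, 0) ∈ OΨ := by
    rw [mem_preimage, hA0]
    refine ⟨h0Φ, ?_⟩
    rw [mem_preimage, hΦ0 u₀ h0Φ]
    exact Metric.mem_ball_self hr
  let Ψ : ℝ × K → G := fun p => Φ (A p)
  have hΨ : ContDiffOn ℝ ∞ Ψ OΨ := hΦ.comp hA.contDiffOn fun p hp => hp.1
  have hΦd : ∀ q ∈ OΦ, HasFDerivAt Φ (fderiv ℝ Φ q) q := fun q hq =>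
    ((hΦ.contDiffAt (hOΦ.mem_nhds hq)).differentiableAt (by simp)).hasFDerivAt
  have hΨd : ∀ p ∈ OΨ, ∀ v : ℝ × K, fderiv ℝ Ψ p v = fderiv ℝ Φ (A p) (v.1, v.2) := by
    intro p hp v
    have h : HasFDerivAt Ψ _ p := (hΦd _ hp.1).comp p (hAd p)
    rw [h.fderiv]
    rfl
  have hΨt : ∀ p ∈ OΨ, ∀ t : ℝ, fderiv ℝ Ψ p (t, 0) = t • Y (Ψ p) := by
    intro p hp t
    rw [hΨd p hp, ← hYY' _ hp.2, ← hΦY _ hp.1, ← map_smul]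
    simp
  have hΦx : ∀ v : G, fderiv ℝ Φ (0, u₀) (0, v) = v := by
    intro v
    have h1 : HasFDerivAt (fun u : G => ((0 : ℝ), u)) (ContinuousLinearMap.inr ℝ ℝ G) u₀ :=
      (ContinuousLinearMap.inr ℝ ℝ G).hasFDerivAt
    have h2 := (hΦd _ h0Φ).comp u₀ h1
    have h3 := h2.unique ((hasFDerivAt_id u₀).congr_of_eventuallyEq (by
      have : (fun u : G => ((0 : ℝ), u)) ⁻¹' OΦ ∈ 𝓝 u₀ :=
        (by fun_prop : Continuous fun u : G => ((0 : ℝ), u)).continuousAt.preimage_mem_nhds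
          (hOΦ.mem_nhds h0Φ)
      filter_upwards [this] with u hu using hΦ0 u hu))
    exact congrArg (fun L : G →L[ℝ] G => L v) h3
  have hΨ0 : Ψ (0, 0) = u₀ := by
    change Φ (A (0, 0)) = u₀
    rw [hA0, hΦ0 _ h0Φ]
  have hform : ∀ v : ℝ × K, fderiv ℝ Ψ (0, 0) v = v.1 • Y u₀ + v.2 := by
    intro v
    have : v = (v.1, 0) + (0, v.2) := by ext <;> simp
    conv_lhs => rw [this, map_add, hΨt _ h0Ψ, hΨ0, hΨd _ h0Ψ, hA0]
    exact congrArg (v.1 • Y u₀ + ·) (hΦx v.2)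
  have hinv : (fderiv ℝ Ψ (0, 0)).IsInvertible := by
    refine isInvertible_of_bijective (fun v hv => ?_) (fun w => ?_)
    · rw [hform] at hv
      have h1 : v.1 = 0 := by
        have := congrArg lam hv
        have h2 : lam (v.2 : G) = 0 := v.2.2
        simpa [hlam, h2] using this
      rw [h1, zero_smul, zero_add] at hv
      exact Prod.ext h1 (Subtype.ext hv)
    · refine ⟨(lam w, ⟨w - lam w • Y u₀, ?_⟩), ?_⟩
      · change lam (w - lam w • Y u₀) = 0
        simp [hlam]
      · rw [hform]; simp
  obtain ⟨e, he, h0e, heO, hes, hed⟩ := exists_smooth_local_inverse hOΨ hΨ h0Ψ hinv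
  let bK := (finBasis ℝ K).equivFunL
  have hedd : ∀ u ∈ e.target, HasFDerivAt e.symm (fderiv ℝ e.symm u) u := fun u hu =>
    ((hes.contDiffAt (e.open_target.mem_nhds hu)).differentiableAt (by simp)).hasFDerivAt
  have hval : ∀ u ∈ e.target, Ψ (e.symm u) = u := fun u hu => by rw [← he, e.right_inv hu]
  refine ⟨_, fun u => bK (e.symm u).2, e.target, e.open_target, ?_, ?_, ?_, ?_⟩
  · rw [← hΨ0, ← he]; exact e.map_source h0e
  · intro u hu
    rw [← hval u hu]
    exact hrO (heO (e.map_target hu)).2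
  · exact bK.contDiff.comp_contDiffOn (contDiff_snd.comp_contDiffOn hes)
  · intro u hu
    have hd : ∀ w, fderiv ℝ (fun u => bK (e.symm u).2) u w = bK (fderiv ℝ e.symm u w).2 := by
      intro w
      have h1 := bK.toContinuousLinearMap.hasFDerivAt.comp u
        ((ContinuousLinearMap.snd ℝ ℝ K).hasFDerivAt.comp u (hedd u hu))
      have h2 : HasFDerivAt (fun u => bK (e.symm u).2) _ u := h1
      rw [h2.fderiv]
      rfl
    refine ⟨fun c => ?_, ?_⟩
    · refine ⟨fderiv ℝ Ψ (e.symm u) (0, bK.symm c), ?_⟩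
      rw [hd, (hed u hu).1]
      simp
    · ext w
      rw [Submodule.mem_span_singleton, LinearMap.mem_ker, ContinuousLinearMap.coe_coe, hd]
      constructor
      · intro h
        have h2 : (fderiv ℝ e.symm u w).2 = 0 := by simpa using h
        refine ⟨(fderiv ℝ e.symm u w).1, ?_⟩
        have h3 := (hed u hu).2 w
        have h4 : fderiv ℝ e.symm u w = ((fderiv ℝ e.symm u w).1, 0) := Prod.ext rfl h2
        rw [h4, hΨt _ (heO (e.map_target hu)), hval u hu] at h3
        exact h3
      · rintro ⟨t, rfl⟩
        have h3 := hΨt _ (heO (e.map_target hu)) t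
        rw [hval u hu] at h3
        rw [← h3, (hed u hu).1]
        simp

/-- If `ker dz` is preserved by `X` modulo `X`, first integrals for `ker dz ⊕ ⟨X⟩` exist. -/
theorem frobenius_step {m : ℕ} {z : G → Fin m → ℝ} {O : Set G} (hO : IsOpen O)
    (hz : ContDiffOn ℝ ∞ z O) {x₀ : G} (hx₀ : x₀ ∈ O) {ι : Type*} {S : ι → G → G}
    (hS : ∀ i, ContDiffOn ℝ ∞ (S i) O) {X : G → G} (hX : ContDiffOn ℝ ∞ X O)
    (hsurj : ∀ x ∈ O, Function.Surjective (fderiv ℝ z x))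
    (hker : ∀ x ∈ O, LinearMap.ker (fderiv ℝ z x).toLinearMap =
      Submodule.span ℝ (range fun i => S i x))
    (hne : X x₀ ∉ Submodule.span ℝ (range fun i => S i x₀))
    (hinv : ∀ x ∈ O, ∀ i, VectorField.lieBracket ℝ X (S i) x ∈
      Submodule.span ℝ (range fun i => S i x) ⊔ Submodule.span ℝ {X x}) :
    ∃ (m' : ℕ) (z' : G → Fin m' → ℝ) (O' : Set G), IsOpen O' ∧ x₀ ∈ O' ∧ O' ⊆ O ∧
      ContDiffOn ℝ ∞ z' O' ∧ ∀ x ∈ O', Function.Surjective (fderiv ℝ z' x) ∧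
        LinearMap.ker (fderiv ℝ z' x).toLinearMap =
          Submodule.span ℝ (range fun i => S i x) ⊔ Submodule.span ℝ {X x} := by
  have hzd : ∀ x ∈ O, HasFDerivAt z (fderiv ℝ z x) x := fun x hx =>
    ((hz.contDiffAt (hO.mem_nhds hx)).differentiableAt (by simp)).hasFDerivAt
  have hdz : ContDiffOn ℝ ∞ (fderiv ℝ z) O := hz.fderiv_of_isOpen hO (by simp)
  let ξ : G → Fin m → ℝ := fun x => fderiv ℝ z x (X x)
  have hξ : ContDiffOn ℝ ∞ ξ O := hdz.clm_apply hX
  have hξd : ∀ x ∈ O, HasFDerivAt ξ (fderiv ℝ ξ x) x := fun x hx =>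
    ((hξ.contDiffAt (hO.mem_nhds hx)).differentiableAt (by simp)).hasFDerivAt
  have hξ0 : ξ x₀ ≠ 0 := fun h => hne (by rw [← hker x₀ hx₀]; exact h)
  have hkS : ∀ x ∈ O, ∀ i, fderiv ℝ z x (S i x) = 0 := by
    intro x hx i
    have : S i x ∈ LinearMap.ker (fderiv ℝ z x).toLinearMap := by
      rw [hker x hx]; exact Submodule.subset_span ⟨i, rfl⟩
    exact this
  -- Since `dz(S_i) = 0`, the bracket satisfies `dz([X, S_i]) = -dξ(S_i)`; by the hypothesis on
  -- brackets it is a multiple of `dz(X) = ξ`. So `ξ` changes along the leaves only by a factor.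
  have hξS : ∀ x ∈ O, ∀ i, ∃ c : ℝ, fderiv ℝ ξ x (S i x) = c • ξ x := by
    intro x hx i
    have h1 := VectorField.fderiv_apply_lieBracket (𝕜 := ℝ) (V := X) (W := S i) (n := ∞)
      (hz.contDiffAt (hO.mem_nhds hx)) (by rw [minSmoothness_of_isRCLikeNormedField]; exact WithTop.coe_le_coe.2 (le_top : (2 : ℕ∞) ≤ ⊤))
      (((hS i).contDiffAt (hO.mem_nhds hx)).differentiableAt (by simp))
      ((hX.contDiffAt (hO.mem_nhds hx)).differentiableAt (by simp))
    have h2 : fderiv ℝ (fun x => fderiv ℝ z x (S i x)) x = 0 := by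
      have : (fun x => fderiv ℝ z x (S i x)) =ᶠ[𝓝 x] fun _ => 0 := by
        filter_upwards [hO.mem_nhds hx] with y hy using hkS y hy i
      rw [this.fderiv_eq]; simp
    rw [h2] at h1
    obtain ⟨d, hd, w, hw, hdw⟩ := Submodule.mem_sup.1 (hinv x hx i)
    obtain ⟨c, rfl⟩ := Submodule.mem_span_singleton.1 hw
    rw [← hker x hx] at hd
    have hd' : fderiv ℝ z x d = 0 := hd
    rw [← hdw, map_add, hd', map_smul] at h1
    refine ⟨-c, ?_⟩
    change fderiv ℝ (fun x => fderiv ℝ z x (X x)) x (S i x) = -c • fderiv ℝ z x (X x)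
    rw [neg_smul, zero_add] at *
    rw [h1]; simp
  obtain ⟨lam, hlam⟩ := SeparatingDual.exists_eq_one (R := ℝ) hξ0
  let O₁ : Set G := O ∩ ξ ⁻¹' {w | lam w ≠ 0}
  have hO₁ : IsOpen O₁ := hξ.continuousOn.isOpen_inter_preimage hO
    (isOpen_ne_fun lam.continuous continuous_const)
  have hx₁ : x₀ ∈ O₁ := ⟨hx₀, by simp [hlam]⟩
  -- Normalizing by a functional removes that factor, so `η` is constant along the leaves of `ker
  -- dz` and becomes a vector field in the variables `z`.
  let η : G → Fin m → ℝ := fun x => (lam (ξ x))⁻¹ • ξ x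
  have hη : ContDiffOn ℝ ∞ η O₁ :=
    ((lam.contDiff.comp_contDiffOn (hξ.mono inter_subset_left)).inv fun x hx => hx.2).smul
      (hξ.mono inter_subset_left)
  have hηd : ∀ x ∈ O₁, HasFDerivAt η (fderiv ℝ η x) x := fun x hx =>
    ((hη.contDiffAt (hO₁.mem_nhds hx)).differentiableAt (by simp)).hasFDerivAt
  have hηker : ∀ x ∈ O₁, ∀ v, fderiv ℝ z x v = 0 → fderiv ℝ η x v = 0 := by
    intro x hx v hv
    have hv' : v ∈ LinearMap.ker (fderiv ℝ z x).toLinearMap := hv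
    rw [hker x hx.1] at hv'
    have hle : Submodule.span ℝ (range fun i => S i x) ≤
        LinearMap.ker (fderiv ℝ η x).toLinearMap := by
      rw [Submodule.span_le]
      rintro _ ⟨i, rfl⟩
      obtain ⟨c, hc⟩ := hξS x hx.1 i
      have hl : HasFDerivAt (fun y => lam (ξ y)) (lam.comp (fderiv ℝ ξ x)) x :=
        lam.hasFDerivAt.comp x (hξd x hx.1)
      have hl2 : HasFDerivAt (fun y => (lam (ξ y))⁻¹) _ x := 
        (hasDerivAt_inv hx.2).comp_hasFDerivAt x hl
      have h4 : HasFDerivAt η _ x := hl2.smul (hξd x hx.1)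
      change fderiv ℝ η x (S i x) = 0
      rw [h4.fderiv]
      have hne' : lam (ξ x) ≠ 0 := hx.2
      simp only [add_apply, smul_apply,
        ContinuousLinearMap.smulRight_apply, ContinuousLinearMap.comp_apply, hc, map_smul,
        smul_eq_mul, smul_smul]
      rw [← add_smul]
      convert zero_smul ℝ (ξ x) using 2
      field_simp
      ring
    exact hle hv'
  -- coordinates adapted to `z`
  let K := LinearMap.ker (fderiv ℝ z x₀).toLinearMap
  obtain ⟨P₀, hP₀⟩ := LinearMap.exists_leftInverse_of_injective K.subtype (by simp)
  let P : G →L[ℝ] K := P₀.toContinuousLinearMap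
  have hP : ∀ κ : K, P κ = κ := fun κ => congrArg (fun L : K →ₗ[ℝ] K => L κ) hP₀
  -- In these coordinates the plaques `z = const` are balls of `K`, hence connected, and vanishing
  -- of `dη` along them makes `η` a function `Y` of `z` alone.
  let Θ : G → (Fin m → ℝ) × K := fun x => (z x, P x)
  have hΘ : ContDiffOn ℝ ∞ Θ O₁ := (hz.mono inter_subset_left).prodMk P.contDiff.contDiffOn
  have hΘd : ∀ x ∈ O, ∀ v, fderiv ℝ Θ x v = (fderiv ℝ z x v, P v) := by
    intro x hx v
    have : HasFDerivAt Θ _ x := (hzd x hx).prodMk P.hasFDerivAt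
    rw [this.fderiv]; rfl
  have hΘinv : (fderiv ℝ Θ x₀).IsInvertible := by
    refine isInvertible_of_bijective (fun v hv => ?_) (fun w => ?_)
    · rw [hΘd x₀ hx₀, Prod.mk_eq_zero] at hv
      have := hP ⟨v, hv.1⟩
      exact (congrArg Subtype.val this).symm.trans (congrArg Subtype.val hv.2)
    · obtain ⟨v, hv⟩ := hsurj x₀ hx₀ w.1
      refine ⟨v + ((w.2 - P v : K) : G), ?_⟩
      rw [hΘd x₀ hx₀, map_add, map_add, hP, hv]
      have : fderiv ℝ z x₀ ((w.2 - P v : K) : G) = 0 := (w.2 - P v : K).2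
      rw [this]
      ext <;> simp
  obtain ⟨e, he, h0e, heO, hes, hed⟩ := exists_smooth_local_inverse hO₁ hΘ hx₁ hΘinv
  have heΘ : ∀ y ∈ e.target, Θ (e.symm y) = y := fun y hy => by rw [← he, e.right_inv hy]
  have hΘ₀ : Θ x₀ ∈ e.target := by rw [← he]; exact e.map_source h0e
  obtain ⟨r, hr, hball⟩ := Metric.isOpen_iff.1 e.open_target _ hΘ₀
  have hmem : ∀ u ∈ Metric.ball (z x₀) r, ∀ κ ∈ Metric.ball (P x₀) r, (u, κ) ∈ e.target := by
    intro u hu κ hκ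
    refine hball ?_
    rw [← ball_prod_same]
    exact ⟨hu, hκ⟩
  have hconst : ∀ u ∈ Metric.ball (z x₀) r, ∀ κ ∈ Metric.ball (P x₀) r,
      η (e.symm (u, κ)) = η (e.symm (u, P x₀)) := by
    intro u hu κ hκ
    refine (Metric.isOpen_ball).is_const_of_fderiv_eq_zero (𝕜 := ℝ)
      (f := fun κ => η (e.symm (u, κ))) (convex_ball (P x₀) r).isPreconnected ?_ ?_ hκ
      (Metric.mem_ball_self hr) 
    all_goals
      have hder : ∀ κ ∈ Metric.ball (P x₀) r,
          HasFDerivAt (fun κ => η (e.symm (u, κ))) (0 : K →L[ℝ] (Fin m → ℝ)) κ := by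
        intro κ hκ
        have ht := hmem u hu κ hκ
        have h1 : HasFDerivAt (fun κ : K => (u, κ)) (ContinuousLinearMap.inr ℝ (Fin m → ℝ) K) κ :=
          hasFDerivAt_prodMk_right u κ
        have h2 : HasFDerivAt e.symm (fderiv ℝ e.symm (u, κ)) (u, κ) :=
          ((hes.contDiffAt (e.open_target.mem_nhds ht)).differentiableAt (by simp)).hasFDerivAt
        have h3 := (hηd _ (heO (e.map_target ht))).comp (u, κ) h2
        have h4 : HasFDerivAt (fun κ => η (e.symm (u, κ))) _ κ := h3.comp κ h1
        refine h4.congr_fderiv ?_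
        ext1 v
        change fderiv ℝ η _ (fderiv ℝ e.symm (u, κ) (0, v)) = 0
        refine hηker _ (heO (e.map_target ht)) _ ?_
        have h5 := (hed _ ht).2 (0, v)
        rw [hΘd _ (heO (e.map_target ht)).1] at h5
        exact congrArg Prod.fst h5
    · exact fun κ hκ => (hder κ hκ).differentiableAt.differentiableWithinAt
    · exact fun κ hκ => (hder κ hκ).fderiv
  let Y : (Fin m → ℝ) → Fin m → ℝ := fun u => η (e.symm (u, P x₀))
  have hY : ContDiffOn ℝ ∞ Y (Metric.ball (z x₀) r) := by
    refine hη.comp (hes.comp (contDiff_id.prodMk contDiff_const).contDiffOn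
      (t := e.target) fun u hu => hmem u hu _ (Metric.mem_ball_self hr)) fun u hu => ?_
    exact heO (e.map_target (hmem u hu _ (Metric.mem_ball_self hr)))
  have hYz : ∀ x ∈ e.source, z x ∈ Metric.ball (z x₀) r → P x ∈ Metric.ball (P x₀) r →
      Y (z x) = η x := by
    intro x hx hzx hPx
    change η (e.symm (z x, P x₀)) = η x
    rw [← hconst _ hzx _ hPx]
    have : e.symm (z x, P x) = x := by
      have := e.left_inv hx
      rwa [he] at this
    rw [this]
  have hY0 : Y (z x₀) ≠ 0 := by
    rw [hYz x₀ h0e (Metric.mem_ball_self hr) (Metric.mem_ball_self hr)]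
    simp [η, hlam, hξ0]
  -- First integrals `h` of `Y` pull back to `h ∘ z`, whose differential kills `ker dz` and the
  -- vectors that `dz` sends to multiples of `η`, i.e. also `X`.
  obtain ⟨m', h, Oh, hOh, h0h, hOhb, hh, hhk⟩ :=
    exists_flow_box Metric.isOpen_ball hY (Metric.mem_ball_self hr) hY0
  have hzc : ContinuousOn z e.source := hz.continuousOn.mono fun x hx => (heO hx).1
  let O' : Set G := (e.source ∩ z ⁻¹' Oh) ∩ P ⁻¹' Metric.ball (P x₀) r
  have hO' : IsOpen O' := (hzc.isOpen_inter_preimage e.open_source hOh).inter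
    (Metric.isOpen_ball.preimage P.continuous)
  refine ⟨m', fun x => h (z x), O', hO', ⟨⟨h0e, h0h⟩, Metric.mem_ball_self hr⟩,
    fun x hx => (heO hx.1.1).1,
    hh.comp (hz.mono fun x hx => (heO hx.1.1).1) fun x hx => hx.1.2, fun x hx => ?_⟩
  have hxO : x ∈ O := (heO hx.1.1).1
  have hxne : lam (ξ x) ≠ 0 := (heO hx.1.1).2
  have hd : ∀ v, fderiv ℝ (fun x => h (z x)) x v = fderiv ℝ h (z x) (fderiv ℝ z x v) := by
    intro v
    have h1 : HasFDerivAt h (fderiv ℝ h (z x)) (z x) :=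
      ((hh.contDiffAt (hOh.mem_nhds hx.1.2)).differentiableAt (by simp)).hasFDerivAt
    have h2 : HasFDerivAt (fun x => h (z x)) _ x := h1.comp x (hzd x hxO)
    rw [h2.fderiv]; rfl
  refine ⟨fun c => ?_, ?_⟩
  · obtain ⟨b, hb⟩ := (hhk _ hx.1.2).1 c
    obtain ⟨a, ha⟩ := hsurj x hxO b
    exact ⟨a, by rw [hd, ha, hb]⟩
  · rw [← hker x hxO]
    have hkh := (hhk _ hx.1.2).2
    rw [hYz x hx.1.1 (hOhb hx.1.2) hx.2] at hkh
    ext v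
    rw [LinearMap.mem_ker, ContinuousLinearMap.coe_coe, hd]
    have hiff : fderiv ℝ h (z x) (fderiv ℝ z x v) = 0 ↔
        fderiv ℝ z x v ∈ Submodule.span ℝ {η x} := by
      rw [← hkh]; rfl
    rw [hiff, Submodule.mem_span_singleton, Submodule.mem_sup]
    constructor
    · rintro ⟨a, ha⟩
      refine ⟨v - (a * (lam (ξ x))⁻¹) • X x, ?_, _,
        Submodule.smul_mem _ _ (Submodule.mem_span_singleton_self _), sub_add_cancel _ _⟩
      rw [LinearMap.mem_ker, ContinuousLinearMap.coe_coe, map_sub, map_smul, ← ha, sub_eq_zero,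
        mul_smul]
    · rintro ⟨d, hd', w, hw, rfl⟩
      obtain ⟨c, rfl⟩ := Submodule.mem_span_singleton.1 hw
      have hd'' : fderiv ℝ z x d = 0 := hd'
      refine ⟨c * lam (ξ x), ?_⟩
      rw [map_add, hd'', zero_add, map_smul]
      change (c * lam (ξ x)) • (lam (ξ x))⁻¹ • ξ x = c • ξ x
      rw [smul_smul, mul_assoc, mul_inv_cancel₀ hxne, mul_one]

/-- First integrals of the distribution spanned by the first `k` members of a sequence of vector
fields such that every initial segment of it is involutive. -/
theorem exists_first_integrals {X : ℕ → G → G} {O : Set G} (hO : IsOpen O) {x₀ : G} (hx₀ : x₀ ∈ O)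
    (k : ℕ) (hX : ∀ i < k, ContDiffOn ℝ ∞ (X i) O)
    (hli : LinearIndependent ℝ fun i : Fin k => X i x₀)
    (hinv : ∀ j < k, ∀ i < j, ∀ x ∈ O, VectorField.lieBracket ℝ (X j) (X i) x ∈
      Submodule.span ℝ ((fun l => X l x) '' Iic j)) :
    ∃ (m : ℕ) (z : G → Fin m → ℝ) (O' : Set G), IsOpen O' ∧ x₀ ∈ O' ∧ O' ⊆ O ∧
      ContDiffOn ℝ ∞ z O' ∧ ∀ x ∈ O', Function.Surjective (fderiv ℝ z x) ∧
        LinearMap.ker (fderiv ℝ z x).toLinearMap =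
          Submodule.span ℝ (range fun i : Fin k => X i x) := by
  induction k with
  | zero =>
    let b := (finBasis ℝ G).equivFunL
    refine ⟨_, b, O, hO, hx₀, subset_rfl, b.contDiff.contDiffOn, fun x hx => ?_⟩
    rw [b.fderiv]
    refine ⟨b.surjective, ?_⟩
    have : LinearMap.ker (b : G →L[ℝ] Fin (finrank ℝ G) → ℝ).toLinearMap = ⊥ :=
      LinearMap.ker_eq_bot.2 b.injective
    rw [this]
    simp
  | succ k ih =>
    have hli' : LinearIndependent ℝ fun i : Fin k => X i x₀ :=
      hli.comp (Fin.castSucc) (Fin.castSucc_injective k)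
    obtain ⟨m, z, O₁, hO₁, hx₁, hO₁O, hz, hk⟩ := ih (fun i hi => hX i (by omega)) hli'
      fun j hj => hinv j (by omega)
    have hsplit : ∀ x, Submodule.span ℝ (range fun i : Fin (k + 1) => X i x) =
        Submodule.span ℝ (range fun i : Fin k => X i x) ⊔ Submodule.span ℝ {X k x} := by
      intro x
      rw [← Submodule.span_union]
      congr 1
      ext v
      simp only [mem_range, mem_union, mem_singleton_iff]
      constructor
      · rintro ⟨i, rfl⟩
        rcases Nat.lt_succ_iff_lt_or_eq.1 i.2 with h | h
        · exact Or.inl ⟨⟨i, h⟩, rfl⟩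
        · exact Or.inr (by rw [h])
      · rintro (⟨i, rfl⟩ | rfl)
        · exact ⟨i.castSucc, rfl⟩
        · exact ⟨Fin.last k, rfl⟩
    have hne : X k x₀ ∉ Submodule.span ℝ (range fun i : Fin k => X i x₀) :=
      (linearIndependent_finSucc'.1 hli).2
    have hinv' : ∀ x ∈ O₁, ∀ i : Fin k, VectorField.lieBracket ℝ (X k) (X i) x ∈
        Submodule.span ℝ (range fun i : Fin k => X i x) ⊔ Submodule.span ℝ {X k x} := by
      intro x hx i
      have h := hinv k (by omega) i i.2 x (hO₁O hx)
      rw [← hsplit]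
      refine Submodule.span_mono ?_ h
      rintro _ ⟨l, hl, rfl⟩
      exact ⟨⟨l, Nat.lt_succ_of_le hl⟩, rfl⟩
    obtain ⟨m', z', O', hO', hx', hO'O, hz', hk'⟩ := frobenius_step hO₁ hz hx₁
      (S := fun i : Fin k => X i) (X := X k)
      (fun i => (hX i (by omega)).mono hO₁O) ((hX k (by omega)).mono hO₁O)
      (fun x hx => (hk x hx).1) (fun x hx => (hk x hx).2) hne hinv'
    refine ⟨m', z', O', hO', hx', hO'O.trans hO₁O, hz', fun x hx => ⟨(hk' x hx).1, ?_⟩⟩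
    rw [(hk' x hx).2, hsplit]

/-- A function constant along an involutive distribution but not along a transversal vector. -/
theorem exists_first_integral {X : ℕ → G → G} {O : Set G} (hO : IsOpen O) {x₀ : G} (hx₀ : x₀ ∈ O)
    (k : ℕ) (hX : ∀ i < k, ContDiffOn ℝ ∞ (X i) O)
    (hli : LinearIndependent ℝ fun i : Fin k => X i x₀)
    (hinv : ∀ j < k, ∀ i < j, ∀ x ∈ O, VectorField.lieBracket ℝ (X j) (X i) x ∈
      Submodule.span ℝ ((fun l => X l x) '' Iic j)) {v : G}
    (hv : v ∉ Submodule.span ℝ (range fun i : Fin k => X i x₀)) :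
    ∃ (h : G → ℝ) (O' : Set G), IsOpen O' ∧ x₀ ∈ O' ∧ O' ⊆ O ∧ ContDiffOn ℝ ∞ h O' ∧
      (∀ x ∈ O', ∀ i < k, fderiv ℝ h x (X i x) = 0) ∧ fderiv ℝ h x₀ v ≠ 0 := by
  obtain ⟨m, z, O', hO', hx', hO'O, hz, hk⟩ := exists_first_integrals hO hx₀ k hX hli hinv
  rw [← (hk x₀ hx').2] at hv
  have hv' : fderiv ℝ z x₀ v ≠ 0 := hv
  obtain ⟨a, ha⟩ := Function.ne_iff.1 hv'
  have hd : ∀ x ∈ O', ∀ w, fderiv ℝ (fun x => z x a) x w = fderiv ℝ z x w a := by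
    intro x hx w
    have h1 := ((hz.contDiffAt (hO'.mem_nhds hx)).differentiableAt (by simp)).hasFDerivAt
    have h2 : HasFDerivAt (fun x => z x a) _ x := (hasFDerivAt_pi'.1 h1) a
    rw [h2.fderiv]; rfl
  refine ⟨fun x => z x a, O', hO', hx', hO'O, fun x hx => (contDiffWithinAt_pi.1 (hz x hx)) a,
    fun x hx i hi => ?_, by rw [hd x₀ hx']; exact ha⟩
  have : X i x ∈ LinearMap.ker (fderiv ℝ z x).toLinearMap := by
    rw [(hk x hx).2]; exact Submodule.subset_span ⟨⟨i, hi⟩, rfl⟩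
  have h0 : fderiv ℝ z x (X i x) = 0 := this
  rw [hd x hx, h0]; rfl

end Frobenius


/-! ### Differentials, smooth fields and Lie brackets on the manifold, read in charts. -/

section Toolbox

open Filter Topology

variable {d : ℕ} {M : Type*} [TopologicalSpace M] [ChartedSpace (EuclideanSpace ℝ (Fin d)) M]

lemma dif_apply (f : M → ℝ) (x : M) (v : TangentSpace (𝓡 d) x) :
    dif f x v = mfderiv (𝓡 d) 𝓘(ℝ, ℝ) f x v := rfl

lemma dif_add {f g : M → ℝ} {x : M} (hf : MDifferentiableAt (𝓡 d) 𝓘(ℝ, ℝ) f x)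
    (hg : MDifferentiableAt (𝓡 d) 𝓘(ℝ, ℝ) g x) :
    dif (d := d) (fun y => f y + g y) x = dif f x + dif g x := by
  unfold dif
  rw [mvfderiv_fun_add hf hg]
  rfl

lemma dif_sub {f g : M → ℝ} {x : M} (hf : MDifferentiableAt (𝓡 d) 𝓘(ℝ, ℝ) f x)
    (hg : MDifferentiableAt (𝓡 d) 𝓘(ℝ, ℝ) g x) :
    dif (d := d) (fun y => f y - g y) x = dif f x - dif g x := by
  unfold dif
  rw [mvfderiv_fun_sub hf hg]
  rfl

lemma dif_mul {f g : M → ℝ} {x : M} (hf : MDifferentiableAt (𝓡 d) 𝓘(ℝ, ℝ) f x)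
    (hg : MDifferentiableAt (𝓡 d) 𝓘(ℝ, ℝ) g x) :
    dif (d := d) (fun y => f y * g y) x = f x • dif g x + g x • dif f x := by
  unfold dif
  rw [mvfderiv_fun_mul hf hg]
  rfl

lemma dif_const (c : ℝ) (x : M) : dif (d := d) (fun _ : M => c) x = 0 := by
  unfold dif
  rw [mvfderiv_const]
  rfl

lemma dif_congr {f g : M → ℝ} {x : M} (h : f =ᶠ[𝓝 x] g) : dif (d := d) f x = dif g x := by
  unfold dif mvfderiv
  rw [h.mfderiv_eq, h.eq_of_nhds]

lemma dif_comp {m : ℕ} {F : (Fin m → ℝ) → ℝ} {f : Fin m → M → ℝ} {x : M}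
    (hF : DifferentiableAt ℝ F fun a => f a x)
    (hf : ∀ a, MDifferentiableAt (𝓡 d) 𝓘(ℝ, ℝ) (f a) x) :
    dif (d := d) (fun y => F fun a => f a y) x =
      ∑ a, fderiv ℝ F (fun b => f b x) (Pi.single a 1) • dif (f a) x := by
  have h1 : HasMFDerivAt (𝓡 d) 𝓘(ℝ, Fin m → ℝ) (fun y a => f a y) x
      (ContinuousLinearMap.pi fun a => mfderiv (𝓡 d) 𝓘(ℝ, ℝ) (f a) x) := by
    refine ⟨?_, ?_⟩
    · exact continuousAt_pi.2 fun a => (hf a).continuousAt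
    · exact hasFDerivWithinAt_pi.2 fun a => (hf a).hasMFDerivAt.2
  have h2 := (hF.hasFDerivAt.hasMFDerivAt).comp x h1
  ext v
  rw [dif_apply]
  change mfderiv (𝓡 d) 𝓘(ℝ, ℝ) (F ∘ fun y a => f a y) x v = _
  rw [h2.mfderiv]
  simp only [LinearMap.sum_apply, LinearMap.smul_apply, dif_apply]
  change fderiv ℝ F (fun b => f b x) (fun a => mfderiv (𝓡 d) 𝓘(ℝ, ℝ) (f a) x v) = _
  set w : Fin m → ℝ := fun a => mfderiv (𝓡 d) 𝓘(ℝ, ℝ) (f a) x v with hw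
  have h3 : w = ∑ a, w a • (Pi.single a 1 : Fin m → ℝ) := by
    ext b
    simp [Finset.sum_apply, Pi.single_apply]
  rw [h3, map_sum]
  refine Finset.sum_congr rfl fun a _ => ?_
  rw [map_smul]
  exact mul_comm _ _

lemma SmoothFnOn.contMDiffAt {V : Set M} {f : M → ℝ} (hf : SmoothFnOn d V f) (hV : IsOpen V) {x : M}
    (hx : x ∈ V) : ContMDiffAt (𝓡 d) 𝓘(ℝ, ℝ) ∞ f x :=
  ContMDiffOn.contMDiffAt hf (hV.mem_nhds hx)

lemma SmoothFnOn.mdifferentiableAt {V : Set M} {f : M → ℝ} (hf : SmoothFnOn d V f) (hV : IsOpen V)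
    {x : M} (hx : x ∈ V) : MDifferentiableAt (𝓡 d) 𝓘(ℝ, ℝ) f x :=
  (hf.contMDiffAt hV hx).mdifferentiableAt (by simp)

lemma isOpen_chart_preimage (p : M) {V : Set M} (hV : IsOpen V) :
    IsOpen ((extChartAt (𝓡 d) p).target ∩ (extChartAt (𝓡 d) p).symm ⁻¹' V) :=
  (continuousOn_extChartAt_symm p).isOpen_inter_preimage (isOpen_extChartAt_target p) hV

variable [IsManifold (𝓡 d) ∞ M]

instance isManifold_minSmoothness_two : IsManifold (𝓡 d) (minSmoothness ℝ 2) M := by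
  rw [minSmoothness_of_isRCLikeNormedField]
  infer_instance

instance isManifold_top_add_one : IsManifold (𝓡 d) (((⊤ : ℕ∞) : ℕ∞ω) + 1) M :=
  inferInstanceAs (IsManifold (𝓡 d) ∞ M)

lemma SmoothVFOn.contMDiffAt {V : Set M} {Y : VField d M} (hY : SmoothVFOn V Y) (hV : IsOpen V)
    {x : M} (hx : x ∈ V) :
    ContMDiffAt (𝓡 d) (𝓡 d).tangent ∞ (fun x => (⟨x, Y x⟩ : TangentBundle (𝓡 d) M)) x :=
  ContMDiffOn.contMDiffAt hY (hV.mem_nhds hx)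

lemma SmoothVFOn.mdifferentiableAt {V : Set M} {Y : VField d M} (hY : SmoothVFOn V Y)
    (hV : IsOpen V) {x : M} (hx : x ∈ V) :
    MDifferentiableAt (𝓡 d) (𝓡 d).tangent (fun x => (⟨x, Y x⟩ : TangentBundle (𝓡 d) M)) x :=
  (hY.contMDiffAt hV hx).mdifferentiableAt (by simp)

lemma SmoothVFOn.mono {V W : Set M} {Y : VField d M} (hY : SmoothVFOn V Y) (h : W ⊆ V) :
    SmoothVFOn W Y := ContMDiffOn.mono hY h

lemma SmoothVFOn.congr {V : Set M} {Y Z : VField d M} (hY : SmoothVFOn V Y)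
    (h : ∀ x ∈ V, Z x = Y x) : SmoothVFOn V Z :=
  ContMDiffOn.congr hY fun x hx => by rw [h x hx]

lemma SmoothVFOn.add {V : Set M} {Y Z : VField d M} (hY : SmoothVFOn V Y) (hZ : SmoothVFOn V Z) :
    SmoothVFOn V (fun x => Y x + Z x) := ContMDiffOn.add_section hY hZ

lemma SmoothVFOn.smul {V : Set M} {f : M → ℝ} {Y : VField d M} (hf : SmoothFnOn d V f)
    (hY : SmoothVFOn V Y) : SmoothVFOn V (fun x => f x • Y x) := ContMDiffOn.smul_section hf hY

lemma SmoothVFOn.sum {ι : Type*} {s : Finset ι} {V : Set M} {Y : ι → VField d M}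
    (hY : ∀ i ∈ s, SmoothVFOn V (Y i)) : SmoothVFOn V (fun x => ∑ i ∈ s, Y i x) :=
  ContMDiffOn.sum_section hY

lemma SmoothVFOn.lieBr {V : Set M} (hV : IsOpen V) {Y Z : VField d M} (hY : SmoothVFOn V Y)
    (hZ : SmoothVFOn V Z) : SmoothVFOn V (lieBr Y Z) := fun x hx =>
  (ContMDiffAt.mlieBracket_vectorField (m := ⊤) (n := ⊤) (hY.contMDiffAt hV hx)
    (hZ.contMDiffAt hV hx) (by rw [minSmoothness_of_isRCLikeNormedField]; rfl)).contMDiffWithinAt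

/-- The function is the fibre component of the tangent map of `f` composed with the section `Y`. -/
lemma SmoothFnOn.der {V : Set M} (hV : IsOpen V) {Y : VField d M} {f : M → ℝ}
    (hY : SmoothVFOn V Y) (hf : SmoothFnOn d V f) : SmoothFnOn d V (der Y f) := by
  have h1 : ContMDiffOn (𝓡 d).tangent 𝓘(ℝ, ℝ).tangent ∞ (tangentMapWithin (𝓡 d) 𝓘(ℝ, ℝ) f V) 
      (Bundle.TotalSpace.proj ⁻¹' V) :=
    ContMDiffOn.contMDiffOn_tangentMapWithin hf (by rfl) hV.uniqueMDiffOn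
  have h2 := h1.comp hY fun x hx => hx
  intro x hx
  have h3 := h2 x hx
  rw [Bundle.contMDiffWithinAt_totalSpace] at h3
  refine h3.2.congr (fun y hy => ?_) ?_
  · simp [tangentMapWithin, mfderivWithin_of_isOpen hV hy]
    rfl
  · simp [tangentMapWithin, mfderivWithin_of_isOpen hV hx]
    rfl

/-- The representation of a vector field in the preferred chart at `p`. -/
def chartField (p : M) (Y : VField d M) : EuclideanSpace ℝ (Fin d) → EuclideanSpace ℝ (Fin d) :=
  VectorField.mpullback 𝓘(ℝ, EuclideanSpace ℝ (Fin d)) (𝓡 d) (extChartAt (𝓡 d) p).symm Y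

lemma contMDiffAt_chart_symm (p : M) {e : EuclideanSpace ℝ (Fin d)}
    (he : e ∈ (extChartAt (𝓡 d) p).target) :
    ContMDiffAt 𝓘(ℝ, EuclideanSpace ℝ (Fin d)) (𝓡 d) ∞ (extChartAt (𝓡 d) p).symm e :=
  (contMDiffOn_extChartAt_symm p).contMDiffAt ((isOpen_extChartAt_target p).mem_nhds he)

lemma isInvertible_chart_symm (p : M) {e : EuclideanSpace ℝ (Fin d)}
    (he : e ∈ (extChartAt (𝓡 d) p).target) :
    (mfderiv 𝓘(ℝ, EuclideanSpace ℝ (Fin d)) (𝓡 d) (extChartAt (𝓡 d) p).symm e).IsInvertible := by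
  have h := isInvertible_mfderivWithin_extChartAt_symm (I := 𝓡 d) he
  rwa [ModelWithCorners.range_eq_univ, mfderivWithin_univ] at h

lemma mfderiv_chartField (p : M) (Y : VField d M) {e : EuclideanSpace ℝ (Fin d)}
    (he : e ∈ (extChartAt (𝓡 d) p).target) :
    mfderiv 𝓘(ℝ, EuclideanSpace ℝ (Fin d)) (𝓡 d) (extChartAt (𝓡 d) p).symm e (chartField p Y e) =
      Y ((extChartAt (𝓡 d) p).symm e) := by
  obtain ⟨A, hA⟩ := isInvertible_chart_symm p he
  unfold chartField
  rw [VectorField.mpullback_apply, ← hA, ContinuousLinearMap.inverse_equiv]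
  exact A.apply_symm_apply _

lemma contDiffOn_chartField (p : M) {V : Set M} (hV : IsOpen V) {Y : VField d M}
    (hY : SmoothVFOn V Y) : ContDiffOn ℝ ∞ (chartField p Y)
      ((extChartAt (𝓡 d) p).target ∩ (extChartAt (𝓡 d) p).symm ⁻¹' V) := by
  intro e he
  have h := ContMDiffAt.mpullback_vectorField_preimage (hY.contMDiffAt hV he.2)
    (contMDiffAt_chart_symm p he.1) (isInvertible_chart_symm p he.1) (by rfl)
  refine ContDiffAt.contDiffWithinAt ?_
  rw [← contMDiffAt_iff_contDiffAt]
  rw [Bundle.contMDiffAt_totalSpace] at h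
  refine h.2.congr_of_eventuallyEq (Filter.Eventually.of_forall fun x => ?_)
  simp only [trivializationAt_model_space_apply]
  rfl

lemma contDiffOn_chart_fn (p : M) {V : Set M} {f : M → ℝ} (hf : SmoothFnOn d V f) :
    ContDiffOn ℝ ∞ (fun e => f ((extChartAt (𝓡 d) p).symm e))
      ((extChartAt (𝓡 d) p).target ∩ (extChartAt (𝓡 d) p).symm ⁻¹' V) := by
  rw [← contMDiffOn_iff_contDiffOn]
  exact ContMDiffOn.comp (g := f) hf ((contMDiffOn_extChartAt_symm p).mono inter_subset_left)
    fun e he => he.2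

lemma fderiv_chart_fn (p : M) {f : M → ℝ} {e : EuclideanSpace ℝ (Fin d)}
    (he : e ∈ (extChartAt (𝓡 d) p).target)
    (hf : MDifferentiableAt (𝓡 d) 𝓘(ℝ, ℝ) f ((extChartAt (𝓡 d) p).symm e))
    (w : EuclideanSpace ℝ (Fin d)) :
    fderiv ℝ (fun e => f ((extChartAt (𝓡 d) p).symm e)) e w =
      dif f _ (mfderiv 𝓘(ℝ, EuclideanSpace ℝ (Fin d)) (𝓡 d) (extChartAt (𝓡 d) p).symm e w) := by
  rw [← mfderiv_eq_fderiv]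
  exact mfderiv_comp_apply (g := f) e hf
    ((contMDiffAt_chart_symm p he).mdifferentiableAt (by simp)) w

lemma fderiv_chart_fn_chartField (p : M) {f : M → ℝ} (Y : VField d M)
    {e : EuclideanSpace ℝ (Fin d)} (he : e ∈ (extChartAt (𝓡 d) p).target)
    (hf : MDifferentiableAt (𝓡 d) 𝓘(ℝ, ℝ) f ((extChartAt (𝓡 d) p).symm e)) :
    fderiv ℝ (fun e => f ((extChartAt (𝓡 d) p).symm e)) e (chartField p Y e) =
      der Y f ((extChartAt (𝓡 d) p).symm e) := by
  rw [fderiv_chart_fn p he hf, mfderiv_chartField p Y he]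
  rfl

lemma lieBracket_chartField (p : M) {V : Set M} (hV : IsOpen V) {Y Z : VField d M}
    (hY : SmoothVFOn V Y) (hZ : SmoothVFOn V Z) {e : EuclideanSpace ℝ (Fin d)}
    (he : e ∈ (extChartAt (𝓡 d) p).target) (heV : (extChartAt (𝓡 d) p).symm e ∈ V) :
    VectorField.lieBracket ℝ (chartField p Y) (chartField p Z) e = chartField p (lieBr Y Z) e := by
  have h := VectorField.mpullback_mlieBracket (hY.mdifferentiableAt hV heV)
    (hZ.mdifferentiableAt hV heV) (contMDiffAt_chart_symm p he)
    (by rw [minSmoothness_of_isRCLikeNormedField]; exact WithTop.coe_le_coe.2 le_top)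
  unfold chartField lieBr
  rw [h, ← VectorField.mlieBracketWithin_univ, VectorField.mlieBracketWithin_eq_lieBracketWithin]
  exact (congrFun (VectorField.lieBracketWithin_univ (𝕜 := ℝ)) e).symm

/-- The Lie bracket is the commutator of derivations. -/
lemma dif_lieBr {V : Set M} (hV : IsOpen V) {Y Z : VField d M} (hY : SmoothVFOn V Y)
    (hZ : SmoothVFOn V Z) {f : M → ℝ} (hf : SmoothFnOn d V f) {x : M} (hx : x ∈ V) :
    dif f x (lieBr Y Z x) = der Y (der Z f) x - der Z (der Y f) x := by
  set ψ := (extChartAt (𝓡 d) x).symm with hψ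
  set T := (extChartAt (𝓡 d) x).target with hT
  set e := extChartAt (𝓡 d) x x with he
  have heT : e ∈ T := mem_extChartAt_target x
  have hex : ψ e = x := extChartAt_to_inv x
  have hO := isOpen_chart_preimage (d := d) x hV
  have heO : e ∈ T ∩ ψ ⁻¹' V := ⟨heT, by rw [mem_preimage, hex]; exact hx⟩
  have key := VectorField.fderiv_apply_lieBracket (𝕜 := ℝ) (V := chartField x Y)
    (W := chartField x Z) (n := ∞) (x := e)
    ((contDiffOn_chart_fn x hf).contDiffAt (hO.mem_nhds heO))
    (by rw [minSmoothness_of_isRCLikeNormedField]; exact WithTop.coe_le_coe.2 le_top)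
    (((contDiffOn_chartField x hV hZ).contDiffAt (hO.mem_nhds heO)).differentiableAt (by simp))
    (((contDiffOn_chartField x hV hY).contDiffAt (hO.mem_nhds heO)).differentiableAt (by simp))
  have hder : ∀ (A B : VField d M), SmoothVFOn V A → SmoothVFOn V B →
      fderiv ℝ (fun e' => fderiv ℝ (fun e => f (ψ e)) e' (chartField x A e')) e (chartField x B e)
        = der B (der A f) (ψ e) := by
    intro A B hA hB
    rw [← fderiv_chart_fn_chartField x B heT
      ((SmoothFnOn.der hV hA hf).mdifferentiableAt hV heO.2)]
    congr 1
    refine Filter.EventuallyEq.fderiv_eq ?_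
    filter_upwards [hO.mem_nhds heO] with e' he'
    exact fderiv_chart_fn_chartField x A he'.1 (hf.mdifferentiableAt hV he'.2)
  rw [hder Z Y hZ hY, hder Y Z hY hZ, lieBracket_chartField x hV hY hZ heT heO.2,
    fderiv_chart_fn_chartField x _ heT (hf.mdifferentiableAt hV heO.2), hex] at key
  exact key

end Toolbox


/-! ### Dual coframes, local volume forms and local completions of a frame. -/

section Forms

open Filter Topology

variable {d : ℕ} {M : Type*} [TopologicalSpace M] [ChartedSpace (EuclideanSpace ℝ (Fin d)) M]

instance finiteDimensional_tangentSpace (x : M) : FiniteDimensional ℝ (TangentSpace (𝓡 d) x) :=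
  inferInstanceAs (FiniteDimensional ℝ (EuclideanSpace ℝ (Fin d)))

lemma finrank_tangentSpace (x : M) : finrank ℝ (TangentSpace (𝓡 d) x) = d :=
  (finrank_euclideanSpace_fin : finrank ℝ (EuclideanSpace ℝ (Fin d)) = d)

lemma span_eq_top_of_linearIndependent {x : M} {v : Fin d → TangentSpace (𝓡 d) x}
    (h : LinearIndependent ℝ v) : ⊤ ≤ Submodule.span ℝ (range v) :=
  (h.span_eq_top_of_card_eq_finrank' (by rw [finrank_tangentSpace, Fintype.card_fin])).ge

open scoped Classical in
/-- The dual coframe of a frame (zero where the frame degenerates). -/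
def coframe (X : Fin d → VField d M) (i : Fin d) : OneForm d M := fun x =>
  if h : LinearIndependent ℝ (fun i => X i x) then
    (Basis.mk h (span_eq_top_of_linearIndependent h)).coord i else 0

lemma coframe_apply_frame {X : Fin d → VField d M} {x : M}
    (h : LinearIndependent ℝ (fun i => X i x)) (i j : Fin d) :
    coframe X i x (X j x) = if j = i then 1 else 0 := by
  have hb : X j x = Basis.mk h (span_eq_top_of_linearIndependent h) j := by simp
  rw [coframe, dif_pos h, hb, Basis.coord_apply, Basis.repr_self, Finsupp.single_apply]

lemma sum_coframe_smul {X : Fin d → VField d M} {x : M}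
    (h : LinearIndependent ℝ (fun i => X i x)) (v : TangentSpace (𝓡 d) x) :
    ∑ i, coframe X i x v • X i x = v := by
  have hb := (Basis.mk h (span_eq_top_of_linearIndependent h)).sum_repr v
  simp only [Basis.mk_apply] at hb
  conv_rhs => rw [← hb]
  refine Finset.sum_congr rfl fun i _ => ?_
  rw [coframe, dif_pos h]
  rfl

/-- Cramer's rule for an alternating form on a frame. -/
lemma map_update_frame {X : Fin d → VField d M} {x : M}
    (h : LinearIndependent ℝ (fun i => X i x)) (Ω : (TangentSpace (𝓡 d) x) [⋀^Fin d]→ₗ[ℝ] ℝ)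
    (i : Fin d) (v : TangentSpace (𝓡 d) x) :
    Ω (Function.update (fun i => X i x) i v) = coframe X i x v * Ω fun i => X i x := by
  conv_lhs => rw [← sum_coframe_smul h v]
  rw [Ω.map_update_sum, Finset.sum_eq_single i]
  · rw [Ω.map_update_smul, Function.update_eq_self, smul_eq_mul]
  · intro j _ hj
    rw [Ω.map_update_smul]
    have : Ω (Function.update (fun i => X i x) i (X j x)) = 0 :=
      Ω.map_update_self (fun i => X i x) hj.symm
    rw [this, smul_zero]
  · simp

lemma map_frame_ne_zero {x : M} {v : Fin d → TangentSpace (𝓡 d) x} (h : LinearIndependent ℝ v)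
    {Ω : (TangentSpace (𝓡 d) x) [⋀^Fin d]→ₗ[ℝ] ℝ} (hΩ : Ω ≠ 0) : Ω v ≠ 0 := by
  have hb : (Basis.mk h (span_eq_top_of_linearIndependent h) : Fin d → _) = v := by simp
  rw [← hb]
  exact Ω.map_basis_ne_zero_iff _ |>.2 hΩ

lemma SmoothFnOn.of_local {V : Set M} (hV : IsOpen V) {f : M → ℝ}
    (h : ∀ x ∈ V, ∃ W, IsOpen W ∧ x ∈ W ∧ SmoothFnOn d (W ∩ V) f) : SmoothFnOn d V f := by
  intro x hx
  obtain ⟨W, hW, hxW, hf⟩ := h x hx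
  exact (hf.contMDiffAt (hW.inter hV) ⟨hxW, hx⟩).contMDiffWithinAt

variable [IsManifold (𝓡 d) ∞ M]

/-- The coordinates in the preferred trivialization of the tangent bundle at `p`. -/
def trivCoord (p : M) (i : Fin d) : OneForm d M :=
  (trivializationAt (EuclideanSpace ℝ (Fin d)) (TangentSpace (𝓡 d)) p).localFrameCoeff (𝓡 d)
    (EuclideanSpace.basisFun (Fin d) ℝ).toBasis i

/-- The coordinate fields of the preferred trivialization of the tangent bundle at `p`. -/
def trivFrame (p : M) (i : Fin d) : VField d M :=
  (trivializationAt (EuclideanSpace ℝ (Fin d)) (TangentSpace (𝓡 d)) p).localFrame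
    (EuclideanSpace.basisFun (Fin d) ℝ).toBasis i

/-- The domain of the preferred trivialization of the tangent bundle at `p`. -/
def trivDomain (p : M) : Set M :=
  (trivializationAt (EuclideanSpace ℝ (Fin d)) (TangentSpace (𝓡 d) (M := M)) p).baseSet

lemma isOpen_trivDomain (p : M) : IsOpen (trivDomain (d := d) p) :=
  (trivializationAt (EuclideanSpace ℝ (Fin d)) (TangentSpace (𝓡 d) (M := M)) p).open_baseSet

lemma mem_trivDomain (p : M) : p ∈ trivDomain (d := d) p :=
  FiberBundle.mem_baseSet_trivializationAt' p

lemma smoothVFOn_trivFrame (p : M) (i : Fin d) : SmoothVFOn (trivDomain (d := d) p) (trivFrame p i) :=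
  Bundle.Trivialization.contMDiffOn_localFrame_baseSet ∞ _ _ i

lemma smooth_trivCoord (p : M) (i : Fin d) {W : Set M} (hW : IsOpen W) (hWp : W ⊆ trivDomain (d := d) p)
    {Y : VField d M} (hY : SmoothVFOn W Y) : SmoothFnOn d W fun x => trivCoord p i x (Y x) :=
  contMDiffOn_localFrameCoeff (EuclideanSpace.basisFun (Fin d) ℝ).toBasis
    hW hWp hY i

lemma sum_trivCoord (p : M) {x : M} (hx : x ∈ trivDomain (d := d) p) (v : TangentSpace (𝓡 d) x) :
    ∑ i, trivCoord p i x v • trivFrame p i x = v := by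
  classical
  have h := Bundle.Trivialization.eq_sum_localFrameCoeff_smul (I := 𝓡 d)
    (b := (EuclideanSpace.basisFun (Fin d) ℝ).toBasis) (s := Function.update (0 : VField d M) x v) hx
  rw [Function.update_self] at h
  exact h.symm

/-- The determinant in the preferred trivialization of the tangent bundle at `p`. -/
def detForm (p : M) : TopForm d M := fun x =>
  (Pi.basisFun ℝ (Fin d)).det.compLinearMap (LinearMap.pi fun i => trivCoord p i x)

lemma detForm_apply (p x : M) (v : Fin d → TangentSpace (𝓡 d) x) :
    detForm p x v = Matrix.det (Matrix.of fun i j => trivCoord p j x (v i)) := by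
  rw [detForm, AlternatingMap.compLinearMap_apply, Pi.basisFun_det_apply]
  rfl

lemma smooth_detForm (p : M) {W : Set M} (hW : IsOpen W) (hWp : W ⊆ trivDomain (d := d) p)
    {Y : Fin d → VField d M} (hY : ∀ i, SmoothVFOn W (Y i)) :
    SmoothFnOn d W fun x => detForm p x fun i => Y i x := by
  simp only [detForm_apply, Matrix.det_apply']
  refine contMDiffOn_finsetSum fun σ _ => ?_
  refine ContMDiffOn.mul contMDiffOn_const (contMDiffOn_finsetProd fun i _ => ?_)
  exact smooth_trivCoord p i hW hWp (hY (σ i))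

/-- The coordinate fields span, hence by dimension they are a basis dual to the coordinates, and the
determinant takes the value 1 on them. -/
lemma detForm_ne_zero (p : M) {x : M} (hx : x ∈ trivDomain (d := d) p) : detForm (d := d) p x ≠ 0 := by
  intro h
  have hspan : ⊤ ≤ Submodule.span ℝ (range fun i => trivFrame (d := d) p i x) := by
    intro v _
    rw [← sum_trivCoord p hx v]
    exact Submodule.sum_mem _ fun i _ => Submodule.smul_mem _ _ (Submodule.subset_span ⟨i, rfl⟩)
  have hli : LinearIndependent ℝ (fun i => trivFrame (d := d) p i x) :=
    linearIndependent_of_top_le_span_of_card_eq_finrank hspan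
      (by rw [finrank_tangentSpace, Fintype.card_fin])
  have hco : ∀ i j, trivCoord (d := d) p j x (trivFrame p i x) = if i = j then 1 else 0 := by
    intro i j
    have h1 := sum_trivCoord p hx (trivFrame p i x)
    have h2 : ∑ j, (if i = j then (1 : ℝ) else 0) • trivFrame (d := d) p j x = trivFrame p i x := by
      simp
    rw [← sub_eq_zero] at h1
    nth_rewrite 2 [← h2] at h1
    rw [← Finset.sum_sub_distrib] at h1
    simp only [← sub_smul] at h1
    exact sub_eq_zero.1 (Fintype.linearIndependent_iff.1 hli _ h1 j)
  have h3 : detForm (d := d) p x (fun i => trivFrame p i x) = 1 := by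
    rw [detForm_apply]
    have : (Matrix.of fun i j => trivCoord (d := d) p j x (trivFrame p i x)) = 1 := by
      ext i j
      rw [Matrix.of_apply, hco, Matrix.one_apply]
    rw [this, Matrix.det_one]
  rw [h] at h3
  simp at h3

lemma isVolumeFormOn_detForm (p : M) {W : Set M} (hW : IsOpen W) (hWp : W ⊆ trivDomain (d := d) p) :
    IsVolumeFormOn W (detForm (d := d) p) :=
  ⟨fun _ hY => smooth_detForm p hW hWp hY, fun _ hx => detForm_ne_zero p (hWp hx)⟩

/-- By Cramer's rule the coefficient is locally a quotient of two values of `detForm`, with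
nonvanishing denominator. -/
lemma smoothFormOn_coframe {X : Fin d → VField d M} {V : Set M} (hV : IsOpen V)
    (hX : ∀ i, SmoothVFOn V (X i)) (hli : ∀ x ∈ V, LinearIndependent ℝ fun i => X i x) (i : Fin d) :
    SmoothFormOn V (coframe X i) := by
  intro Y hY
  refine SmoothFnOn.of_local hV fun p hp => ⟨trivDomain (d := d) p, isOpen_trivDomain p, mem_trivDomain p, ?_⟩
  have hW := (isOpen_trivDomain (d := d) p).inter hV
  have h1 := smooth_detForm p hW inter_subset_left
    (Y := fun j x => Function.update (fun i => X i x) i (Y x) j) (fun j => by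
      by_cases hj : j = i
      · subst hj
        simpa using hY.mono inter_subset_right
      · simpa [hj] using (hX j).mono inter_subset_right)
  have h2 := smooth_detForm p hW inter_subset_left fun j => (hX j).mono inter_subset_right
  have h3 : ∀ x ∈ trivDomain (d := d) p ∩ V, detForm p x (fun i => X i x) ≠ 0 := fun x hx =>
    map_frame_ne_zero (hli x hx.2) (detForm_ne_zero p hx.1)
  refine (ContMDiffOn.div₀ h1 h2 h3).congr fun x hx => ?_
  change _ = detForm p x (Function.update (fun i => X i x) i (Y x)) / _
  rw [map_update_frame (hli x hx.2), mul_div_assoc, div_self (h3 x hx), mul_one]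

/-- Global smooth functions separate tangent vectors. -/
lemma exists_smooth_dif_ne_zero [T2Space M] {p : M} {v : TangentSpace (𝓡 d) p} (hv : v ≠ 0) :
    ∃ h : M → ℝ, SmoothFnOn d univ h ∧ dif h p v ≠ 0 := by
  obtain ⟨A, hA⟩ := isInvertible_mfderiv_extChartAt (I := 𝓡 d) (mem_extChartAt_source (I := 𝓡 d) p)
  have hw : mfderiv (𝓡 d) 𝓘(ℝ, EuclideanSpace ℝ (Fin d)) (extChartAt (𝓡 d) p) p v ≠ 0 := by
    rw [← hA]
    exact fun h => hv (A.map_eq_zero_iff.1 h)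
  let w : EuclideanSpace ℝ (Fin d) :=
    mfderiv (𝓡 d) 𝓘(ℝ, EuclideanSpace ℝ (Fin d)) (extChartAt (𝓡 d) p) p v
  obtain ⟨a, ha⟩ : ∃ a, w a ≠ 0 := by
    by_contra hcon
    push Not at hcon
    have h0 : w = 0 := by ext a; exact hcon a
    exact hw h0
  let L : EuclideanSpace ℝ (Fin d) →L[ℝ] ℝ := EuclideanSpace.proj a
  let b : SmoothBumpFunction (𝓡 d) p := Classical.arbitrary _
  have hg : ContMDiffOn (𝓡 d) 𝓘(ℝ, ℝ) ∞ (fun x => L (extChartAt (𝓡 d) p x)) (chartAt _ p).source :=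
    L.contMDiff.comp_contMDiffOn contMDiffOn_extChartAt
  refine ⟨fun x => b x • L (extChartAt (𝓡 d) p x), (b.contMDiff_smul hg).contMDiffOn, ?_⟩
  have hloc : (fun x => b x • L (extChartAt (𝓡 d) p x)) =ᶠ[𝓝 p]
      fun x => L (extChartAt (𝓡 d) p x) := by
    filter_upwards [b.eventuallyEq_one] with x hx
    simp [hx]
  rw [dif_congr hloc, dif_apply]
  have h1 : HasMFDerivAt (𝓡 d) 𝓘(ℝ, EuclideanSpace ℝ (Fin d)) (extChartAt (𝓡 d) p) p
    (mfderiv (𝓡 d) 𝓘(ℝ, EuclideanSpace ℝ (Fin d)) (extChartAt (𝓡 d) p) p) :=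
    (mdifferentiableAt_extChartAt (mem_chart_source _ p)).hasMFDerivAt
  have h2 := L.hasMFDerivAt.comp p h1
  change mfderiv (𝓡 d) 𝓘(ℝ, ℝ) (L ∘ (extChartAt (𝓡 d) p)) p v ≠ 0
  rw [h2.mfderiv]
  exact ha

/-- The Jacobi identities are available only for globally smooth functions, so identities between
vector fields have to be tested on those. -/
lemma eq_of_forall_dif [T2Space M] {p : M} {v w : TangentSpace (𝓡 d) p}
    (h : ∀ f : M → ℝ, SmoothFnOn d univ f → dif f p v = dif f p w) : v = w := by
  by_contra hne
  obtain ⟨f, hf, hfv⟩ := exists_smooth_dif_ne_zero (sub_ne_zero.2 hne)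
  exact hfv (by rw [map_sub, h f hf, sub_self])

/-- Near a point where `X_0, …, X_k` are independent they can be completed to a frame, and there is
a volume form. -/
lemma exists_local_completion {k : ℕ} {M : Type*} [TopologicalSpace M]
    [ChartedSpace (EuclideanSpace ℝ (Fin (k + 1))) M] [IsManifold (𝓡 (k + 1)) ∞ M]
    {X : Fin k → VField (k + 1) M} (hX : ∀ i, SmoothVFOn univ (X i)) {p : M}
    (hp : LinearIndependent ℝ fun i => X i p) :
    ∃ (W : Set M) (R : VField (k + 1) M) (Ω : TopForm (k + 1) M), IsOpen W ∧ p ∈ W ∧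
      SmoothVFOn W R ∧
      (∀ x ∈ W, LinearIndependent ℝ
        fun i => Fin.snoc (α := fun _ => VField (k + 1) M) X R i x) ∧
      ∀ W' ⊆ W, IsOpen W' → IsVolumeFormOn W' Ω := by
  have hlt : finrank ℝ (Submodule.span ℝ (range fun i => X i p)) <
      finrank ℝ (TangentSpace (𝓡 (k + 1)) p) := by
    rw [finrank_span_eq_card hp, Fintype.card_fin, finrank_tangentSpace]
    exact Nat.lt_succ_self k
  obtain ⟨v, hv⟩ : ∃ v, v ∉ Submodule.span ℝ (range fun i => X i p) := by
    by_contra hcon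
    push Not at hcon
    rw [(Submodule.eq_top_iff'.2 hcon), finrank_top] at hlt
    exact lt_irrefl _ hlt
  -- The missing vector `v` at `p` is extended with constant coefficients in the local
  -- trivialization; independence then holds wherever the determinant does not vanish.
  let R : VField (k + 1) M := fun x => ∑ i, trivCoord p i p v • trivFrame p i x
  have hR : SmoothVFOn (trivDomain (d := k + 1) p) R := SmoothVFOn.sum fun i _ =>
    SmoothVFOn.smul (f := fun _ => trivCoord p i p v) contMDiffOn_const (smoothVFOn_trivFrame p i)
  have hRp : R p = v := sum_trivCoord p (mem_trivDomain p) v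
  have hsn : ∀ i, SmoothVFOn (trivDomain (d := k + 1) p)
      (Fin.snoc (α := fun _ => VField (k + 1) M) X R i) := by
    refine Fin.lastCases ?_ fun i => ?_
    · simpa using hR
    · simpa using (hX i).mono (subset_univ _)
  have hlip : LinearIndependent ℝ fun i => Fin.snoc (α := fun _ => VField (k + 1) M) X R i p := by
    rw [linearIndependent_finSucc']
    refine ⟨?_, ?_⟩
    · have : (Fin.init fun i => Fin.snoc (α := fun _ => VField (k + 1) M) X R i p)
          = fun i => X i p := by
        funext i; simp [Fin.init]
      rw [this]; exact hp
    · have : range (Fin.init fun i => Fin.snoc (α := fun _ => VField (k + 1) M) X R i p)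
          = range fun i => X i p := by
        congr 1; ext i; simp [Fin.init]
      rw [this]
      simpa [hRp] using hv
  have hsm := smooth_detForm p (isOpen_trivDomain p) subset_rfl hsn
  let W : Set M := trivDomain (d := k + 1) p ∩
    (fun x => detForm p x fun i => Fin.snoc (α := fun _ => VField (k + 1) M) X R i x) ⁻¹' {0}ᶜ
  have hW : IsOpen W := hsm.continuousOn.isOpen_inter_preimage (isOpen_trivDomain p)
    isOpen_compl_singleton
  refine ⟨W, R, detForm p, hW, ⟨mem_trivDomain p, map_frame_ne_zero hlip
    (detForm_ne_zero p (mem_trivDomain p))⟩, hR.mono inter_subset_left, fun x hx => ?_,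
    fun W' hW' ho => isVolumeFormOn_detForm p ho (hW'.trans inter_subset_left)⟩
  by_contra hcon
  exact hx.2 ((detForm p x).map_linearDependent _ hcon)

end Forms


/-! ### Leibniz rules for brackets and differentials of sums. -/

section Calculus

open Filter Topology

variable {d : ℕ} {M : Type*} [TopologicalSpace M] [ChartedSpace (EuclideanSpace ℝ (Fin d)) M]

lemma mdifferentiableAt_sum_and_dif_sum {ι : Type*} {s : Finset ι} {f : ι → M → ℝ} {x : M}
    (hf : ∀ i ∈ s, MDifferentiableAt (𝓡 d) 𝓘(ℝ, ℝ) (f i) x) :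
    MDifferentiableAt (𝓡 d) 𝓘(ℝ, ℝ) (fun y => ∑ i ∈ s, f i y) x ∧
      dif (d := d) (fun y => ∑ i ∈ s, f i y) x = ∑ i ∈ s, dif (f i) x := by
  classical
  induction s using Finset.induction_on with
  | empty => exact ⟨by simpa using mdifferentiableAt_const, by simpa using dif_const (d := d) 0 x⟩
  | insert a s ha ih =>
    simp only [Finset.sum_insert ha]
    obtain ⟨h1, h2⟩ := ih fun i hi => hf i (Finset.mem_insert_of_mem hi)
    have h3 := hf a (Finset.mem_insert_self a s)
    exact ⟨h3.add h1, by rw [dif_add h3 h1, h2]⟩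

lemma lieBr_congr_right {Y Z Z' : VField d M} {x : M} (h : Z =ᶠ[𝓝 x] Z') :
    lieBr Y Z x = lieBr Y Z' x :=
  Filter.EventuallyEq.mlieBracket_vectorField_eq (Filter.EventuallyEq.refl _ _) h

lemma lieBr_swap (Y Z : VField d M) (x : M) : lieBr Y Z x = - lieBr Z Y x :=
  VectorField.mlieBracket_swap_apply

lemma lieBr_self (Y : VField d M) (x : M) : lieBr Y Y x = 0 := by
  unfold lieBr
  rw [VectorField.mlieBracket_self]
  rfl

lemma fibre_moduleSpan_singleton {V : Set M} (Y : VField (d) M) {x : M} (hx : x ∈ V) :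
    fibre (moduleSpan V fun _ : Fin 1 => Y) x = Submodule.span ℝ {Y x} := by
  apply le_antisymm
  · refine Submodule.span_le.2 ?_
    rintro _ ⟨Z, ⟨c, -, hZ⟩, rfl⟩
    rw [hZ x hx, Fin.sum_univ_one]
    exact Submodule.smul_mem _ _ (Submodule.mem_span_singleton_self _)
  · refine Submodule.span_mono ?_
    rintro _ rfl
    exact ⟨Y, ⟨fun _ _ => 1, fun _ => contMDiffOn_const, fun y _ => by simp⟩, rfl⟩

variable [IsManifold (𝓡 d) ∞ M]

lemma lieBr_smul_right {V : Set M} (hV : IsOpen V) {f : M → ℝ} (hf : SmoothFnOn d V f)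
    {Y Z : VField d M} (hZ : SmoothVFOn V Z) {x : M} (hx : x ∈ V) :
    lieBr Y (fun y => f y • Z y) x = der Y f x • Z x + f x • lieBr Y Z x :=
  VectorField.mlieBracket_smul_right (hf.mdifferentiableAt hV hx) (hZ.mdifferentiableAt hV hx)

lemma lieBr_sum_smul_right {V : Set M} (hV : IsOpen V) {ι : Type*} {s : Finset ι} {f : ι → M → ℝ}
    (hf : ∀ i, SmoothFnOn d V (f i)) {Y : VField d M} {Z : ι → VField d M}
    (hZ : ∀ i, SmoothVFOn V (Z i)) {x : M} (hx : x ∈ V) :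
    lieBr Y (fun y => ∑ i ∈ s, f i y • Z i y) x =
      ∑ i ∈ s, (der Y (f i) x • Z i x + f i x • lieBr Y (Z i) x) := by
  classical
  induction s using Finset.induction_on with
  | empty =>
    simp only [Finset.sum_empty]
    exact congrFun VectorField.mlieBracket_zero_right x
  | insert a s ha ih =>
    simp only [Finset.sum_insert ha]
    rw [← ih, ← lieBr_smul_right hV (hf a) (hZ a) hx]
    exact VectorField.mlieBracket_add_right
      ((SmoothVFOn.smul (hf a) (hZ a)).mdifferentiableAt hV hx)
      ((SmoothVFOn.sum fun i _ => SmoothVFOn.smul (hf i) (hZ i)).mdifferentiableAt hV hx)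

end Calculus

/-! ### Frames with involutive initial segments, and their `C^∞`-structure. -/

section Frame

open Filter Topology

variable {n : ℕ} {M : Type*} [TopologicalSpace M]
  [ChartedSpace (EuclideanSpace ℝ (Fin (n + 2))) M] [IsManifold (𝓡 (n + 2)) ∞ M]

/-- A smooth frame on `V` such that each initial segment of it spans an involutive distribution. -/
structure SolvableFrame (V : Set M) (X : Fin (n + 2) → VField (n + 2) M) : Prop where
  isOpen : IsOpen V
  smooth : ∀ i, SmoothVFOn V (X i)
  indep : ∀ x ∈ V, LinearIndependent ℝ fun i => X i x
  invol : ∀ i j, i < j → ∀ x ∈ V, ∀ k, j < k → coframe X k x (lieBr (X j) (X i) x) = 0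

variable {V : Set M} {X : Fin (n + 2) → VField (n + 2) M}

namespace SolvableFrame

lemma smooth_coframe (h : SolvableFrame V X) (i : Fin (n + 2)) : SmoothFormOn V (coframe X i) :=
  smoothFormOn_coframe h.isOpen h.smooth h.indep i

/-- The vector fields of the distribution spanned by `X_0, …, X_j`. -/
lemma mem_moduleSum_iff (h : SolvableFrame V X) (j : Fin (n + 1)) {Z : VField (n + 2) M} :
    Z ∈ moduleSum V (moduleSpan V fun _ : Fin 1 => X 0)
      (moduleSpan V fun i : {i : Fin (n + 1) // i < j} => X i.1.succ) ↔
    SmoothVFOn V Z ∧ ∀ x ∈ V, ∀ l, j.succ ≤ l → coframe X l x (Z x) = 0 := by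
  constructor
  · rintro ⟨Y, ⟨c, hc, hY⟩, Y', ⟨c', hc', hY'⟩, hZ⟩
    refine ⟨?_, ?_⟩
    · refine SmoothVFOn.congr (SmoothVFOn.add
        (SmoothVFOn.sum (s := Finset.univ) fun i _ => SmoothVFOn.smul (hc i) (h.smooth 0))
        (SmoothVFOn.sum (s := Finset.univ) fun i _ => SmoothVFOn.smul (hc' i)
          (h.smooth i.1.succ))) fun x hx => ?_
      rw [hZ x hx, hY x hx, hY' x hx]
    · intro x hx l hl
      rw [hZ x hx, hY x hx, hY' x hx, map_add, map_sum, map_sum]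
      have h1 : ∀ k, k < l → coframe X l x (X k x) = 0 := fun k hk => by
        rw [coframe_apply_frame (h.indep x hx), if_neg hk.ne]
      have hl0 : (0 : Fin (n + 2)) < l := lt_of_lt_of_le (Fin.succ_pos j) hl
      rw [Finset.sum_eq_zero, Finset.sum_eq_zero, add_zero]
      · intro i _
        rw [map_smul, h1 _ (lt_of_lt_of_le (Fin.succ_lt_succ_iff.2 i.2) hl), smul_zero]
      · intro i _
        rw [map_smul, h1 _ hl0, smul_zero]
  · rintro ⟨hZ, hZ0⟩
    refine ⟨fun x => coframe X 0 x (Z x) • X 0 x, ⟨fun _ x => coframe X 0 x (Z x),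
      fun _ => h.smooth_coframe 0 Z hZ, fun x _ => by simp⟩,
      fun x => ∑ i : {i : Fin (n + 1) // i < j}, coframe X i.1.succ x (Z x) • X i.1.succ x,
      ⟨fun i x => coframe X i.1.succ x (Z x), fun i => h.smooth_coframe _ Z hZ,
        fun x _ => rfl⟩, fun x hx => ?_⟩
    conv_lhs => rw [← sum_coframe_smul (h.indep x hx) (Z x), Fin.sum_univ_succ]
    congr 1
    have h0 : ∀ i ∈ (Finset.univ : Finset (Fin (n + 1))),
        coframe X i.succ x (Z x) • X i.succ x ≠ 0 → i < j := fun i _ hi => by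
      by_contra hij
      exact hi (by rw [hZ0 x hx _ (Fin.succ_le_succ_iff.2 (not_lt.1 hij)), zero_smul])
    rw [← Finset.sum_filter_of_ne h0]
    exact Finset.sum_subtype _ (by simp) _

/-- Passage from the generators to all sections of their span, by the Leibniz rule for `Y = ∑ y_l
X_l`. For `l < j` the bracket is controlled by `invol`; for `l ≥ j` the coefficient vanishes near
`x`, together with its derivative. -/
lemma coframe_lieBr_eq_zero (h : SolvableFrame V X) {j k : Fin (n + 2)} (hjk : j < k)
    {Y : VField (n + 2) M} (hY : SmoothVFOn V Y)
    (hY0 : ∀ x ∈ V, ∀ l, j ≤ l → coframe X l x (Y x) = 0) {x : M} (hx : x ∈ V) :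
    coframe X k x (lieBr (X j) Y x) = 0 := by
  have hV := h.isOpen
  have hYe : Y =ᶠ[𝓝 x] fun y => ∑ l, coframe X l y (Y y) • X l y := by
    filter_upwards [hV.mem_nhds hx] with y hy
    exact (sum_coframe_smul (h.indep y hy) (Y y)).symm
  have hbr : lieBr (X j) Y x = ∑ l, (der (X j) (fun y => coframe X l y (Y y)) x • X l x +
      coframe X l x (Y x) • lieBr (X j) (X l) x) :=
    (lieBr_congr_right hYe).trans
      (lieBr_sum_smul_right hV (fun l => h.smooth_coframe l Y hY) h.smooth hx)
  rw [hbr, map_sum]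
  refine Finset.sum_eq_zero fun l _ => ?_
  rw [map_add, map_smul, map_smul]
  rcases lt_or_ge l j with hl | hl
  · rw [h.invol l j hl x hx k hjk, coframe_apply_frame (h.indep x hx),
      if_neg (hl.trans hjk).ne, smul_zero, smul_zero, add_zero]
  · have h1 : (fun y => coframe X l y (Y y)) =ᶠ[𝓝 x] fun _ => (0 : ℝ) := by
      filter_upwards [hV.mem_nhds hx] with y hy using hY0 y hy l hl
    have h2 : der (X j) (fun y => coframe X l y (Y y)) x = 0 := by
      unfold der
      rw [dif_congr h1, dif_const]; rfl
    rw [h2, hY0 x hx l hl, zero_smul, zero_smul, add_zero]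

/-- The distribution in question is cut out by the coframe members from `j.succ` on. Those after
`j.succ` kill the bracket, so subtracting its `X j.succ`-component puts it back in the distribution.
-/
theorem isCinfStructure (h : SolvableFrame V X) :
    IsCinfStructure V (moduleSpan V fun _ : Fin 1 => X 0) (fun i : Fin (n + 1) => X i.succ) := by
  refine ⟨fun x hx => ?_, fun j => ⟨h.smooth _, fun x hx hmem => ?_, fun Y hY => ?_⟩⟩
  · rw [fibre_moduleSpan_singleton _ hx, finrank_span_singleton ((h.indep x hx).ne_zero 0)]
    omega
  · have hle : fibre (moduleSum V (moduleSpan V fun _ : Fin 1 => X 0)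
        (moduleSpan V fun i : {i : Fin (n + 1) // i < j} => X i.1.succ)) x ≤
        LinearMap.ker (coframe X j.succ x) := by
      refine Submodule.span_le.2 ?_
      rintro _ ⟨Z, hZ, rfl⟩
      exact ((h.mem_moduleSum_iff j).1 hZ).2 x hx _ le_rfl
    have h1 : coframe X j.succ x (X j.succ x) = 0 := hle hmem
    rw [coframe_apply_frame (h.indep x hx), if_pos rfl] at h1
    exact one_ne_zero h1
  · obtain ⟨hYs, hY0⟩ := (h.mem_moduleSum_iff j).1 hY
    set Z := lieBr (X j.succ) Y with hZ
    have hZs : SmoothVFOn V Z := SmoothVFOn.lieBr h.isOpen (h.smooth _) hYs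
    set a : M → ℝ := fun x => coframe X j.succ x (Z x) with ha
    have has : SmoothFnOn (n + 2) V a := h.smooth_coframe _ Z hZs
    refine ⟨fun x => Z x + (-a x) • X j.succ x, (h.mem_moduleSum_iff j).2
      ⟨SmoothVFOn.add hZs (SmoothVFOn.smul (f := fun x => -a x) has.neg (h.smooth _)), ?_⟩,
      fun x => a x • X j.succ x, ⟨fun _ => a, fun _ => has, fun x _ => by simp⟩,
      fun x _ => by simp⟩
    intro x hx l hl
    rw [map_add, map_smul, coframe_apply_frame (h.indep x hx)]
    rcases hl.eq_or_lt with rfl | hl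
    · simp [ha]
    · rw [hZ, h.coframe_lieBr_eq_zero hl hYs hY0 hx, if_neg hl.ne]
      simp

end SolvableFrame

end Frame


/-- The terms of a two-form are grouped by their larger index, which is how `dη_i` is later written
as a sum of `θ_l ∧ η_l`. -/
lemma sum_sum_mul_of_antisymm {N : ℕ} {A : Fin N → Fin N → ℝ} (hA : ∀ a b, A a b = -A b a)
    (y z : Fin N → ℝ) :
    ∑ a, ∑ b, y a * z b * A a b = ∑ b, ∑ a ∈ Finset.Iio b, A a b * (y a * z b - y b * z a) := by
  have h1 : ∀ a b, y a * z b * A a b = (if a < b then y a * z b * A a b else 0) +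
      (if b < a then y a * z b * A a b else 0) := fun a b => by
    rcases lt_trichotomy a b with h | rfl | h
    · simp [h, h.not_gt]
    · have : A a a = 0 := by linarith [hA a a]
      simp [this]
    · simp [h, h.not_gt]
  have h2 : ∑ a, ∑ b, (if a < b then y a * z b * A a b else 0) =
      ∑ b, ∑ a, (if a < b then y a * z b * A a b else 0) := Finset.sum_comm
  rw [Finset.sum_congr rfl fun a _ => Finset.sum_congr rfl fun b _ => h1 a b]
  simp_rw [Finset.sum_add_distrib]
  rw [h2, ← Finset.sum_add_distrib]
  refine Finset.sum_congr rfl fun b _ => ?_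
  rw [← Finset.sum_add_distrib]
  have h3 : Finset.Iio b = Finset.univ.filter fun a => a < b := by ext; simp
  rw [h3, Finset.sum_filter]
  refine Finset.sum_congr rfl fun a _ => ?_
  by_cases h : a < b
  · simp only [h, if_true]
    rw [hA b a]; ring
  · simp [h]

/-! ### The exterior derivative in a frame, and closedness modulo later forms. -/

section ExteriorDerivative

open Filter Topology

variable {d : ℕ} {M : Type*} [TopologicalSpace M] [ChartedSpace (EuclideanSpace ℝ (Fin d)) M]

lemma extD_swap (η : OneForm d M) (Y Z : VField d M) (x : M) : extD η Y Z x = -extD η Z Y x := by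
  unfold extD
  rw [lieBr_swap Y Z x, map_neg]
  ring

lemma der_congr {Y : VField d M} {f g : M → ℝ} {x : M} (h : f =ᶠ[𝓝 x] g) : der Y f x = der Y g x := by
  unfold der
  rw [dif_congr h]

variable [IsManifold (𝓡 d) ∞ M]

lemma SmoothFormOn.extD {V : Set M} (hV : IsOpen V) {η : OneForm d M} (hη : SmoothFormOn V η)
    {Y Z : VField d M} (hY : SmoothVFOn V Y) (hZ : SmoothVFOn V Z) :
    SmoothFnOn d V (extD η Y Z) :=
  ((SmoothFnOn.der hV hY (hη Z hZ)).sub (SmoothFnOn.der hV hZ (hη Y hY))).sub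
    (hη _ (SmoothVFOn.lieBr hV hY hZ))

/-- Linearity over functions: the derivatives of the `f i` produced by `Y(η(Z))` cancel against
those in `η([Y, Z])`. -/
lemma extD_sum_right {V : Set M} (hV : IsOpen V) {η : OneForm d M} (hη : SmoothFormOn V η)
    {ι : Type*} [Fintype ι] {f : ι → M → ℝ} (hf : ∀ i, SmoothFnOn d V (f i)) {Y Z : VField d M}
    {X : ι → VField d M} (hX : ∀ i, SmoothVFOn V (X i))
    (hZ : ∀ x ∈ V, Z x = ∑ i, f i x • X i x) {x : M} (hx : x ∈ V) :
    JacobiCinf.extD η Y Z x = ∑ i, f i x * JacobiCinf.extD η Y (X i) x := by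
  have hZe : Z =ᶠ[𝓝 x] fun y => ∑ i, f i y • X i y := by
    filter_upwards [hV.mem_nhds hx] with y hy using hZ y hy
  have hbr : JacobiCinf.lieBr Y Z x = ∑ i, (JacobiCinf.der Y (f i) x • X i x +
      f i x • JacobiCinf.lieBr Y (X i) x) :=
    (lieBr_congr_right hZe).trans (lieBr_sum_smul_right hV hf hX hx)
  have hfd := fun i => (hf i).mdifferentiableAt hV hx
  have hηd := fun i => (hη _ (hX i)).mdifferentiableAt hV hx
  have h1 : JacobiCinf.der Y (fun y => η y (Z y)) x = ∑ i, (JacobiCinf.der Y (f i) x * η x (X i x) +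
      f i x * JacobiCinf.der Y (fun y => η y (X i y)) x) := by
    have he : (fun y => η y (Z y)) =ᶠ[𝓝 x] fun y => ∑ i, f i y * η y (X i y) := by
      filter_upwards [hV.mem_nhds hx] with y hy
      rw [hZ y hy, map_sum]
      exact Finset.sum_congr rfl fun i _ => by rw [map_smul, smul_eq_mul]
    rw [der_congr he]
    unfold JacobiCinf.der
    rw [(mdifferentiableAt_sum_and_dif_sum (f := fun i y => f i y * η y (X i y))
      fun i _ => (hfd i).mul (hηd i)).2, LinearMap.sum_apply]
    refine Finset.sum_congr rfl fun i _ => ?_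
    rw [dif_mul (hfd i) (hηd i)]
    simp only [LinearMap.add_apply, LinearMap.smul_apply, smul_eq_mul]
    ring
  have h2 : JacobiCinf.der Z (fun y => η y (Y y)) x =
      ∑ i, f i x * JacobiCinf.der (X i) (fun y => η y (Y y)) x := by
    unfold JacobiCinf.der
    rw [hZ x hx, map_sum]
    exact Finset.sum_congr rfl fun i _ => by rw [map_smul, smul_eq_mul]
  unfold JacobiCinf.extD
  rw [h1, h2, hbr, map_sum, ← Finset.sum_sub_distrib, ← Finset.sum_sub_distrib]
  refine Finset.sum_congr rfl fun i _ => ?_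
  rw [map_add, map_smul, map_smul, smul_eq_mul, smul_eq_mul]
  ring

end ExteriorDerivative

section Frame

open Filter Topology

variable {n : ℕ} {M : Type*} [TopologicalSpace M]
  [ChartedSpace (EuclideanSpace ℝ (Fin (n + 2))) M] [IsManifold (𝓡 (n + 2)) ∞ M]
  {V : Set M} {X : Fin (n + 2) → VField (n + 2) M} {η : Fin (n + 1) → OneForm (n + 2) M}

/-- Smooth one-forms proportional to the members of the dual coframe, except the first one. -/
structure IsScaledCoframe (V : Set M) (X : Fin (n + 2) → VField (n + 2) M)
    (η : Fin (n + 1) → OneForm (n + 2) M) : Prop where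
  smooth : ∀ i, SmoothFormOn V (η i)
  apply_of_ne : ∀ i, ∀ x ∈ V, ∀ k, k ≠ i.succ → η i x (X k x) = 0
  apply_self_ne : ∀ i, ∀ x ∈ V, η i x (X i.succ x) ≠ 0

lemma SolvableFrame.extD_eq_sum (h : SolvableFrame V X) {β : OneForm (n + 2) M}
    (hβ : SmoothFormOn V β) {Y Z : VField (n + 2) M} (hY : SmoothVFOn V Y) (hZ : SmoothVFOn V Z)
    {x : M} (hx : x ∈ V) :
    extD β Y Z x = ∑ a, ∑ b, coframe X a x (Y x) * coframe X b x (Z x) * extD β (X a) (X b) x := by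
  have key : ∀ {W : VField (n + 2) M} (T : VField (n + 2) M), SmoothVFOn V W →
      extD β T W x = ∑ b, coframe X b x (W x) * extD β T (X b) x := fun {W} T hW =>
    extD_sum_right h.isOpen hβ (fun b => h.smooth_coframe b W hW) h.smooth
      (fun y hy => (sum_coframe_smul (h.indep y hy) (W y)).symm) hx
  rw [extD_swap, key Z hY, ← Finset.sum_neg_distrib]
  refine Finset.sum_congr rfl fun a _ => ?_
  rw [← mul_neg, ← extD_swap, key (X a) hZ, Finset.mul_sum]
  exact Finset.sum_congr rfl fun b _ => by ring

namespace IsScaledCoframe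

lemma apply_eq (hη : IsScaledCoframe V X η) (h : SolvableFrame V X) (i : Fin (n + 1)) {x : M}
    (hx : x ∈ V) (v : TangentSpace (𝓡 (n + 2)) x) :
    η i x v = coframe X i.succ x v * η i x (X i.succ x) := by
  conv_lhs => rw [← sum_coframe_smul (h.indep x hx) v, map_sum]
  rw [Finset.sum_eq_single i.succ]
  · rw [map_smul, smul_eq_mul]
  · intro k _ hk
    rw [map_smul, hη.apply_of_ne i x hx k hk, smul_zero]
  · simp

/-- `η i` vanishes identically on `X a` and `X b`, so only `η_i([X_a, X_b])` remains, and that is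
zero by involutivity. -/
lemma extD_eq_zero (hη : IsScaledCoframe V X η) (h : SolvableFrame V X) (i : Fin (n + 1))
    {a b : Fin (n + 2)} (ha : a < i.succ) (hb : b < i.succ) {x : M} (hx : x ∈ V) :
    extD (η i) (X a) (X b) x = 0 := by
  have h0 : ∀ k, k < i.succ → ∀ Y : VField (n + 2) M, der Y (fun y => η i y (X k y)) x = 0 :=
    fun k hk Y => by
    have : (fun y => η i y (X k y)) =ᶠ[𝓝 x] fun _ => (0 : ℝ) := by
      filter_upwards [h.isOpen.mem_nhds hx] with y hy using hη.apply_of_ne i y hy k hk.ne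
    rw [der_congr this]
    unfold der
    rw [dif_const]; rfl
  have h1 : ∀ {a b}, a < i.succ → b < a → coframe X i.succ x (lieBr (X a) (X b) x) = 0 :=
    fun ha hba => h.invol _ _ hba x hx _ ha
  have h2 : coframe X i.succ x (lieBr (X a) (X b) x) = 0 := by
    rcases lt_trichotomy a b with hab | rfl | hab
    · rw [lieBr_swap, map_neg, h1 hb hab, neg_zero]
    · rw [lieBr_self, map_zero]
    · exact h1 ha hab
  unfold extD
  rw [h0 b hb, h0 a ha, hη.apply_eq h i hx, h2]
  simp

/-- Expand `dη_i` in products of coframe members `α^a ∧ α^b` with `a < b`, put `b = l.succ`, and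
replace `α^b` by `η_l / η_l(X_b)`; what multiplies `η_l` is `θ_l`. The groups with `l < i` vanish by
`extD_eq_zero`, and `b = 0` contributes nothing because no index is smaller. -/
theorem closed_mod (hη : IsScaledCoframe V X η) (h : SolvableFrame V X) (i : Fin (n + 1)) :
    ∃ θ : Fin (n + 1) → OneForm (n + 2) M, (∀ l, SmoothFormOn V (θ l)) ∧
      ∀ Y Z : VField (n + 2) M, SmoothVFOn V Y → SmoothVFOn V Z → ∀ x ∈ V,
        extD (η i) Y Z x = ∑ l ∈ Finset.Ici i, wedge (θ l) (η l) Y Z x := by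
  refine ⟨fun l x => ∑ a ∈ Finset.Iio l.succ,
    (extD (η i) (X a) (X l.succ) x / η l x (X l.succ x)) • coframe X a x, fun l Y hY => ?_,
    fun Y Z hY hZ x hx => ?_⟩
  · simp only [LinearMap.sum_apply, LinearMap.smul_apply, smul_eq_mul]
    refine contMDiffOn_finsetSum fun a _ => ?_
    refine ContMDiffOn.mul ?_ (h.smooth_coframe a Y hY)
    exact ContMDiffOn.div₀ (SmoothFormOn.extD h.isOpen (hη.smooth i) (h.smooth a) (h.smooth _))
      (hη.smooth l _ (h.smooth _)) fun y hy => hη.apply_self_ne l y hy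
  · rw [h.extD_eq_sum (hη.smooth i) hY hZ hx, sum_sum_mul_of_antisymm fun a b => extD_swap _ _ _ _,
      Fin.sum_univ_succ]
    have h0 : Finset.Iio (0 : Fin (n + 2)) = ∅ := by ext a; simp
    rw [h0, Finset.sum_empty, zero_add]
    symm
    rw [← Finset.sum_subset (Finset.subset_univ (Finset.Ici i))]
    · refine Finset.sum_congr rfl fun l _ => ?_
      unfold wedge
      simp only [LinearMap.sum_apply, LinearMap.smul_apply, smul_eq_mul]
      rw [hη.apply_eq h l hx (Z x), hη.apply_eq h l hx (Y x), Finset.sum_mul, Finset.sum_mul,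
        ← Finset.sum_sub_distrib]
      refine Finset.sum_congr rfl fun a _ => ?_
      have := hη.apply_self_ne l x hx
      field_simp
      try ring
    · intro l _ hl
      have hli : l < i := by simpa using hl
      refine Finset.sum_eq_zero fun a ha => ?_
      rw [hη.extD_eq_zero h i ((Finset.mem_Iio.1 ha).trans (Fin.succ_lt_succ_iff.2 hli))
        (Fin.succ_lt_succ_iff.2 hli) hx, zero_mul]

end IsScaledCoframe

end Frame


/-! ### Transfer of functions from a chart to the manifold. -/

section Chart

open Filter Topology

variable {d : ℕ} {M : Type*} [TopologicalSpace M] [ChartedSpace (EuclideanSpace ℝ (Fin d)) M]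
  [IsManifold (𝓡 d) ∞ M]

/-- A smooth function in the chart at `p` defines a smooth function on the manifold. -/
lemma smooth_comp_chart (p : M) {h : EuclideanSpace ℝ (Fin d) → ℝ}
    {O : Set (EuclideanSpace ℝ (Fin d))} (hO : IsOpen O) (hOT : O ⊆ (extChartAt (𝓡 d) p).target)
    (hh : ContDiffOn ℝ ∞ h O) :
    SmoothFnOn d ((extChartAt (𝓡 d) p).source ∩ extChartAt (𝓡 d) p ⁻¹' O)
      (fun x => h (extChartAt (𝓡 d) p x)) ∧
    ∀ x ∈ (extChartAt (𝓡 d) p).source ∩ extChartAt (𝓡 d) p ⁻¹' O, ∀ Y : VField d M,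
      der Y (fun x => h (extChartAt (𝓡 d) p x)) x =
        fderiv ℝ h (extChartAt (𝓡 d) p x) (chartField p Y (extChartAt (𝓡 d) p x)) := by
  have hW : IsOpen ((extChartAt (𝓡 d) p).source ∩ extChartAt (𝓡 d) p ⁻¹' O) :=
    (continuousOn_extChartAt p).isOpen_inter_preimage (isOpen_extChartAt_source p) hO
  have hs : SmoothFnOn d ((extChartAt (𝓡 d) p).source ∩ extChartAt (𝓡 d) p ⁻¹' O)
      (fun x => h (extChartAt (𝓡 d) p x)) := by
    have h1 : ContMDiffOn (𝓡 d) 𝓘(ℝ, EuclideanSpace ℝ (Fin d)) ∞ (extChartAt (𝓡 d) p)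
        ((extChartAt (𝓡 d) p).source ∩ extChartAt (𝓡 d) p ⁻¹' O) := by
      refine contMDiffOn_extChartAt.mono fun x hx => ?_
      rw [← extChartAt_source (𝓡 d)]
      exact hx.1
    exact ContMDiffOn.comp (g := h) (contMDiffOn_iff_contDiffOn.2 hh) h1 fun x hx => hx.2
  refine ⟨hs, fun x hx Y => ?_⟩
  have hxe : (extChartAt (𝓡 d) p).symm (extChartAt (𝓡 d) p x) = x :=
    (extChartAt (𝓡 d) p).left_inv hx.1
  have heq : (fun e => h (extChartAt (𝓡 d) p ((extChartAt (𝓡 d) p).symm e)))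
      =ᶠ[𝓝 (extChartAt (𝓡 d) p x)] h := by
    filter_upwards [(isOpen_extChartAt_target p).mem_nhds (hOT hx.2)] with e he
    rw [(extChartAt (𝓡 d) p).right_inv he]
  have h2 := fderiv_chart_fn_chartField p (f := fun x => h (extChartAt (𝓡 d) p x)) Y (hOT hx.2)
    (by rw [hxe]; exact hs.mdifferentiableAt hW hx)
  rw [heq.fderiv_eq] at h2
  rw [h2, hxe]

end Chart

section Forms

variable {n : ℕ} {M : Type*} [TopologicalSpace M]
  [ChartedSpace (EuclideanSpace ℝ (Fin (n + 2))) M]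

lemma pfaffianForms_apply (Ω : TopForm (n + 2) M) (X : Fin (n + 2) → VField (n + 2) M)
    (i : Fin (n + 1)) (x : M) (v : TangentSpace (𝓡 (n + 2)) x) :
    pfaffianForms Ω X i x v = Ω x (Fin.snoc (α := fun _ => TangentSpace (𝓡 (n + 2)) x)
      (fun l : Fin (n + 1) => X (i.succ.succAbove l) x) v) := by
  unfold pfaffianForms
  rw [MultilinearMap.toLinearMap_apply]
  change Ω x _ = _
  congr 1
  exact Fin.update_snoc_last _ _ _

lemma mem_levelTangent {g : Fin (n + 1) → M → ℝ} {i : Fin (n + 1)} {x : M} {v : TangentSpace (𝓡 (n + 2)) x} :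
    v ∈ levelTangent g i x ↔ ∀ l, i < l → dif (g l) x v = 0 := by
  simp [levelTangent, Submodule.mem_iInf]

end Forms

/-! ### Pfaffian equations: local solvability and differentials of solutions. -/

section Frame

open Filter Topology

variable {n : ℕ} {M : Type*} [TopologicalSpace M]
  [ChartedSpace (EuclideanSpace ℝ (Fin (n + 2))) M] [IsManifold (𝓡 (n + 2)) ∞ M]
  {V : Set M} {X : Fin (n + 2) → VField (n + 2) M} {η : Fin (n + 1) → OneForm (n + 2) M}

/-- Local first integrals of `X_l`, `l < s`, that are not first integrals of `X_s`. -/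
lemma SolvableFrame.exists_first_integral (h : SolvableFrame V X) {p : M} (hp : p ∈ V)
    (s : Fin (n + 2)) :
    ∃ (W : Set M) (g : M → ℝ), IsOpen W ∧ p ∈ W ∧ W ⊆ V ∧ SmoothFnOn (n + 2) W g ∧
      (∀ x ∈ W, ∀ l < s, dif g x (X l x) = 0) ∧ ∀ x ∈ W, dif g x (X s x) ≠ 0 := by
  set ψ := (extChartAt (𝓡 (n + 2)) p).symm with hψ
  set e₀ := extChartAt (𝓡 (n + 2)) p p with he₀
  have hO := isOpen_chart_preimage (d := n + 2) p h.isOpen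
  set O := (extChartAt (𝓡 (n + 2)) p).target ∩ ψ ⁻¹' V with hOdef
  have hep : ψ e₀ = p := extChartAt_to_inv p
  have he₀O : e₀ ∈ O := ⟨mem_extChartAt_target p, by rw [mem_preimage, hep]; exact hp⟩
  -- The Euclidean theorem takes a sequence indexed by `ℕ`; the value 0 past the frame plays no
  -- role, as only indices up to `s` occur.
  let X' : ℕ → EuclideanSpace ℝ (Fin (n + 2)) → EuclideanSpace ℝ (Fin (n + 2)) := fun i =>
    if hi : i < n + 2 then chartField p (X ⟨i, hi⟩) else 0
  have hX' : ∀ i : Fin (n + 2), X' i = chartField p (X i) := fun i => by simp [X']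
  have hX'n : ∀ i (hi : i < n + 2), X' i = chartField p (X ⟨i, hi⟩) := fun i hi => hX' ⟨i, hi⟩
  have hlt : ∀ i, i < s.1 → i < n + 2 := fun i hi => hi.trans s.2
  have hli : LinearIndependent ℝ fun i : Fin (n + 2) => X' i e₀ := by
    refine LinearIndependent.of_comp (mfderiv 𝓘(ℝ, EuclideanSpace ℝ (Fin (n + 2))) (𝓡 (n + 2)) ψ
      e₀).toLinearMap ?_
    have : (fun i : Fin (n + 2) => X i (ψ e₀)) = (mfderiv 𝓘(ℝ, EuclideanSpace ℝ (Fin (n + 2)))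
        (𝓡 (n + 2)) ψ e₀).toLinearMap ∘ fun i : Fin (n + 2) => X' i e₀ := by
      funext i
      simp only [Function.comp, hX']
      exact (mfderiv_chartField p (X i) he₀O.1).symm
    exact this.subst (motive := fun u => LinearIndependent ℝ u) (h.indep _ he₀O.2)
  obtain ⟨f, O', hO', he', hO'O, hf, hf0, hfv⟩ := JacobiCinf.exists_first_integral (X := X') hO he₀O
    s.1 (fun i hi => by
      rw [hX'n i (hlt i hi)]
      exact contDiffOn_chartField p h.isOpen (h.smooth _))
    (hli.comp (fun i : Fin s.1 => Fin.castLE s.2.le i) (Fin.castLE_injective _))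
    (fun j hj i hij e he => by
      have hj' := hlt j hj
      have hi' := hij.trans hj'
      rw [hX'n j hj', hX'n i hi', lieBracket_chartField p h.isOpen (h.smooth _) (h.smooth _) he.1
        he.2]
      unfold chartField
      rw [VectorField.mpullback_apply, ← sum_coframe_smul (h.indep _ he.2)
        (lieBr (X ⟨j, hj'⟩) (X ⟨i, hi'⟩) (ψ e)), map_sum]
      refine Submodule.sum_mem _ fun k _ => ?_
      rw [map_smul]
      rcases le_or_gt k ⟨j, hj'⟩ with hk | hk
      · refine Submodule.smul_mem _ _ (Submodule.subset_span ⟨k.1, hk, ?_⟩)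
        simp only [hX']
        rfl
      · rw [h.invol ⟨i, hi'⟩ ⟨j, hj'⟩ hij _ he.2 k hk, zero_smul]
        exact Submodule.zero_mem _)
    (v := X' s e₀) (by
      have := hli.notMem_span_image (s := Iio s) (x := s) (by simp)
      refine fun hmem => this (Submodule.span_mono ?_ hmem)
      rintro _ ⟨i, rfl⟩
      exact ⟨Fin.castLE s.2.le i, i.2, rfl⟩)
  obtain ⟨hg, hgd⟩ := smooth_comp_chart p hO' (hO'O.trans inter_subset_left) hf
  set W := (extChartAt (𝓡 (n + 2)) p).source ∩ extChartAt (𝓡 (n + 2)) p ⁻¹' O' with hWdef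
  have hW : IsOpen W :=
    (continuousOn_extChartAt p).isOpen_inter_preimage (isOpen_extChartAt_source p) hO'
  have hWV : W ⊆ V := fun x hx => by
    have := (hO'O hx.2).2
    rwa [mem_preimage, hψ, (extChartAt (𝓡 (n + 2)) p).left_inv hx.1] at this
  have hder := SmoothFnOn.der hW ((h.smooth s).mono hWV) hg
  have hpW : p ∈ W := ⟨mem_extChartAt_source p, he'⟩
  -- The derivative along `X s` is known to be nonzero only at `p`; the neighbourhood is shrunk to
  -- keep it nonzero throughout.
  have hW' := hder.continuousOn.isOpen_inter_preimage hW (isOpen_compl_singleton (x := (0 : ℝ)))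
  refine ⟨_, _, hW', ⟨hpW, ?_⟩, inter_subset_left.trans hWV, hg.mono inter_subset_left,
    fun x hx l hl => ?_, fun x hx => hx.2⟩
  · rw [mem_preimage, hgd p hpW, ← hX' s]
    exact hfv
  · have := hgd x hx.1 (X l)
    rw [← hX' l, hf0 _ hx.1.2 l hl] at this
    exact this

/-- On a field already contracted, `Ω` has a repeated argument; on the omitted one, it is evaluated
on a permutation of the frame. -/
lemma isScaledCoframe_pfaffianForms (h : SolvableFrame V X) {Ω : TopForm (n + 2) M}
    (hΩ : IsVolumeFormOn V Ω) : IsScaledCoframe V X (pfaffianForms Ω X) := by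
  refine ⟨fun i Y hY => ?_, fun i x hx k hk => ?_, fun i x hx => ?_⟩
  · have := hΩ.1 (Fin.snoc (α := fun _ => VField (n + 2) M) (fun l => X (i.succ.succAbove l)) Y)
      (fun j => by
        refine Fin.lastCases ?_ (fun l => ?_) j
        · simpa using hY
        · simpa using h.smooth _)
    refine this.congr fun x hx => ?_
    rw [pfaffianForms_apply]
    congr 1
    funext j
    refine Fin.lastCases ?_ (fun l => ?_) j <;> simp
  · obtain ⟨l, rfl⟩ := Fin.exists_succAbove_eq hk
    rw [pfaffianForms_apply]
    refine (Ω x).map_eq_zero_of_eq _ (i := l.castSucc) (j := Fin.last _) (by simp) ?_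
    exact (Fin.castSucc_lt_last l).ne
  · rw [pfaffianForms_apply]
    refine map_frame_ne_zero ?_ (hΩ.2 x hx)
    let σ : Fin (n + 2) → Fin (n + 2) := Fin.snoc (α := fun _ => Fin (n + 2)) i.succ.succAbove i.succ
    have hσ : Function.Injective σ := by
      rw [Fin.snoc_injective_iff]
      exact ⟨Fin.succAbove_right_injective, fun ⟨l, hl⟩ => Fin.succAbove_ne _ _ hl⟩
    convert (h.indep x hx).comp σ hσ using 1
    funext j
    refine Fin.lastCases ?_ (fun l => ?_) j <;> simp [σ]

namespace IsScaledCoframe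

lemma linearIndependent (hη : IsScaledCoframe V X η) {x : M} (hx : x ∈ V) :
    LinearIndependent ℝ fun i => η i x := by
  rw [Fintype.linearIndependent_iff]
  intro c hc j
  have h1 := LinearMap.congr_fun hc (X j.succ x)
  rw [LinearMap.sum_apply, Finset.sum_eq_single j] at h1
  · simpa [hη.apply_self_ne j x hx] using h1
  · intro i _ hij
    rw [LinearMap.smul_apply, hη.apply_of_ne i x hx _ (by simpa using hij.symm), smul_zero]
  · simp

lemma _root_.JacobiCinf.SolvableFrame.mem_span_iff (h : SolvableFrame V X) {x : M} (hx : x ∈ V)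
    (v : TangentSpace (𝓡 (n + 2)) x) :
    v ∈ Submodule.span ℝ {X 0 x} ↔ ∀ i : Fin (n + 1), coframe X i.succ x v = 0 := by
  rw [Submodule.mem_span_singleton]
  constructor
  · rintro ⟨c, rfl⟩ i
    rw [map_smul, coframe_apply_frame (h.indep x hx), if_neg (Fin.succ_ne_zero i).symm, smul_zero]
  · intro hv
    refine ⟨coframe X 0 x v, ?_⟩
    conv_rhs => rw [← sum_coframe_smul (h.indep x hx) v, Fin.sum_univ_succ]
    simp [hv]

lemma annihilator (hη : IsScaledCoframe V X η) (h : SolvableFrame V X) {x : M} (hx : x ∈ V) :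
    (⨅ i, LinearMap.ker (η i x)) = Submodule.span ℝ {X 0 x} := by
  ext v
  rw [h.mem_span_iff hx, Submodule.mem_iInf]
  refine forall_congr' fun i => ?_
  rw [LinearMap.mem_ker, hη.apply_eq h i hx]
  simp [hη.apply_self_ne i x hx]

end IsScaledCoframe

section Solutions

variable {W : Set M} {g : Fin (n + 1) → M → ℝ}

namespace IsScaledCoframe

/-- By `hT` the vector `X i.succ` is tangent to the level sets of the later solutions, and `η i`
does not vanish on it. So `η_i ∧ dg_i = 0` there makes `dg_i` a multiple of the coframe member, and
regularity of the solution makes the factor nonzero. -/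
lemma dif_eq_of_solves_aux (hη : IsScaledCoframe V X η) (h : SolvableFrame V X) {i : Fin (n + 1)}
    (hs : SolvesPfaffian W η g i) {x : M} (hx : x ∈ V) (hxW : x ∈ W)
    (hT : ∀ v, (∀ l, i < l → dif (g l) x v = 0) ↔ ∀ l, i < l → coframe X l.succ x v = 0) :
    dif (g i) x (X i.succ x) ≠ 0 ∧ ∀ v, (∀ l, i < l → coframe X l.succ x v = 0) →
      dif (g i) x v = coframe X i.succ x v * dif (g i) x (X i.succ x) := by
  obtain ⟨⟨u, hu, hu0⟩, hs2⟩ := hs.2 x hxW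
  have hX : ∀ l, i < l → coframe X l.succ x (X i.succ x) = 0 := fun l hl => by
    rw [coframe_apply_frame (h.indep x hx), if_neg]
    simpa using hl.ne
  have key : ∀ v, (∀ l, i < l → coframe X l.succ x v = 0) →
      dif (g i) x v = coframe X i.succ x v * dif (g i) x (X i.succ x) := fun v hv => by
    have := hs2 _ (mem_levelTangent.2 ((hT _).2 hX)) v (mem_levelTangent.2 ((hT v).2 hv))
    rw [hη.apply_eq h i hx v] at this
    have h0 := hη.apply_self_ne i x hx
    have h1 : η i x (X i.succ x) *
        (dif (g i) x v - coframe X i.succ x v * dif (g i) x (X i.succ x)) = 0 := by linarith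
    exact sub_eq_zero.1 ((mul_eq_zero.1 h1).resolve_left h0)
  refine ⟨fun h0 => hu0 ?_, key⟩
  rw [key u ((hT u).1 (mem_levelTangent.1 hu)), h0, mul_zero]

/-- Descending induction on `k`: on the common kernel of the later differentials, the `k`-th
differential and the `k`-th coframe condition are proportional by `dif_eq_of_solves_aux`. -/
lemma forall_dif_eq_zero_iff (hη : IsScaledCoframe V X η) (h : SolvableFrame V X) (hWV : W ⊆ V)
    (k : ℕ) (hs : ∀ l : Fin (n + 1), k ≤ l.1 → SolvesPfaffian W η g l) {x : M} (hx : x ∈ W)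
    (v : TangentSpace (𝓡 (n + 2)) x) :
    (∀ l : Fin (n + 1), k ≤ l.1 → dif (g l) x v = 0) ↔
      ∀ l : Fin (n + 1), k ≤ l.1 → coframe X l.succ x v = 0 := by
  -- `m` bounds the number of remaining equations and turns the descent in `k` into an ordinary
  -- induction.
  obtain ⟨m, hm⟩ : ∃ m, n + 1 ≤ k + m := ⟨n + 1, by omega⟩
  induction m generalizing k v with
  | zero => exact ⟨fun _ l hl => absurd l.2 (by omega), fun _ l hl => absurd l.2 (by omega)⟩
  | succ m ih =>
    rcases Nat.lt_or_ge k (n + 1) with hk | hk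
    swap
    · exact ⟨fun _ l hl => absurd l.2 (by omega), fun _ l hl => absurd l.2 (by omega)⟩
    have ih' := fun v => ih (k + 1) (fun l hl => hs l (by omega)) v (by omega)
    obtain ⟨h1, h2⟩ := dif_eq_of_solves_aux hη h (i := ⟨k, hk⟩) (hs _ le_rfl) (hWV hx) hx ih'
    have hsplit : ∀ P : Fin (n + 1) → Prop, (∀ l : Fin (n + 1), k ≤ l.1 → P l) ↔
        P ⟨k, hk⟩ ∧ ∀ l : Fin (n + 1), k + 1 ≤ l.1 → P l := fun P =>
      ⟨fun hP => ⟨hP _ le_rfl, fun l hl => hP l (by omega)⟩, fun hP l hl => by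
        rcases hl.eq_or_lt with hl | hl
        · have : l = ⟨k, hk⟩ := Fin.ext hl.symm
          rw [this]; exact hP.1
        · exact hP.2 l hl⟩
    rw [hsplit, hsplit, ih']
    refine and_congr_left fun hv => ?_
    rw [h2 v hv, mul_eq_zero, or_iff_left h1]

lemma dif_eq_of_solves (hη : IsScaledCoframe V X η) (h : SolvableFrame V X) (hWV : W ⊆ V)
    (hs : ∀ l, SolvesPfaffian W η g l) (i : Fin (n + 1)) {x : M} (hx : x ∈ W) :
    dif (g i) x (X i.succ x) ≠ 0 ∧ ∀ v, (∀ l, i < l → coframe X l.succ x v = 0) →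
      dif (g i) x v = coframe X i.succ x v * dif (g i) x (X i.succ x) :=
  dif_eq_of_solves_aux hη h (hs i) (hWV hx) hx
    (fun v => forall_dif_eq_zero_iff hη h hWV (i.1 + 1) (fun l _ => hs l) hx v)

/-- The matrix `dg_i(X_{j+1})` vanishes for `i > j` and has nonzero diagonal, so the coefficients of
a linear relation vanish one after another. -/
lemma level_tangent (hη : IsScaledCoframe V X η) (h : SolvableFrame V X) (hWV : W ⊆ V)
    (hs : ∀ l, SolvesPfaffian W η g l) {x : M} (hx : x ∈ W) :
    LinearIndependent ℝ (fun i => dif (d := n + 2) (g i) x) ∧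
      (⨅ i, LinearMap.ker (dif (d := n + 2) (g i) x)) = Submodule.span ℝ {X 0 x} := by
  constructor
  · rw [Fintype.linearIndependent_iff]
    intro c hc j
    induction j using WellFoundedLT.induction with
    | ind j ih =>
      have h1 := LinearMap.congr_fun hc (X j.succ x)
      rw [LinearMap.sum_apply, Finset.sum_eq_single j] at h1
      · have := (dif_eq_of_solves hη h hWV hs j hx).1
        simpa [this] using h1
      · intro i _ hij
        rw [LinearMap.smul_apply]
        rcases lt_or_gt_of_ne hij with hij | hij
        · rw [ih i hij, zero_smul]
        · rw [(dif_eq_of_solves hη h hWV hs i hx).2, coframe_apply_frame (h.indep x (hWV hx)),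
            if_neg, zero_mul, smul_zero]
          · simpa using hij.ne
          · intro l hl
            rw [coframe_apply_frame (h.indep x (hWV hx)), if_neg]
            simpa using (hij.trans hl).ne
      · simp
  · ext v
    rw [h.mem_span_iff (hWV hx), Submodule.mem_iInf]
    simpa using forall_dif_eq_zero_iff hη h hWV 0 (fun l _ => hs l) hx v

/-- A first integral of the fields before `X i.succ`, not constant along it, serves for every choice
of `g`. On the level tangent the later frame components vanish, so both its differential and `η i`
are multiples of one coframe member. -/
lemma solvable (hη : IsScaledCoframe V X η) (h : SolvableFrame V X) {i : Fin (n + 1)}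
    (hW : IsOpen W) (hWV : W ⊆ V) (hs : ∀ l, i < l → SolvesPfaffian W η g l) {x : M} (hx : x ∈ W) :
    ∃ W' : Set M, IsOpen W' ∧ x ∈ W' ∧ W' ⊆ W ∧
      ∃ f : M → ℝ, SolvesPfaffian W' η (Function.update g i f) i := by
  obtain ⟨W₁, f, hW₁, hxW₁, hW₁V, hf, hf0, hf1⟩ := h.exists_first_integral (hWV hx) i.succ
  refine ⟨W₁ ∩ W, hW₁.inter hW, ⟨hxW₁, hx⟩, inter_subset_right, f, ?_⟩
  unfold SolvesPfaffian
  rw [Function.update_self]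
  refine ⟨hf.mono inter_subset_left, fun y hy => ?_⟩
  have hyV := hWV hy.2
  have hT : ∀ v, v ∈ levelTangent (Function.update g i f) i y ↔
      ∀ l, i < l → coframe X l.succ y v = 0 := fun v => by
    refine Iff.trans ?_ (forall_dif_eq_zero_iff hη h hWV (i.1 + 1) hs hy.2 v)
    rw [mem_levelTangent]
    refine forall_congr' fun l => forall_congr' fun hl => ?_
    rw [Function.update_of_ne (ne_of_gt hl)]
  have hd : ∀ v, (∀ l, i < l → coframe X l.succ y v = 0) →
      dif f y v = coframe X i.succ y v * dif f y (X i.succ y) := fun v hv => by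
    conv_lhs => rw [← sum_coframe_smul (h.indep y hyV) v, map_sum]
    rw [Finset.sum_eq_single i.succ]
    · rw [map_smul, smul_eq_mul]
    · intro a _ ha
      rw [map_smul, smul_eq_mul]
      rcases lt_or_gt_of_ne ha with ha | ha
      · rw [hf0 y hy.1 a ha, mul_zero]
      · obtain ⟨l, rfl⟩ := Fin.exists_succ_eq.2 (Fin.ne_zero_of_lt ha)
        rw [hv l (Fin.succ_lt_succ_iff.1 ha), zero_mul]
    · simp
  refine ⟨⟨X i.succ y, (hT _).2 fun l hl => ?_, hf1 y hy.1⟩, fun v hv w hw => ?_⟩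
  · rw [coframe_apply_frame (h.indep y hyV), if_neg]
    simpa using hl.ne
  · rw [hd v ((hT v).1 hv), hd w ((hT w).1 hw), hη.apply_eq h i hyV v, hη.apply_eq h i hyV w]
    ring

end IsScaledCoframe

end Solutions

end Frame


/-! ### Level sets of first integrals as trajectories. -/

section Curves

variable {d : ℕ} {M : Type*} [TopologicalSpace M] [ChartedSpace (EuclideanSpace ℝ (Fin d)) M]

lemma hasDerivAt_comp_integralCurve {X : VField d M} {γ : ℝ → M} {a b : ℝ}
    (hγ : IsMIntegralCurveOn (I := 𝓡 d) γ X (Ioo a b)) {W : Set M} (hW : IsOpen W) {f : M → ℝ}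
    (hf : SmoothFnOn d W f) {t : ℝ} (ht : t ∈ Ioo a b) (htW : γ t ∈ W) :
    HasDerivAt (fun s => f (γ s)) (dif f (γ t) (X (γ t))) t := by
  have h1 := (hγ t ht).hasMFDerivAt (Ioo_mem_nhds ht.1 ht.2)
  have h2 := (hf.mdifferentiableAt hW htW).hasMFDerivAt.comp t h1
  let L : ℝ →L[ℝ] ℝ := (mfderiv (𝓡 d) 𝓘(ℝ, ℝ) f (γ t)).comp
    ((1 : ℝ →L[ℝ] ℝ).smulRight (X (γ t)))
  have h3 : HasFDerivAt (fun s => f (γ s)) L t := h2.hasFDerivAt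
  have h4 : L 1 = dif f (γ t) (X (γ t)) := by
    change mfderiv (𝓡 d) 𝓘(ℝ, ℝ) f (γ t) ((1 : ℝ) • X (γ t)) = _
    rw [one_smul, dif_apply]
  rw [← h4]
  exact h3.hasDerivAt

lemma eq_of_dif_eq_zero_along {X : VField d M} {γ : ℝ → M} {a b : ℝ}
    (hγ : IsMIntegralCurveOn (I := 𝓡 d) γ X (Ioo a b)) {W : Set M} (hW : IsOpen W)
    (hγW : ∀ t ∈ Ioo a b, γ t ∈ W) {f : M → ℝ} (hf : SmoothFnOn d W f)
    (hX : ∀ x ∈ W, dif f x (X x) = 0) {s t : ℝ} (hs : s ∈ Ioo a b) (ht : t ∈ Ioo a b) :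
    f (γ s) = f (γ t) := by
  have hd : ∀ r ∈ Ioo a b, HasDerivAt (fun s => f (γ s)) 0 r := fun r hr => by
    have := hasDerivAt_comp_integralCurve hγ hW hf hr (hγW r hr)
    rwa [hX _ (hγW r hr)] at this
  exact isOpen_Ioo.is_const_of_deriv_eq_zero (f := fun s => f (γ s)) isPreconnected_Ioo
    (fun r hr => (hd r hr).differentiableAt.differentiableWithinAt) (fun r hr => (hd r hr).deriv)
    hs ht

variable [IsManifold (𝓡 d) ∞ M]

/-- Functions whose differentials have trivial common kernel are jointly locally injective. -/
lemma exists_injOn_of_dif {ι : Type*} [Fintype ι] (hι : Fintype.card ι = d) {W : Set M}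
    (hW : IsOpen W) {f : ι → M → ℝ} (hf : ∀ i, SmoothFnOn d W (f i)) {x : M} (hx : x ∈ W)
    (hker : ∀ v, (∀ i, dif (d := d) (f i) x v = 0) → v = 0) :
    ∃ W' : Set M, IsOpen W' ∧ x ∈ W' ∧ W' ⊆ W ∧
      ∀ y ∈ W', ∀ z ∈ W', (∀ i, f i y = f i z) → y = z := by
  set φ := extChartAt (𝓡 d) x with hφ
  have hO := isOpen_chart_preimage (d := d) x hW
  set O := φ.target ∩ φ.symm ⁻¹' W with hOdef
  have hex : φ.symm (φ x) = x := extChartAt_to_inv x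
  have heO : φ x ∈ O := ⟨mem_extChartAt_target x, by rw [mem_preimage, hex]; exact hx⟩
  let Θ : EuclideanSpace ℝ (Fin d) → ι → ℝ := fun e i => f i (φ.symm e)
  have hΘ : ContDiffOn ℝ ∞ Θ O := contDiffOn_pi.2 fun i => contDiffOn_chart_fn x (hf i)
  have hΘd : ∀ v i, fderiv ℝ Θ (φ x) v i = fderiv ℝ (fun e => f i (φ.symm e)) (φ x) v := by
    intro v i
    have h1 := ((hΘ.contDiffAt (hO.mem_nhds heO)).differentiableAt (by simp)).hasFDerivAt
    rw [((hasFDerivAt_pi'.1 h1) i).fderiv]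
    rfl
  have hinj : ∀ v, fderiv ℝ Θ (φ x) v = 0 → v = 0 := by
    intro v hv
    have h1 : ∀ i, dif (d := d) (f i) _ (mfderiv 𝓘(ℝ, EuclideanSpace ℝ (Fin d)) (𝓡 d) φ.symm (φ x) v) = 0 := by
      intro i
      rw [← fderiv_chart_fn x heO.1 ((hf i).mdifferentiableAt hW heO.2), ← hΘd, hv]
      rfl
    obtain ⟨A, hA⟩ := isInvertible_chart_symm x heO.1
    have hker' : ∀ v, (∀ i, dif (d := d) (f i) (φ.symm (φ x)) v = 0) → v = 0 := by
      rw [hex]; exact hker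
    have h2 := hker' _ h1
    rw [← hA] at h2
    exact A.map_eq_zero_iff.1 h2
  obtain ⟨e, he, hae, heO', -⟩ := exists_smooth_local_inverse hO hΘ heO
    (isInvertible_of_bijective hinj ((LinearMap.injective_iff_surjective_of_finrank_eq_finrank
      (f := (fderiv ℝ Θ (φ x)).toLinearMap) (by simp [hι])).1
      ((injective_iff_map_eq_zero _).2 hinj)))
  refine ⟨φ.source ∩ φ ⁻¹' e.source,
    (continuousOn_extChartAt x).isOpen_inter_preimage (isOpen_extChartAt_source x) e.open_source,
    ⟨mem_extChartAt_source x, hae⟩, fun y hy => ?_, fun y hy z hz hyz => ?_⟩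
  · have := (heO' hy.2).2
    rwa [mem_preimage, φ.left_inv hy.1] at this
  · refine φ.injOn hy.1 hz.1 (e.injOn hy.2 hz.2 ?_)
    rw [he, he]
    funext i
    simpa only [Θ, φ.left_inv hy.1, φ.left_inv hz.1] using hyz i

end Curves

section Frame

open Filter Topology

variable {n : ℕ} {M : Type*} [TopologicalSpace M]
  [ChartedSpace (EuclideanSpace ℝ (Fin (n + 2))) M] [IsManifold (𝓡 (n + 2)) ∞ M]
  {V : Set M} {X : Fin (n + 2) → VField (n + 2) M}

/-- If `g` is a complete set of first integrals of `X_0`, its level sets are locally the integral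
curves of `X_0`. -/
lemma SolvableFrame.exists_level_eq_curve (h : SolvableFrame V X) {W : Set M} (hW : IsOpen W)
    (hWV : W ⊆ V) {g : Fin (n + 1) → M → ℝ} (hg : ∀ i, SmoothFnOn (n + 2) W (g i))
    (hker : ∀ x ∈ W, (⨅ i, LinearMap.ker (dif (d := n + 2) (g i) x)) = Submodule.span ℝ {X 0 x})
    {x : M} (hx : x ∈ W) :
    ∃ W' : Set M, IsOpen W' ∧ x ∈ W' ∧ W' ⊆ W ∧
      ∃ (ε : ℝ) (γ : ℝ → M), 0 < ε ∧ γ 0 = x ∧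
        IsMIntegralCurveOn (I := 𝓡 (n + 2)) γ (X 0) (Ioo (-ε) ε) ∧
        γ '' Ioo (-ε) ε = {y ∈ W' | ∀ i, g i y = g i x} := by
  obtain ⟨W₁, τ₁, hW₁, hxW₁, hW₁V, hτ₁, -, hτ₁0⟩ := h.exists_first_integral (hWV hx) 0
  set c := dif τ₁ x (X 0 x) with hc
  have hc0 : c ≠ 0 := hτ₁0 x hxW₁
  -- The factor `c` gives `τ` the derivative `c * c > 0` along `X 0` at `x`, so `τ` is a local clock
  -- increasing along trajectories.
  let τ : M → ℝ := fun y => c * τ₁ y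
  have hτ : SmoothFnOn (n + 2) W₁ τ := contMDiffOn_const.mul hτ₁
  have hder : SmoothFnOn (n + 2) W₁ (der (X 0) τ) :=
    SmoothFnOn.der hW₁ ((h.smooth 0).mono hW₁V) hτ
  have hτx : 0 < der (X 0) τ x := by
    have : der (X 0) τ x = c * c := by
      unfold der
      have h1 := dif_mul (d := n + 2) (f := fun _ : M => c) mdifferentiableAt_const
        (hτ₁.mdifferentiableAt hW₁ hxW₁)
      rw [show dif (d := n + 2) τ x = _ from h1, dif_const]
      simp [hc]
    rw [this]
    exact mul_self_pos.2 hc0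
  set W₂ := W₁ ∩ der (X 0) τ ⁻¹' Ioi 0 with hW₂def
  have hW₂ : IsOpen W₂ := hder.continuousOn.isOpen_inter_preimage hW₁ isOpen_Ioi
  have hgX : ∀ y ∈ W, ∀ i, dif (d := n + 2) (g i) y (X 0 y) = 0 := fun y hy i => by
    have : X 0 y ∈ (⨅ i, LinearMap.ker (dif (d := n + 2) (g i) y)) := by
      rw [hker y hy]; exact Submodule.mem_span_singleton_self _
    exact (Submodule.mem_iInf _).1 this i
  -- The common kernel of the `dg_i` is the line of `X 0`, on which `dτ` is nonzero; hence these `n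
  -- + 2` functions are jointly injective near `x`.
  let Φ : Option (Fin (n + 1)) → M → ℝ := fun o => o.elim τ g
  obtain ⟨W₀, hW₀, hxW₀, hW₀W, hinj⟩ := exists_injOn_of_dif (d := n + 2)
    (ι := Option (Fin (n + 1))) (by simp)
    (hW₂.inter hW) (f := Φ) (fun o => by
      cases o with
      | none => exact hτ.mono (inter_subset_left.trans inter_subset_left)
      | some i => exact (hg i).mono inter_subset_right) (x := x) ⟨⟨hxW₁, hτx⟩, hx⟩ (fun v hv => by
      have h1 : v ∈ (⨅ i, LinearMap.ker (dif (d := n + 2) (g i) x)) :=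
        (Submodule.mem_iInf _).2 fun i => hv (some i)
      rw [hker x hx, Submodule.mem_span_singleton] at h1
      obtain ⟨a, rfl⟩ := h1
      have h2 : dif τ x (a • X 0 x) = 0 := hv none
      rw [map_smul, smul_eq_mul] at h2
      rw [(mul_eq_zero.1 h2).resolve_right hτx.ne', zero_smul])
  have : IsManifold (𝓡 (n + 2)) 1 M := IsManifold.of_le (n := ∞) (by simp)
  obtain ⟨γ, hγ0, hγ⟩ := exists_isMIntegralCurveAt_of_contMDiffAt_boundaryless (I := 𝓡 (n + 2))
    (v := X 0) 0 (((h.smooth 0).contMDiffAt h.isOpen (hWV hx)).of_le (by simp))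
  have hcont := hγ.continuousAt
  obtain ⟨ε₁, hε₁, hγ₁⟩ := isMIntegralCurveAt_iff'.1 hγ
  obtain ⟨ε₂, hε₂, hγ₂⟩ := Metric.mem_nhds_iff.1
    (hcont.preimage_mem_nhds (hW₀.mem_nhds (by rw [hγ0]; exact hxW₀)))
  set δ := min ε₁ ε₂ with hδdef
  have hδ : 0 < δ := lt_min hε₁ hε₂
  have hball : ∀ r ≤ δ, Ioo (-r) r ⊆ Metric.ball 0 ε₁ ∩ Metric.ball 0 ε₂ := fun r hr t ht => by
    have h1 : |t| < r := abs_lt.2 ht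
    simp only [mem_inter_iff, Metric.mem_ball, Real.dist_eq, sub_zero]
    exact ⟨h1.trans_le (hr.trans (min_le_left _ _)), h1.trans_le (hr.trans (min_le_right _ _))⟩
  have hγδ : IsMIntegralCurveOn (I := 𝓡 (n + 2)) γ (X 0) (Ioo (-δ) δ) :=
    hγ₁.mono fun t ht => (hball δ le_rfl ht).1
  have hγW : ∀ t ∈ Ioo (-δ) δ, γ t ∈ W₀ := fun t ht => hγ₂ (hball δ le_rfl ht).2
  have hu : ∀ t ∈ Ioo (-δ) δ, HasDerivAt (fun s => τ (γ s)) (der (X 0) τ (γ t)) t := fun t ht =>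
    hasDerivAt_comp_integralCurve hγδ hW₁ hτ ht (hW₀W (hγW t ht)).1.1
  have hmono : StrictMonoOn (fun s => τ (γ s)) (Ioo (-δ) δ) := by
    refine strictMonoOn_of_deriv_pos (convex_Ioo _ _)
      (fun t ht => (hu t ht).continuousAt.continuousWithinAt) fun t ht => ?_
    rw [interior_Ioo] at ht
    rw [(hu t ht).deriv]
    exact (hW₀W (hγW t ht)).1.2
  -- With half the interval, the end points `±ε` lie on the curve, and the clock values there bound
  -- `W'`. A point of the level set in `W'` shares its clock value with some `γ t` by the
  -- intermediate value theorem, and injectivity identifies the two.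
  set ε := δ / 2 with hεdef
  have hε : 0 < ε := by positivity
  have hsub : Icc (-ε) ε ⊆ Ioo (-δ) δ := fun t ht => ⟨by linarith [ht.1], by linarith [ht.2]⟩
  have hl : -ε ∈ Ioo (-δ) δ := hsub ⟨le_rfl, by linarith⟩
  have hr : ε ∈ Ioo (-δ) δ := hsub ⟨by linarith, le_rfl⟩
  have h0 : (0 : ℝ) ∈ Ioo (-δ) δ := ⟨by linarith, hδ⟩
  have hτW₀ : ContinuousOn τ W₀ := hτ.continuousOn.mono fun y hy => (hW₀W hy).1.1
  have hrange : ∀ t ∈ Ioo (-ε) ε, τ (γ t) ∈ Ioo (τ (γ (-ε))) (τ (γ ε)) := fun t ht =>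
    ⟨hmono hl (hsub (Ioo_subset_Icc_self ht)) ht.1, hmono (hsub (Ioo_subset_Icc_self ht)) hr ht.2⟩
  have hlevel : ∀ t ∈ Ioo (-δ) δ, ∀ i, g i (γ t) = g i x := fun t ht i => by
    rw [← hγ0]
    exact eq_of_dif_eq_zero_along hγδ hW (fun s hs => (hW₀W (hγW s hs)).2) (hg i)
      (fun y hy => hgX y hy i) ht h0
  refine ⟨W₀ ∩ τ ⁻¹' Ioo (τ (γ (-ε))) (τ (γ ε)), hτW₀.isOpen_inter_preimage hW₀ isOpen_Ioo,
    ⟨hxW₀, ?_⟩, fun y hy => (hW₀W hy.1).2, ε, γ, hε, hγ0,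
    hγδ.mono (Ioo_subset_Icc_self.trans hsub), ?_⟩
  · rw [mem_preimage, ← hγ0]
    exact hrange 0 ⟨by linarith, hε⟩
  · apply Subset.antisymm
    · rintro _ ⟨t, ht, rfl⟩
      have ht' := hsub (Ioo_subset_Icc_self ht)
      exact ⟨⟨hγW t ht', hrange t ht⟩, hlevel t ht'⟩
    · rintro y ⟨⟨hyW, hy⟩, hyg⟩
      have hcu : ContinuousOn (fun s => τ (γ s)) (Icc (-ε) ε) := fun t ht =>
        (hu t (hsub ht)).continuousAt.continuousWithinAt
      obtain ⟨t, ht, hty⟩ := intermediate_value_Ioo (by linarith) hcu hy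
      have ht' := hsub (Ioo_subset_Icc_self ht)
      refine ⟨t, ht, hinj _ (hγW t ht') y hyW fun o => ?_⟩
      cases o with
      | none => exact hty
      | some i => exact (hlevel t ht' i).trans (hyg i).symm

theorem SolvableFrame.integratedByPfaffians (h : SolvableFrame V X) {Ω : TopForm (n + 2) M}
    (hΩ : IsVolumeFormOn V Ω) : IntegratedByPfaffians V (X 0) (pfaffianForms Ω X) := by
  have hη := isScaledCoframe_pfaffianForms h hΩ
  exact
    { smooth := hη.smooth
      independent := fun x hx => hη.linearIndependent hx
      annihilator := fun x hx => hη.annihilator h hx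
      closed_mod := fun i => hη.closed_mod h i
      solvable := fun i W hW hWV g hs x hx => hη.solvable h hW hWV hs hx
      level_tangent := fun W _ hWV g hs x hx => hη.level_tangent h hWV hs hx
      motion_in_level := fun W hW hWV g hs a b γ hγ hγW i s hs' t ht => by
        refine eq_of_dif_eq_zero_along hγ hW hγW (hs i).1 (fun x hx => ?_) hs' ht
        have : X 0 x ∈ (⨅ i, LinearMap.ker (dif (d := n + 2) (g i) x)) := by
          rw [(hη.level_tangent h hWV hs hx).2]
          exact Submodule.mem_span_singleton_self _
        exact (Submodule.mem_iInf _).1 this i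
      level_is_motion := fun W hW hWV g hs x hx =>
        h.exists_level_eq_curve hW hWV (fun i => (hs i).1)
          (fun y hy => (hη.level_tangent h hWV hs hy).2) hx }

end Frame


/-! ### Algebra of the bivector pairing and of Hamiltonian vector fields. -/

section Bivector

variable {d : ℕ} {M : Type*} [TopologicalSpace M] [ChartedSpace (EuclideanSpace ℝ (Fin d)) M]

lemma SmoothFnOn.mdifferentiableAt_of_univ {f : M → ℝ} (hf : SmoothFnOn d univ f) (x : M) :
    MDifferentiableAt (𝓡 d) 𝓘(ℝ, ℝ) f x := hf.mdifferentiableAt isOpen_univ (mem_univ x)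

lemma der_add {Y : VField d M} {g h : M → ℝ} (hg : SmoothFnOn d univ g)
    (hh : SmoothFnOn d univ h) (x : M) :
    der Y (fun y => g y + h y) x = der Y g x + der Y h x := by
  unfold der
  rw [dif_add (hg.mdifferentiableAt_of_univ x) (hh.mdifferentiableAt_of_univ x)]
  rfl

lemma der_mul {Y : VField d M} {g h : M → ℝ} (hg : SmoothFnOn d univ g)
    (hh : SmoothFnOn d univ h) (x : M) :
    der Y (fun y => g y * h y) x = g x * der Y h x + h x * der Y g x := by
  unfold der
  rw [dif_mul (hg.mdifferentiableAt_of_univ x) (hh.mdifferentiableAt_of_univ x)]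
  simp only [LinearMap.add_apply, LinearMap.smul_apply, smul_eq_mul]

variable [IsManifold (𝓡 d) ∞ M] (Λ : Bivector d M)

namespace Bivector

lemma smoothFnOn_pair {f g : M → ℝ} (hf : SmoothFnOn d univ f) (hg : SmoothFnOn d univ g) :
    SmoothFnOn d univ (Λ.pair f g) :=
  SmoothFnOn.der isOpen_univ (Λ.smooth f hf) hg

lemma pair_swap (f g : M → ℝ) (x : M) : Λ.pair f g x = -Λ.pair g f x := by
  have h := Λ.skew x (dif f x + dif g x)
  rw [map_add, LinearMap.add_apply, map_add, map_add, Λ.skew, Λ.skew] at h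
  unfold pair
  linarith

lemma pair_add_right (f : M → ℝ) {g h : M → ℝ} (hg : SmoothFnOn d univ g)
    (hh : SmoothFnOn d univ h) (x : M) :
    Λ.pair f (fun y => g y + h y) x = Λ.pair f g x + Λ.pair f h x := by
  unfold pair
  rw [dif_add (hg.mdifferentiableAt_of_univ x) (hh.mdifferentiableAt_of_univ x)]
  rfl

lemma pair_sub_right (f : M → ℝ) {g h : M → ℝ} (hg : SmoothFnOn d univ g)
    (hh : SmoothFnOn d univ h) (x : M) :
    Λ.pair f (fun y => g y - h y) x = Λ.pair f g x - Λ.pair f h x := by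
  unfold pair
  rw [dif_sub (hg.mdifferentiableAt_of_univ x) (hh.mdifferentiableAt_of_univ x)]
  rfl

lemma pair_mul_right (f : M → ℝ) {g h : M → ℝ} (hg : SmoothFnOn d univ g)
    (hh : SmoothFnOn d univ h) (x : M) :
    Λ.pair f (fun y => g y * h y) x = g x * Λ.pair f h x + h x * Λ.pair f g x := by
  unfold pair
  rw [dif_mul (hg.mdifferentiableAt_of_univ x) (hh.mdifferentiableAt_of_univ x)]
  simp only [LinearMap.add_apply, LinearMap.smul_apply, smul_eq_mul]

end Bivector

end Bivector

namespace JacobiStructure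

section Hamiltonian

variable {d : ℕ} {M : Type*} [TopologicalSpace M] [ChartedSpace (EuclideanSpace ℝ (Fin d)) M]
  [IsManifold (𝓡 d) ∞ M] (J : JacobiStructure d M)

lemma smoothVFOn_ham {f : M → ℝ} (hf : SmoothFnOn d univ f) : SmoothVFOn univ (J.ham f) :=
  SmoothVFOn.add (J.biv.smooth f hf) (SmoothVFOn.smul hf J.smooth_reeb)

lemma der_ham (f k : M → ℝ) :
    der (J.ham f) k = fun x => J.biv.pair f k x + f x * der J.reeb k x := by
  funext x
  unfold der ham Bivector.pair
  rw [map_add, map_smul, smul_eq_mul]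

lemma smoothFnOn_der_reeb {f : M → ℝ} (hf : SmoothFnOn d univ f) :
    SmoothFnOn d univ (der J.reeb f) := SmoothFnOn.der isOpen_univ J.smooth_reeb hf

/-- This is `[Λ, E] = 0`, read as a derivation rule for `E`. -/
lemma der_reeb_pair {f g : M → ℝ} (hf : SmoothFnOn d univ f) (hg : SmoothFnOn d univ g) (x : M) :
    der J.reeb (J.biv.pair f g) x =
      J.biv.pair (der J.reeb f) g x + J.biv.pair f (der J.reeb g) x := by
  have h := J.schouten_reeb f g hf hg x
  unfold schoutenBV at h
  rw [J.biv.pair_swap f]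
  linarith

/-- The map `f ↦ X_f` takes the Jacobi bracket to the Lie bracket. -/
theorem lieBr_ham [T2Space M] {f g : M → ℝ} (hf : SmoothFnOn d univ f)
    (hg : SmoothFnOn d univ g) (x : M) :
    lieBr (J.ham f) (J.ham g) x = J.ham (J.bracket f g) x := by
  refine eq_of_forall_dif fun h hh => ?_
  -- Both sides are compared as derivations on a test function `h`. In the commutator the
  -- second-order terms in `E` cancel, and the iterated pairings are matched by the Schouten
  -- identity.
  have key : ∀ {f g : M → ℝ}, SmoothFnOn d univ f → SmoothFnOn d univ g →
      der (J.ham f) (der (J.ham g) h) x = J.biv.pair f (J.biv.pair g h) x +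
        (g x * J.biv.pair f (der J.reeb h) x + der J.reeb h x * J.biv.pair f g x) +
        f x * (J.biv.pair (der J.reeb g) h x + J.biv.pair g (der J.reeb h) x +
          (g x * der J.reeb (der J.reeb h) x + der J.reeb h x * der J.reeb g x)) := by
    intro f g hf hg
    have h1 := J.biv.smoothFnOn_pair hg hh
    have h2 := J.smoothFnOn_der_reeb hh
    have h3 : SmoothFnOn d univ fun y => g y * der J.reeb h y := hg.mul h2
    rw [J.der_ham g h, J.der_ham f]
    simp only
    rw [J.biv.pair_add_right f h1 h3, J.biv.pair_mul_right f hg h2, der_add h1 h3,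
      der_mul hg h2, J.der_reeb_pair hg hh]
  rw [dif_lieBr isOpen_univ (J.smoothVFOn_ham hf) (J.smoothVFOn_ham hg) hh (mem_univ x),
    key hf hg, key hg hf]
  have hfg := J.biv.smoothFnOn_pair hf hg
  have hEf := J.smoothFnOn_der_reeb hf
  have hEg := J.smoothFnOn_der_reeb hg
  have hfEg : SmoothFnOn d univ fun y => f y * der J.reeb g y := hf.mul hEg
  have hgEf : SmoothFnOn d univ fun y => g y * der J.reeb f y := hg.mul hEf
  have hsum : SmoothFnOn d univ fun y => J.biv.pair f g y + f y * der J.reeb g y := hfg.add hfEg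
  have hB : J.biv.pair (J.bracket f g) h x = J.biv.pair (J.biv.pair f g) h x +
      (f x * J.biv.pair (der J.reeb g) h x + der J.reeb g x * J.biv.pair f h x) -
      (g x * J.biv.pair (der J.reeb f) h x + der J.reeb f x * J.biv.pair g h x) := by
    rw [J.biv.pair_swap _ h]
    unfold bracket
    rw [J.biv.pair_sub_right h hsum hgEf, J.biv.pair_add_right h hfg hfEg,
      J.biv.pair_mul_right h hf hEg, J.biv.pair_mul_right h hg hEf, J.biv.pair_swap h,
      J.biv.pair_swap h f, J.biv.pair_swap h g, J.biv.pair_swap h (der J.reeb f),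
      J.biv.pair_swap h (der J.reeb g)]
    ring
  have hRHS : dif h x (J.ham (J.bracket f g) x) = der (J.ham (J.bracket f g)) h x := rfl
  rw [hRHS, J.der_ham]
  simp only
  rw [hB]
  have hS := J.schouten_self f g h hf hg hh x
  unfold schoutenBB wedgeVB at hS
  rw [J.biv.pair_swap (J.biv.pair g h) f, J.biv.pair_swap h f] at hS
  have hhf : J.biv.pair (J.biv.pair h f) g x = J.biv.pair g (J.biv.pair f h) x := by
    have : J.biv.pair h f = fun y => 0 - J.biv.pair f h y := by
      funext y
      rw [J.biv.pair_swap h f]; ring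
    rw [J.biv.pair_swap _ g, this, J.biv.pair_sub_right g contMDiffOn_const
      (J.biv.smoothFnOn_pair hf hh)]
    have h0 : J.biv.pair g (fun _ => 0) x = 0 := by
      unfold Bivector.pair
      rw [dif_const]; rfl
    rw [h0]; ring
  rw [hhf] at hS
  rw [J.biv.pair_swap g f]
  unfold bracket
  -- For equal arguments `schoutenBB` counts the cyclic sum twice, and `E ∧ Λ` also carries a factor
  -- 2; the half removes both.
  linear_combination -(1 / 2) * hS

/-- The chain rule applies to `Λ^♯ d(F ∘ f)`; substituting `Λ^♯ df_k = X_{f_k} - f_k E` leaves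
exactly the Reeb term of condition 3. -/
lemma ham_comp {m : ℕ} {F : (Fin m → ℝ) → ℝ} (hF : ContDiff ℝ ∞ F) {f : Fin m → M → ℝ}
    (hf : ∀ k, SmoothFnOn d univ (f k)) (x : M) :
    J.ham (fun y => F fun k => f k y) x =
      ∑ k, fderiv ℝ F (fun b => f b x) (Pi.single k 1) • J.ham (f k) x + J.reebTerm F f x := by
  unfold ham reebTerm
  rw [dif_comp ((hF.differentiable (by simp)).differentiableAt)
    fun k => (hf k).mdifferentiableAt_of_univ x]
  simp only [smul_add, smul_smul, Finset.sum_add_distrib, map_sum, map_smul, sub_smul,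
    Finset.sum_smul]
  have : ∀ k, fderiv ℝ F (fun b => f b x) (Pi.single k 1) * f k x =
    f k x * fderiv ℝ F (fun b => f b x) (Pi.single k 1) := fun k => mul_comm _ _
  simp only [this]
  abel

end Hamiltonian

end JacobiStructure

/-! ### From Jacobi `C^∞`-structures to involutive frames. -/

section Structure

lemma smoothFnOn_family {n : ℕ} {M : Type*} [TopologicalSpace M]
    [ChartedSpace (EuclideanSpace ℝ (Fin (n + 2))) M] {H : M → ℝ} {f : Fin n → M → ℝ}
    (hH : SmoothFnOn (n + 2) univ H) (hf : ∀ i, SmoothFnOn (n + 2) univ (f i))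
    (i : Fin (n + 1)) : SmoothFnOn (n + 2) univ (family H f i) := by
  refine Fin.cases ?_ (fun i => ?_) i
  · simpa [family] using hH
  · simpa [family] using hf i

variable {n : ℕ} {M : Type*} [TopologicalSpace M] [T2Space M]
  [ChartedSpace (EuclideanSpace ℝ (Fin (n + 2))) M] [IsManifold (𝓡 (n + 2)) ∞ M]
  {J : JacobiStructure (n + 2) M} {H : M → ℝ} {f : Fin n → M → ℝ} {V : Set M}
  {R : VField (n + 2) M}

/-- At the points of `U` the bracket of two Hamiltonian members is computed by `lieBr_ham` and
`ham_comp`. The set `V` may leave `U`, and there the relation is reached by density. -/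
theorem IsCompletion.solvableFrame (hR : IsCompletion J H f V R)
    (hH : SmoothFnOn (n + 2) univ H) (hf : IsJacobiCinfStructure J H f) :
    SolvableFrame V (hamFrame J H f R) := by
  obtain ⟨hV, hRs, hli⟩ := hR
  obtain ⟨hfs, U, hU, hUd, -, hF⟩ := hf
  have hfam := smoothFnOn_family hH hfs
  have hcast : ∀ i : Fin (n + 1), hamFrame J H f R i.castSucc = J.ham (family H f i) := fun i =>
    Fin.snoc_castSucc _ _ _
  have hsm : ∀ i, SmoothVFOn V (hamFrame J H f R i) := fun i => by
    refine Fin.lastCases ?_ (fun i => ?_) i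
    · simpa [hamFrame] using hRs
    · rw [hcast]
      exact (J.smoothVFOn_ham (hfam i)).mono (subset_univ V)
  refine ⟨hV, hsm, hli, fun i j hij x hx k hjk => ?_⟩
  -- Since some `k` exceeds `j`, neither `j` nor `i` is the last index, so `R` does not enter the
  -- bracket.
  obtain ⟨j, rfl⟩ := Fin.exists_castSucc_eq.2 (Fin.ne_last_of_lt hjk)
  obtain ⟨i, rfl⟩ := Fin.exists_castSucc_eq.2 (Fin.ne_last_of_lt hij)
  obtain ⟨F, hFs, hFb, hFU⟩ := hF i j (Fin.castSucc_lt_castSucc_iff.1 hij)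
  have hini : ∀ a, SmoothFnOn (n + 2) univ (initial (family H f) j a) := fun a => hfam _
  have hzero : ∀ y ∈ V ∩ U, coframe (hamFrame J H f R) k y
      (lieBr (hamFrame J H f R j.castSucc) (hamFrame J H f R i.castSucc) y) = 0 := by
    rintro y ⟨hyV, hyU⟩
    obtain ⟨W, -, hyW, c, -, hc⟩ := hFU y hyU
    have hham : ∀ a : Fin (j.1 + 1), coframe (hamFrame J H f R) k y
        (J.ham (initial (family H f) j a) y) = 0 := fun a => by
      have : J.ham (initial (family H f) j a) =
          hamFrame J H f R (Fin.castLE j.2 a).castSucc := (hcast _).symm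
      rw [this, coframe_apply_frame (hli y hyV), if_neg]
      refine ne_of_lt (lt_of_le_of_lt ?_ hjk)
      exact Nat.le_of_lt_succ a.2
    rw [hcast, hcast, J.lieBr_ham (hfam j) (hfam i), funext hFb, J.ham_comp hFs hini, hc y hyW,
      map_add, map_sum, map_sum, Finset.sum_eq_zero, Finset.sum_eq_zero, add_zero]
    · intro a _
      rw [map_smul, hham, smul_zero]
    · intro a _
      rw [map_smul, hham, smul_zero]
  have hcont := (smoothFormOn_coframe hV hsm hli k _
    (SmoothVFOn.lieBr hV (hsm j.castSucc) (hsm i.castSucc))).continuousOn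
  -- The coefficient is continuous on `V`, so a nonzero value would persist on a nonempty open set;
  -- that set meets the dense `U`, where the coefficient is zero.
  by_contra hne
  have hop := hcont.isOpen_inter_preimage hV (isOpen_compl_singleton (x := (0 : ℝ)))
  obtain ⟨y, hy, hyU⟩ := hUd.inter_open_nonempty _ hop ⟨x, hx, hne⟩
  exact hy.2 (hzero y ⟨hy.1, hyU⟩)

end Structure


/-! ### Existence of completions, near a point and on a dense open set. -/

section Completion

open Filter Topology

variable {n : ℕ} {M : Type*} [TopologicalSpace M]
  [ChartedSpace (EuclideanSpace ℝ (Fin (n + 2))) M] [IsManifold (𝓡 (n + 2)) ∞ M]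
  {J : JacobiStructure (n + 2) M} {H : M → ℝ} {f : Fin n → M → ℝ}

/-- All open `W' ⊆ W` are included because smoothness of `Ω` is tested on fields over the set
itself, which need not extend to `W`, so `IsVolumeFormOn` does not restrict formally. -/
lemma exists_completion_near (hfam : ∀ i, SmoothFnOn (n + 2) univ (family H f i)) {x : M}
    (hx : LinearIndependent ℝ fun i => J.ham (family H f i) x) :
    ∃ (W : Set M) (R : VField (n + 2) M) (Ω : TopForm (n + 2) M), x ∈ W ∧ IsOpen W ∧
      ∀ W' ⊆ W, IsOpen W' → IsCompletion J H f W' R ∧ IsVolumeFormOn W' Ω := by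
  obtain ⟨W, R, Ω, hW, hxW, hR, hli, hΩ⟩ :=
    exists_local_completion (fun i => J.smoothVFOn_ham (hfam i)) hx
  exact ⟨W, R, Ω, hxW, hW, fun W' hW' ho =>
    ⟨⟨ho, hR.mono hW', fun y hy => hli y (hW' hy)⟩, hΩ W' hW' ho⟩⟩

/-- Completions and volume forms on disjoint open sets can be glued. -/
lemma exists_completion_sUnion {S : Set (Set M)} (hdis : S.PairwiseDisjoint id)
    (hS : ∀ W ∈ S, ∃ (R : VField (n + 2) M) (Ω : TopForm (n + 2) M),
      IsCompletion J H f W R ∧ IsVolumeFormOn W Ω) :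
    ∃ (R : VField (n + 2) M) (Ω : TopForm (n + 2) M),
      IsCompletion J H f (⋃₀ S) R ∧ IsVolumeFormOn (⋃₀ S) Ω := by
  classical
  choose! R Ω hR hΩ using hS
  have hopen : IsOpen (⋃₀ S) := isOpen_sUnion fun W hW => (hR W hW).1
  -- Disjointness makes the chosen member the only one containing `x`, so `c` is constant on each
  -- piece and smoothness can be checked piece by piece.
  let c : M → Set M := fun x => if h : ∃ W ∈ S, x ∈ W then h.choose else ∅
  have hc : ∀ W ∈ S, ∀ x ∈ W, c x = W := fun W hW x hx => by
    have h : ∃ W ∈ S, x ∈ W := ⟨W, hW, hx⟩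
    simp only [c, dif_pos h]
    exact hdis.elim_set h.choose_spec.1 hW x h.choose_spec.2 hx
  refine ⟨fun x => R (c x) x, fun x => Ω (c x) x, ⟨hopen, ?_, ?_⟩, ?_, ?_⟩
  · rintro x ⟨W, hW, hx⟩
    have h1 : SmoothVFOn W fun x => R (c x) x := (hR W hW).2.1.congr fun y hy => by
      rw [hc W hW y hy]
    exact (h1.contMDiffAt (hR W hW).1 hx).contMDiffWithinAt
  · rintro x ⟨W, hW, hx⟩
    convert (hR W hW).2.2 x hx using 1
    funext i
    refine Fin.lastCases ?_ (fun i => ?_) i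
    · simp [hamFrame, hc W hW x hx]
    · simp [hamFrame]
  · intro Y hY
    rintro x ⟨W, hW, hx⟩
    have h1 : SmoothFnOn (n + 2) W fun x => Ω (c x) x fun i => Y i x :=
      ((hΩ W hW).1 Y fun i => (hY i).mono (subset_sUnion_of_mem hW)).congr fun y hy => by
        rw [hc W hW y hy]
    exact (h1.contMDiffAt (hR W hW).1 hx).contMDiffWithinAt
  · rintro x ⟨W, hW, hx⟩
    change Ω (c x) x ≠ 0
    rw [hc W hW x hx]
    exact (hΩ W hW).2 x hx

/-- A maximal disjoint family of open sets carrying a completion and a volume form has dense union: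
otherwise `U` meets the complement of the closure, and a local completion restricted to that
complement could be added. -/
theorem exists_dense_completion (hfam : ∀ i, SmoothFnOn (n + 2) univ (family H f i)) {U : Set M}
    (hU : Dense U) (hli : ∀ x ∈ U, LinearIndependent ℝ fun i => J.ham (family H f i) x) :
    ∃ (V : Set M) (R : VField (n + 2) M) (Ω : TopForm (n + 2) M),
      Dense V ∧ IsCompletion J H f V R ∧ IsVolumeFormOn V Ω := by
  let 𝒮 : Set (Set (Set M)) := {S | S.PairwiseDisjoint id ∧
    ∀ W ∈ S, ∃ (R : VField (n + 2) M) (Ω : TopForm (n + 2) M),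
      IsCompletion J H f W R ∧ IsVolumeFormOn W Ω}
  obtain ⟨S, hS⟩ := zorn_subset 𝒮 fun c hc hchain => ⟨⋃₀ c,
    ⟨(pairwiseDisjoint_sUnion hchain.directedOn).2 fun T hT => (hc hT).1, by
      rintro W ⟨T, hT, hWT⟩
      exact (hc hT).2 W hWT⟩, fun T hT => subset_sUnion_of_mem hT⟩
  obtain ⟨R, Ω, hR, hΩ⟩ := exists_completion_sUnion hS.prop.1 hS.prop.2
  refine ⟨⋃₀ S, R, Ω, ?_, hR, hΩ⟩
  by_contra hd
  rw [dense_iff_closure_eq, ← ne_eq, ne_univ_iff_exists_notMem] at hd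
  obtain ⟨y, hy⟩ := hd
  obtain ⟨x, hx, hxU⟩ := hU.inter_open_nonempty _ isClosed_closure.isOpen_compl ⟨y, hy⟩
  obtain ⟨W, R', Ω', hxW, hW, hW'⟩ := exists_completion_near hfam (hli x hxU)
  have hT : insert (W ∩ (closure (⋃₀ S))ᶜ) S ∈ 𝒮 := by
    refine ⟨hS.prop.1.insert fun T hT _ => ?_, ?_⟩
    · exact disjoint_left.2 fun z hz hzT => hz.2 (subset_closure ⟨T, hT, hzT⟩)
    · rintro T (rfl | hT)
      · exact ⟨R', Ω', hW' _ inter_subset_left (hW.inter isClosed_closure.isOpen_compl)⟩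
      · exact hS.prop.2 T hT
  have hmem := hS.le_of_ge hT (subset_insert _ _) (mem_insert _ _)
  exact hx (subset_closure ⟨_, hmem, hxW, hx⟩)

end Completion

end JacobiCinf

end

/-! ### The theorem on exact integration. -/

theorem mainTheorem2 {n : ℕ} {M : Type*} [TopologicalSpace M] [T2Space M]
    [SecondCountableTopology M] [ChartedSpace (EuclideanSpace ℝ (Fin (n + 2))) M]
    [IsManifold (𝓡 (n + 2)) ∞ M]
    (J : JacobiCinf.JacobiStructure (n + 2) M) (H : M → ℝ)
    (hH : JacobiCinf.SmoothFnOn (n + 2) Set.univ H) (f : Fin n → M → ℝ)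
    (hf : JacobiCinf.IsJacobiCinfStructure J H f) :
    (∀ (V : Set M) (R : JacobiCinf.VField (n + 2) M), JacobiCinf.IsCompletion J H f V R →
      JacobiCinf.IsCinfStructure V (JacobiCinf.moduleSpan V (fun _ : Fin 1 => J.ham H))
        (fun i : Fin (n + 1) => JacobiCinf.hamFrame J H f R i.succ) ∧
      ∀ Ω : JacobiCinf.TopForm (n + 2) M, JacobiCinf.IsVolumeFormOn V Ω →
        JacobiCinf.IntegratedByPfaffians V (J.ham H)
          (JacobiCinf.pfaffianForms Ω (JacobiCinf.hamFrame J H f R))) ∧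
    (∃ (V : Set M) (R : JacobiCinf.VField (n + 2) M) (Ω : JacobiCinf.TopForm (n + 2) M),
      Dense V ∧ JacobiCinf.IsCompletion J H f V R ∧ JacobiCinf.IsVolumeFormOn V Ω) ∧
    (∀ x : M, LinearIndependent ℝ (fun i => J.ham (JacobiCinf.family H f i) x) →
      ∃ (V : Set M) (R : JacobiCinf.VField (n + 2) M) (Ω : JacobiCinf.TopForm (n + 2) M),
        x ∈ V ∧ JacobiCinf.IsCompletion J H f V R ∧ JacobiCinf.IsVolumeFormOn V Ω) := by
  have hfam := JacobiCinf.smoothFnOn_family hH hf.1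
  refine ⟨fun V R hR => ?_, ?_, fun x hx => ?_⟩
  · have h := hR.solvableFrame hH hf
    have h0 : JacobiCinf.hamFrame J H f R 0 = J.ham H := by
      rw [← Fin.castSucc_zero]
      exact Fin.snoc_castSucc _ _ _
    rw [← h0]
    exact ⟨h.isCinfStructure, fun Ω hΩ => h.integratedByPfaffians hΩ⟩
  · obtain ⟨U, -, hUd, hli, -⟩ := hf.2
    exact JacobiCinf.exists_dense_completion hfam hUd hli
  · obtain ⟨W, R, Ω, hxW, hW, h⟩ := JacobiCinf.exists_completion_near hfam hx
    exact ⟨W, R, Ω, hxW, h W subset_rfl hW⟩
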